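/- \textbf{Model.} Consider a one-channel queue without waiting room. The state space is $S=[0,1]$: state $0$ means that the system is idle, state $x\in(0,1]$ that a job of volume $x$ is in service. The action space is $A=[0,\infty)$, with admissible sets $A(0)=\{0\}$ and $A(x)=[0,\bar A/x]$ for $x\in(0,1]$, where $\bar A\ge0$. Jobs arrive at rate $\lambda>0$ with volume density $5y^4$ on $(0,1]$; jobs that find the server busy are lost; the service time of a job of volume $x$ under action $a$ is exponential with parameter $a/x$. So the transition rates are $$q(\Gamma|0,0)=5\lambda\int_{\Gamma\setminus\{0\}}y^4dy-\lambda I\{0\in\Gamma\},\qquad q(\Gamma|x,a)=\frac ax\left(I\{0\in\Gamma\}-I\{x\in\Gamma\}\right)\ \ (x\in(0,1]).$$ The cost rate is $c_0(0,0)=0$ and $c_0(x,a)=C_1x+C_2a^2-\frac ax$ for $x\in(0,1]$, with $C_1,C_2\ge0$. The discount factor satisfies $\alpha>4\lambda$, and the initial distribution $\gamma$ (a probability measure on $[0,1]$) satisfies $\int_{(0,1]}y^{-4}\gamma(dy)<\infty$. Put $q_x(a)=-q(\{x\}|x,a)$ and $\bar q_x=\sup_{a\in A(x)}q_x(a)$.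 A policy is a transition probability $\pi(da|\omega,t)$ that is predictable with respect to the history of the controlled process $\xi$ (randomized and history-dependent) and is concentrated on $A(\xi_{t-})$. Under $\pi$, the process starts from $\gamma$ and jumps with intensity $\int_A\pi(da|\omega,t)\,q(\Gamma\setminus\{\xi_{t-}\}|\xi_{t-},a)$; its law is denoted by $P^\pi_\gamma$, and $$V_0(\pi)=E^\pi_\gamma\left[\int_0^\infty e^{-\alpha t}\int_Ac_0(\xi_{t-},a)\,\pi(da|\omega,t)\,dt\right].$$ For each policy $\pi$ the law $P^\pi_\gamma$ exists and is unique, and the negative part of the cost has a finite expected discounted total, so that $V_0(\pi)\in(-\infty,\infty]$ is well defined. A policy is optimal if it attains $\inf_\pi V_0(\pi)$ over all policies. \textbf{Theorem 5.} (a) The primitives form a continuous-time Markov decision process: the sets $A(x)$ and $K=\{(x,a):a\in A(x)\}$ are measurable, $K$ contains the graph of a measurable map, and the cost rate and the transition rate are measurable on $K$, the transition rate being nonnegative off $\{x\}$, conservative ($q(S|x,a)=0$) and stable ($\bar q_x<\infty$). There are measurable functions $w,w'\ge1$ on $S$ and constants $\rho,b,L',\rho',b'\ge0$ such that: (1) there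 are measurable sets $S_l\uparrow S$ with $\inf_{S\setminus S_l}w\to\infty$ and $\sup_{S_l}\bar q_x<\infty$ for each $l$, and $\int_S q(dy|x,a)w(y)\le\rho w(x)+b$ for all $x\in S$, $a\in A(x)$; (2) $\int w\,d\gamma<\infty$, $\alpha>\rho$, and $|\inf_{a\in A(x)}c_0(x,a)|\le Mw(x)+c$ for some constants $M,c\ge0$; (3) each $A(x)$ is compact and $q_x(a)$ is upper semicontinuous in $a\in A(x)$; (4) $0\le\bar q_x<Lw(x)$ for some constant $L>0$; (5) $(\bar q_x+1)w'(x)\le L'w(x)$, $\int_S q(dy|x,a)w'(y)\le\rho'w'(x)+b'$ for all $x\in S$, $a\in A(x)$, $\alpha>\rho'$, and $|\inf_{a\in A(x)}c_0(x,a)|\le M'w'(x)+c'$ for some constants $M',c'\ge0$; (6) for each $x$, $A(x)$ is compact, $\int_S g(y)q(dy|x,a)$ is lower semicontinuous in $a\in A(x)$ for every bounded nonnegative measurable $g$, $\int_S w(y)q(dy|x,a)$ is continuous in $a\in A(x)$, and $c_0(x,a)$ is lower semicontinuous in $a\in A(x)$. (b) Suppose $\frac{C_1}{2\alpha}\le1$,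 and for $x\in(0,1]$, $z\ge0$ let $$u(x,z)=-2\alpha C_2x^2-z+2\sqrt{\alpha^2C_2^2x^4+C_1C_2x^3+\alpha C_2x^2z}.$$ Define $z^{(0)}=0$, $u^{(n)}(x)=u(x,z^{(n)})$ and $z^{(n+1)}=1-\frac{5\lambda}{\alpha+\lambda}\int_0^1u^{(n)}(y)y^4dy$ for $n\ge0$. Then $z^{(n)}$ is (strictly) increasing and has a finite limit $z^*$, and $\lim_{n\to\infty}u^{(n)}(x)=u(x,z^*)=:u^*(x)$ for all $x\in(0,1]$. (c) Suppose in addition that $C_2>0$ and $\frac{u^*(x)+z^*}{2C_2}\le\bar A$ for all $x\in(0,1]$. Then $u^*$, supplemented by $u^*(0)=1-z^*$, solves the Bellman equation $$\alpha u(x)=\inf_{a\in A(x)}\left\{c_0(x,a)+\int_Sq(dy|x,a)u(y)\right\},\qquad x\in S,$$ and $\phi^*(x)=\frac{u^*(x)+z^*}{2xC_2}$ for $x\in(0,1]$, $\phi^*(0)=0$, is a measurable map with $\phi^*(x)\in A(x)$ whose deterministic stationary policy is optimal. -/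

import Mathlib

open MeasureTheory Filter Topology Set
open scoped NNReal ENNReal

noncomputable section

/-! ## Discounted continuous-time Markov decision processes -/

/-- The primitives of a discounted CTMDP with state space `S` and action space `A`
(both Borel spaces), apart from the initial distribution. The requirements on these data are
collected in `CTMDP.IsModel`. -/
structure CTMDP (S A : Type*) [MeasurableSpace S] where
  /-- the set `A(x)` of admissible actions at `x` -/
  admissible : S → Set A
  /-- the transition rate `q(dy | x, a)`; only the values at admissible pairs matter -/
  rate : S → A → SignedMeasure S
  /-- the cost rate `c₀(x, a)`; only the values at admissible pairs matter -/
  cost : S → A → ℝ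
  /-- the discount factor `α` -/
  discount : ℝ

namespace CTMDP

variable {S A : Type*} [MeasurableSpace S]

/-- The set `K` of admissible state-action pairs. -/
def admissiblePairs (M : CTMDP S A) : Set (S × A) := {p | p.2 ∈ M.admissible p.1}

/-- `q_x(a) = - q({x} | x, a)`. -/
def exitRate (M : CTMDP S A) (x : S) (a : A) : ℝ := -(M.rate x a {x})

/-- `q̄_x = sup_{a ∈ A(x)} q_x(a)`. -/
def supExitRate (M : CTMDP S A) (x : S) : ℝ := sSup (M.exitRate x '' M.admissible x)

/-- The standing requirements on the primitives of a CTMDP. -/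
structure IsModel [MeasurableSpace A] (M : CTMDP S A) : Prop where
  measurableSet_admissible : ∀ x, MeasurableSet (M.admissible x)
  measurableSet_pairs : MeasurableSet M.admissiblePairs
  exists_selector : ∃ φ : S → A, Measurable φ ∧ ∀ x, φ x ∈ M.admissible x
  measurable_rate : ∀ Γ : Set S, MeasurableSet Γ →
    Measurable fun p : M.admissiblePairs => M.rate p.1.1 p.1.2 Γ
  rate_nonneg : ∀ x, ∀ a ∈ M.admissible x, ∀ Γ : Set S, MeasurableSet Γ → x ∉ Γ →
    0 ≤ M.rate x a Γ
  conservative : ∀ x, ∀ a ∈ M.admissible x, M.rate x a univ = 0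
  stable : ∀ x, BddAbove (M.exitRate x '' M.admissible x)
  measurable_cost : Measurable fun p : M.admissiblePairs => M.cost p.1.1 p.1.2
  discount_pos : 0 < M.discount

/-! ### Conditions on the primitives -/

/-- Lyapunov-type condition with weight `w` and constants `ρ`, `b` (non-explosion). -/
structure RegularityCondition (M : CTMDP S A) (w : S → ℝ) (ρ b : ℝ) : Prop where
  measurable_weight : Measurable w
  one_le_weight : ∀ x, 1 ≤ w x
  rho_nonneg : 0 ≤ ρ
  b_nonneg : 0 ≤ b
  /-- There are measurable sets `S_l ↑ S` with `inf_{S ∖ S_l} w → ∞` and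
  `sup_{S_l} q̄ < ∞` for each `l`. -/
  exhaustion : ∃ Sl : ℕ → Set S, (∀ l, MeasurableSet (Sl l)) ∧ Monotone Sl ∧
    (⋃ l, Sl l) = univ ∧
    (∀ R : ℝ, ∀ᶠ l in atTop, ∀ x, x ∉ Sl l → R ≤ w x) ∧
    ∀ l, BddAbove (M.supExitRate '' Sl l)
  integrable_weight : ∀ x, ∀ a ∈ M.admissible x, (M.rate x a).Integrable w
  drift : ∀ x, ∀ a ∈ M.admissible x, ∫ᵛ y, w y ∂<•(M.rate x a) ≤ ρ * w x + b

/-- `|inf_{a ∈ A(x)} c₀(x, a)| ≤ C w(x) + c` for all `x`, for some constants `C, c ≥ 0`. -/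
def CostBound (M : CTMDP S A) (w : S → ℝ) : Prop :=
  ∃ C c : ℝ, 0 ≤ C ∧ 0 ≤ c ∧ ∀ x, BddBelow (M.cost x '' M.admissible x) ∧
    |sInf (M.cost x '' M.admissible x)| ≤ C * w x + c

/-- The condition under which the performance functional is well defined. -/
structure FinitenessCondition (M : CTMDP S A) (γ : Measure S) (w : S → ℝ) (ρ : ℝ) : Prop where
  integrable_initial : Integrable w γ
  rho_lt_discount : ρ < M.discount
  cost_bound : M.CostBound w

/-- Compact action sets and upper semicontinuity of `q_x(a)` in `a`. -/
structure ExitRateCondition [TopologicalSpace A] (M : CTMDP S A) : Prop where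
  compact_admissible : ∀ x, IsCompact (M.admissible x)
  usc_exitRate : ∀ x, UpperSemicontinuousOn (M.exitRate x) (M.admissible x)

/-- `0 ≤ q̄_x < L w(x)` for some constant `L > 0`. -/
def StrongRegularityCondition (M : CTMDP S A) (w : S → ℝ) : Prop :=
  ∃ L : ℝ, 0 < L ∧ ∀ x, 0 ≤ M.supExitRate x ∧ M.supExitRate x < L * w x

/-- The condition with a second weight `w'` behind Dynkin's formula and dynamic programming. -/
structure DynamicProgrammingCondition (M : CTMDP S A) (w w' : S → ℝ) (L' ρ' b' : ℝ) :
    Prop where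
  measurable_weight : Measurable w'
  one_le_weight : ∀ x, 1 ≤ w' x
  L_nonneg : 0 ≤ L'
  rho_nonneg : 0 ≤ ρ'
  b_nonneg : 0 ≤ b'
  weight_le : ∀ x, (M.supExitRate x + 1) * w' x ≤ L' * w x
  integrable_weight : ∀ x, ∀ a ∈ M.admissible x, (M.rate x a).Integrable w'
  drift : ∀ x, ∀ a ∈ M.admissible x, ∫ᵛ y, w' y ∂<•(M.rate x a) ≤ ρ' * w' x + b'
  rho_lt_discount : ρ' < M.discount
  cost_bound : M.CostBound w'

/-- The compactness-continuity condition with weight `w`. -/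
structure CompactnessContinuityCondition [TopologicalSpace A] (M : CTMDP S A) (w : S → ℝ) :
    Prop where
  lsc_rate : ∀ u : S → ℝ, Measurable u → (∀ y, 0 ≤ u y) → BddAbove (range u) → ∀ x,
    LowerSemicontinuousOn (fun a => ∫ᵛ y, u y ∂<•(M.rate x a)) (M.admissible x)
  integrable_weight : ∀ x, ∀ a ∈ M.admissible x, (M.rate x a).Integrable w
  continuous_weight : ∀ x,
    ContinuousOn (fun a => ∫ᵛ y, w y ∂<•(M.rate x a)) (M.admissible x)
  lsc_cost : ∀ x, LowerSemicontinuousOn (M.cost x) (M.admissible x)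
  compact_admissible : ∀ x, IsCompact (M.admissible x)

/-- `u` is a measurable solution of the Bellman equation
`α u(x) = inf_{a ∈ A(x)} { c₀(x, a) + ∫ q(dy | x, a) u(y) }`. -/
structure SolvesBellman (M : CTMDP S A) (u : S → ℝ) : Prop where
  measurable : Measurable u
  integrable : ∀ x, ∀ a ∈ M.admissible x, (M.rate x a).Integrable u
  equation : ∀ x, IsGLB
    ((fun a => M.cost x a + ∫ᵛ y, u y ∂<•(M.rate x a)) '' M.admissible x) (M.discount * u x)

end CTMDP

/-! ## The sample space -/

/-- A point `(x₀, θ₁, x₁, θ₂, …)` of the sample space: either all `x_m ∈ S` and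
`θ_m ∈ (0, ∞)`, or from some index on the sequence is `∞, x_∞, ∞, x_∞, …`.
Here `S_∞ = S ⊕ Unit`, `x_∞ = Sum.inr ()`, and `sojourn m` is `θ_{m+1}`. -/
structure Trajectory (S : Type*) where
  state : ℕ → S ⊕ Unit
  sojourn : ℕ → ℝ≥0∞
  state_zero : ∃ x, state 0 = Sum.inl x
  sojourn_pos : ∀ m, 0 < sojourn m
  sojourn_eq_top_iff : ∀ m, sojourn m = ⊤ ↔ state (m + 1) = Sum.inr ()
  absorbed : ∀ m, sojourn m = ⊤ → sojourn (m + 1) = ⊤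

namespace Trajectory

variable {S : Type*}

/-- The jump moments `T_m = θ₁ + ⋯ + θ_m`. -/
def jumpTime (ω : Trajectory S) (m : ℕ) : ℝ≥0∞ := ∑ i ∈ Finset.range m, ω.sojourn i

open Classical in
/-- The left limit `ξ_{t-}`: it is `x_m` for `T_m < t ≤ T_{m+1}`, `x₀` for `t = 0`, and `x_∞`
from the explosion time `T_∞` on. -/
def leftState (ω : Trajectory S) (t : ℝ≥0) : S ⊕ Unit :=
  if h : ∃ m, ω.jumpTime m < (t : ℝ≥0∞) ∧ (t : ℝ≥0∞) ≤ ω.jumpTime (m + 1) then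
    ω.state (Nat.find h)
  else if t = 0 then ω.state 0 else Sum.inr ()

/-- The trajectory `(x₀, θ₁, …, θ_k, x_k, ∞, x_∞, ∞, x_∞, …)` with the `k`-component history of
`ω` and no further jumps. -/
def freeze (ω : Trajectory S) (k : ℕ) : Trajectory S where
  state m := if m ≤ k then ω.state m else Sum.inr ()
  sojourn m := if m < k then ω.sojourn m else ⊤
  state_zero := by simpa using ω.state_zero
  sojourn_pos m := by
    split_ifs
    · exact ω.sojourn_pos m
    · exact ENNReal.zero_lt_top
  sojourn_eq_top_iff m := by
    by_cases h : m < k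
    · have h2 : m + 1 ≤ k := h
      simp only [h, h2, if_true]
      exact ω.sojourn_eq_top_iff m
    · have h2 : ¬ m + 1 ≤ k := h
      simp [h, h2]
  absorbed m := by
    by_cases h : m + 1 < k
    · have h2 : m < k := by omega
      simp only [h, h2, if_true]
      exact ω.absorbed m
    · simp [h]

variable [MeasurableSpace S]

instance : MeasurableSpace (Trajectory S) :=
  MeasurableSpace.comap (fun ω => (ω.state, ω.sojourn)) inferInstance

lemma measurable_state (m : ℕ) : Measurable fun ω : Trajectory S => ω.state m := by
  have h : Measurable fun ω : Trajectory S => (ω.state, ω.sojourn) := comap_measurable _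
  exact (measurable_pi_apply m).comp (measurable_fst.comp h)

lemma measurable_sojourn (m : ℕ) : Measurable fun ω : Trajectory S => ω.sojourn m := by
  have h : Measurable fun ω : Trajectory S => (ω.state, ω.sojourn) := comap_measurable _
  exact (measurable_pi_apply m).comp (measurable_snd.comp h)

lemma measurable_jumpTime (m : ℕ) : Measurable fun ω : Trajectory S => ω.jumpTime m :=
  Finset.measurable_sum _ fun i _ => measurable_sojourn i

/-- The σ-algebra generated by the `k`-component history `h_k = (x₀, θ₁, x₁, …, θ_k, x_k)`. -/
abbrev historySigma (S : Type*) [MeasurableSpace S] (k : ℕ) : MeasurableSpace (Trajectory S) :=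
  MeasurableSpace.comap
    (fun ω => ((fun i : Fin (k + 1) => ω.state i), (fun i : Fin k => ω.sojourn i)))
    inferInstance

/-- The filtration `F_t = σ({T_m ≤ s, x_m ∈ Γ} : Γ ∈ B(S), s ≤ t, m ≥ 0)`. -/
def filtration (S : Type*) [MeasurableSpace S] :
    Filtration ℝ≥0 (inferInstance : MeasurableSpace (Trajectory S)) where
  seq t := MeasurableSpace.generateFrom
    {E | ∃ s ≤ t, ∃ m : ℕ, ∃ Γ : Set S, MeasurableSet Γ ∧
      E = {ω | ω.jumpTime m ≤ (s : ℝ≥0∞) ∧ ω.state m ∈ Sum.inl '' Γ}}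
  mono' := by
    intro t t' htt'
    apply MeasurableSpace.generateFrom_mono
    rintro E ⟨s, hs, m, Γ, hΓ, rfl⟩
    exact ⟨s, hs.trans htt', m, Γ, hΓ, rfl⟩
  le' := by
    intro t
    apply MeasurableSpace.generateFrom_le
    rintro E ⟨s, hs, m, Γ, hΓ, rfl⟩
    exact (measurableSet_le (measurable_jumpTime m) measurable_const).inter
      (measurable_state m hΓ.inl_image)

end Trajectory

/-- Lebesgue measure on the time axis `[0, ∞)`. -/
def timeMeasure : Measure ℝ≥0 := (volume : Measure ℝ).comap ((↑) : ℝ≥0 → ℝ)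

/-! ## Policies, the controlled law, and the optimization problem -/

namespace CTMDP

variable {S A : Type*} [MeasurableSpace S] [MeasurableSpace A]

/-- `A(x)` for `x ∈ S_∞ = S ⊕ Unit`, as a subset of `A_∞ = A ⊕ Unit`; `A(x_∞) = {a_∞}`. -/
def admissibleExt (M : CTMDP S A) : S ⊕ Unit → Set (A ⊕ Unit) :=
  Sum.elim (fun x => Sum.inl '' M.admissible x) (fun _ => {Sum.inr ()})

/-- `π` is a randomized history-dependent policy: a predictable transition probability
`π(da | ω, t)` on `A_∞`, concentrated on `A(ξ_{t-})`. -/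
structure IsPolicy (M : CTMDP S A) (π : Trajectory S → ℝ≥0 → Measure (A ⊕ Unit)) : Prop where
  isProbability : ∀ ω t, IsProbabilityMeasure (π ω t)
  predictable : ∀ B : Set (A ⊕ Unit), MeasurableSet B →
    Measurable[(Trajectory.filtration S).predictable]
      fun p : ℝ≥0 × Trajectory S => π p.2 p.1 B
  concentrated : ∀ ω t, π ω t (M.admissibleExt (ω.leftState t))ᶜ = 0

/-- The deterministic stationary policy given by `φ : S → A` (with `φ(x_∞) = a_∞`). -/
def stationaryPolicy (φ : S → A) : Trajectory S → ℝ≥0 → Measure (A ⊕ Unit) :=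
  fun ω t => Measure.dirac (Sum.map φ id (ω.leftState t))

/-- The integral `∫_A f(ξ_{t-}, a) π(da | ω, t)` of a nonnegative function `f` on `S × A`
(nothing is added at `x_∞` or `a_∞`). -/
def actionIntegral (π : Trajectory S → ℝ≥0 → Measure (A ⊕ Unit)) (f : S → A → ℝ≥0∞)
    (ω : Trajectory S) (t : ℝ≥0) : ℝ≥0∞ :=
  ∫⁻ a, Sum.elim (fun x => Sum.elim (f x) (fun _ => 0) a) (fun _ => 0) (ω.leftState t) ∂(π ω t)

/-- The jump intensity `Λ(Γ | ω, t) = ∫_A π(da | ω, t) q(Γ ∖ {ξ_{t-}} | ξ_{t-}, a)`. -/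
def intensity (M : CTMDP S A) (π : Trajectory S → ℝ≥0 → Measure (A ⊕ Unit))
    (Γ : Set S) (ω : Trajectory S) (t : ℝ≥0) : ℝ≥0∞ :=
  actionIntegral π (fun x a => ENNReal.ofReal (M.rate x a (Γ \ {x}))) ω t

/-- The intensity `Λ^k(Γ | x₀, θ₁, …, x_k, u)`, `u > 0`, after the `k`-th jump. It depends on `ω`
only through the `k`-component history, and `Λ(Γ | ω, t) = Λ^k(Γ | h_k(ω), t - T_k)` for
`T_k < t ≤ T_{k+1}`, because a predictable policy does not see the next jump. -/
def historyIntensity (M : CTMDP S A) (π : Trajectory S → ℝ≥0 → Measure (A ⊕ Unit))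
    (k : ℕ) (Γ : Set S) (ω : Trajectory S) (u : ℝ≥0) : ℝ≥0∞ :=
  M.intensity π Γ (ω.freeze k) ((ω.jumpTime k).toNNReal + u)

/-- `exp(-∫_D Λ^k(S | h_k, v) dv)`, with `exp(-∞) = 0`. -/
def survival (M : CTMDP S A) (π : Trajectory S → ℝ≥0 → Measure (A ⊕ Unit))
    (k : ℕ) (ω : Trajectory S) (D : Set ℝ≥0) : ℝ≥0∞ :=
  EReal.exp (-((∫⁻ v in D, M.historyIntensity π k univ ω v ∂timeMeasure : ℝ≥0∞) : EReal))

/-- `P` is the law `P_γ^π` on the space of trajectories: `x₀` has law `γ`, and given the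
`k`-component history with `T_k < ∞`, the next pair `(θ_{k+1}, x_{k+1})` has the density
`Λ^k(dy | h_k, u) exp(-∫₀ᵘ Λ^k(S | h_k, v) dv) du` on `(0, ∞) × S` and an atom of mass
`exp(-∫₀^∞ Λ^k(S | h_k, v) dv)` at `(∞, x_∞)`. -/
structure IsControlledLaw (M : CTMDP S A) (γ : Measure S)
    (π : Trajectory S → ℝ≥0 → Measure (A ⊕ Unit)) (P : Measure (Trajectory S)) : Prop where
  isProbability : IsProbabilityMeasure P
  initial : ∀ Γ : Set S, MeasurableSet Γ → P {ω | ω.state 0 ∈ Sum.inl '' Γ} = γ Γ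
  jump : ∀ (k : ℕ) (C : Set (Trajectory S)), MeasurableSet[Trajectory.historySigma S k] C →
    ∀ I : Set ℝ≥0, MeasurableSet I → ∀ Γ : Set S, MeasurableSet Γ →
    P (C ∩ {ω | ω.sojourn k ∈ ((↑) : ℝ≥0 → ℝ≥0∞) '' I ∧ ω.state (k + 1) ∈ Sum.inl '' Γ}) =
      ∫⁻ ω in C ∩ {ω | ω.jumpTime k < ⊤},
        (∫⁻ u in I, M.historyIntensity π k Γ ω u * M.survival π k ω (Iic u) ∂timeMeasure) ∂P
  no_jump : ∀ (k : ℕ) (C : Set (Trajectory S)), MeasurableSet[Trajectory.historySigma S k] C →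
    P (C ∩ {ω | ω.sojourn k = ⊤ ∧ ω.state (k + 1) = Sum.inr ()}) =
      P (C ∩ {ω | ω.jumpTime k = ⊤}) +
        ∫⁻ ω in C ∩ {ω | ω.jumpTime k < ⊤}, M.survival π k ω univ ∂P

open Classical in
/-- The law `P_γ^π`, defined as the measure characterized by `IsControlledLaw`
(and as `0` if there were none). -/
def controlledLaw (M : CTMDP S A) (γ : Measure S)
    (π : Trajectory S → ℝ≥0 → Measure (A ⊕ Unit)) : Measure (Trajectory S) :=
  if h : ∃ P, M.IsControlledLaw γ π P then h.choose else 0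

/-- `E_γ^π [ ∫₀^∞ e^{-αt} ∫_A f(ξ_{t-}, a) π(da | ω, t) dt ]` for nonnegative `f`. -/
def discountedTotal (M : CTMDP S A) (γ : Measure S)
    (π : Trajectory S → ℝ≥0 → Measure (A ⊕ Unit)) (f : S → A → ℝ≥0∞) : ℝ≥0∞ :=
  ∫⁻ ω, (∫⁻ t : ℝ≥0, ENNReal.ofReal (Real.exp (-(M.discount * t))) * actionIntegral π f ω t
    ∂timeMeasure) ∂(M.controlledLaw γ π)

/-- The total expected discounted negative part of the cost. -/
def negativeCost (M : CTMDP S A) (γ : Measure S)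
    (π : Trajectory S → ℝ≥0 → Measure (A ⊕ Unit)) : ℝ≥0∞ :=
  M.discountedTotal γ π fun x a => ENNReal.ofReal (-(M.cost x a))

/-- The performance functional
`V₀(π) = E_γ^π [ ∫₀^∞ e^{-αt} ∫_A c₀(ξ_{t-}, a) π(da | ω, t) dt ]`, as an extended real number:
positive part minus negative part. It is well defined when `negativeCost` is finite. -/
def value (M : CTMDP S A) (γ : Measure S)
    (π : Trajectory S → ℝ≥0 → Measure (A ⊕ Unit)) : EReal :=
  ((M.discountedTotal γ π fun x a => ENNReal.ofReal (M.cost x a) : ℝ≥0∞) : EReal) -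
    (M.negativeCost γ π : EReal)

/-- `π` is an optimal policy: `V₀(π) = inf_{π'} V₀(π')` over all randomized history-dependent
policies `π'`. -/
def IsOptimalPolicy (M : CTMDP S A) (γ : Measure S)
    (π : Trajectory S → ℝ≥0 → Measure (A ⊕ Unit)) : Prop :=
  M.IsPolicy π ∧ M.value γ π = sInf (M.value γ '' {π' | M.IsPolicy π'})

end CTMDP

/-! ## The loss queue -/

namespace LossQueue

/-- The law of the volume of a job: density `5 y⁴` on `(0, 1]` (the point `0` is null). -/
def jobLaw : Measure unitInterval :=
  (volume : Measure unitInterval).withDensity fun y => ENNReal.ofReal (5 * (y : ℝ) ^ 4)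

instance : IsProbabilityMeasure jobLaw := by
  constructor
  rw [jobLaw, withDensity_apply _ MeasurableSet.univ, Measure.restrict_univ,
    unitInterval.measurePreserving_coe.lintegral_comp
      (f := fun y : ℝ => ENNReal.ofReal (5 * y ^ 4)) (by fun_prop),
    ← ofReal_integral_eq_lintegral_ofReal]
  · rw [integral_Icc_eq_integral_Ioc, ← intervalIntegral.integral_of_le zero_le_one]
    norm_num [integral_pow]
  · exact (Continuous.integrableOn_Icc (by fun_prop))
  · exact ae_of_all _ fun y => by positivity

open Classical in
/-- The loss queue on `S = [0, 1]` with actions `A = [0, ∞)`: arrival rate `lam`, discount factor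
`α`, holding cost `C₁ x`, service cost `C₂ a²`, income `1` per served job, and service intensities
`a ∈ [0, Ā / x]`. State `0` is the idle system, `x ∈ (0, 1]` a job of volume `x` in service. -/
def model (lam α C₁ C₂ Abar : ℝ) : CTMDP unitInterval ℝ≥0 where
  admissible x := if x = 0 then {0} else {a | (a : ℝ) ≤ Abar / (x : ℝ)}
  rate x a :=
    if x = 0 then lam • (jobLaw.toSignedMeasure - (Measure.dirac 0).toSignedMeasure)
    else ((a : ℝ) / (x : ℝ)) •
      ((Measure.dirac 0).toSignedMeasure - (Measure.dirac x).toSignedMeasure)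
  cost x a :=
    if x = 0 then 0 else C₁ * (x : ℝ) + C₂ * (a : ℝ) ^ 2 - (a : ℝ) / (x : ℝ)
  discount := α

/-- `u(x, z) = -2αC₂x² - z + 2 √(α²C₂²x⁴ + C₁C₂x³ + αC₂x²z)`. -/
def u (α C₁ C₂ x z : ℝ) : ℝ :=
  -2 * α * C₂ * x ^ 2 - z +
    2 * Real.sqrt (α ^ 2 * C₂ ^ 2 * x ^ 4 + C₁ * C₂ * x ^ 3 + α * C₂ * x ^ 2 * z)

/-- `z⁽⁰⁾ = 0` and `z⁽ⁿ⁺¹⁾ = 1 - 5λ/(α+λ) ∫₀¹ u(y, z⁽ⁿ⁾) y⁴ dy`. -/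
def zSeq (lam α C₁ C₂ : ℝ) : ℕ → ℝ
  | 0 => 0
  | n + 1 => 1 - 5 * lam / (α + lam) *
      ∫ y in (0 : ℝ)..1, u α C₁ C₂ y (zSeq lam α C₁ C₂ n) * y ^ 4

open Classical in
/-- `u*` for the limit value `z`: `u*(x) = u(x, z)` on `(0, 1]` and `u*(0) = 1 - z`. -/
def uStar (α C₁ C₂ z : ℝ) (x : unitInterval) : ℝ :=
  if x = 0 then 1 - z else u α C₁ C₂ x z

end LossQueue

end

/-! ### Integration over the time axis -/

/-! The process is analysed one sojourn at a time. Up to the next jump a predictable policy cannot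
tell a trajectory from the one frozen after its current history (`predictable_mem_iff`). Given that
history, the hazard rate is thus a function of the elapsed time alone, and it is bounded because the
state is fixed. So the next pair (θ, x) has an explicit Markov kernel `stepKernel`, and
`isControlledLaw_iff` identifies the controlled law as the one with initial law γ and these one-step
conditional laws. Uniqueness is an induction over histories; existence runs the recursion on
independent uniform noise.

Optimality comes from telescoping over the stages. Let J_k(v) = E[exp(-αT_k) v(x_k)], let g be the
jump rate and ν the law of the state after a jump. Then J_k(v) is the discounted total of (α + g)v
over stage k (`jumpTotal_eq_stageTotal`), and J_{k+1}(v) is that of gνv over the same stage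
(`jumpTotal_succ`). A pointwise inequality such as f + gνv ≤ f' + (α + g)v therefore sums to a
comparison of the discounted totals of f and f', with ∫ v dγ as boundary term. The verification
theorem `isOptimalPolicy_stationaryPolicy` uses this twice: over all admissible actions for the
lower bound on the value of any policy, and at the single action φ(x) for the upper bound on the
value of φ. The lower bound needs J_k(v) → 0; for bounded v this holds because a Lyapunov function
makes the expected discounted number of jumps finite. All totals live in [0, ∞], so the cost is
split into positive and negative parts, and u* is replaced by v = u* + z ≥ 0 at the price of a
constant running cost αz.

For the queue, minimizing over the action is completing a square (`cost_sub_eq`): with z = 1 - u(0),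
the function u(x, z) is the root with u + z ≥ 0 of the resulting quadratic equation, and (u +
z)/(2xC₂) is the minimizer. The Bellman equation at the idle state then says that z is a fixed point
of `zStep`. Since u(x, z) decreases strictly in z and u ≥ -z, the map `zStep` increases strictly and
is at most 1 + z/5, so the iterates stay below 2; `zStep` is positive at 0 because C₁ ≤ 2α. Monotone
convergence and continuity give the fixed point.

The structural conditions hold with the weights x⁻⁴ and x⁻²: the density 5y⁴ makes x⁻⁴ integrable
with mean 5, and the maximal service intensity is of order x⁻². -/

lemma lintegral_timeMeasure (f : ℝ≥0 → ℝ≥0∞) :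
    ∫⁻ t, f t ∂timeMeasure = ∫⁻ t in Ici (0 : ℝ), f t.toNNReal := by
  have h : MeasurableEmbedding ((↑) : ℝ≥0 → ℝ) := MeasurableEmbedding.subtype_coe measurableSet_Ici
  have hr : range ((↑) : ℝ≥0 → ℝ) = Ici 0 := by ext x; simp
  rw [← hr, ← h.map_comap volume, h.lintegral_map]
  simp [timeMeasure]

lemma setLIntegral_timeMeasure {D : Set ℝ≥0} (hD : MeasurableSet D) (f : ℝ≥0 → ℝ≥0∞) :
    ∫⁻ t in D, f t ∂timeMeasure = ∫⁻ t in Ici (0 : ℝ) ∩ Real.toNNReal ⁻¹' D, f t.toNNReal := by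
  rw [← lintegral_indicator hD, lintegral_timeMeasure, inter_comm,
    ← Measure.restrict_restrict (measurable_real_toNNReal hD),
    ← lintegral_indicator (measurable_real_toNNReal hD)]
  rfl

lemma setLIntegral_Iic_timeMeasure (u : ℝ≥0) (f : ℝ≥0 → ℝ≥0∞) :
    ∫⁻ t in Iic u, f t ∂timeMeasure = ∫⁻ t in Ioc (0 : ℝ) u, f t.toNNReal := by
  rw [setLIntegral_timeMeasure measurableSet_Iic, setLIntegral_congr Ioc_ae_eq_Icc]
  congr 2
  ext t
  simp only [mem_inter_iff, mem_Ici, mem_preimage, mem_Iic, mem_Icc, Real.toNNReal_le_iff_le_coe]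

lemma timeMeasure_eq_map :
    timeMeasure = (volume.restrict (Ici (0 : ℝ))).map Real.toNNReal := by
  ext D hD
  rw [Measure.map_apply measurable_real_toNNReal hD, ← setLIntegral_one D,
    setLIntegral_timeMeasure hD, setLIntegral_one, inter_comm,
    Measure.restrict_apply (measurable_real_toNNReal hD)]

instance : SFinite timeMeasure := by
  rw [timeMeasure_eq_map]
  infer_instance

instance : NullSingletonClass timeMeasure := by
  have h : MeasurableEmbedding ((↑) : ℝ≥0 → ℝ) := MeasurableEmbedding.subtype_coe measurableSet_Ici
  constructor
  intro x
  rw [timeMeasure, h.comap_apply]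
  simp

lemma timeMeasure_univ : timeMeasure univ = ⊤ := by
  rw [← lintegral_one, lintegral_timeMeasure]
  simp

/-- Passes from absolute time to the time elapsed since a jump at c. -/
lemma setLIntegral_Ioi_timeMeasure_add (c : ℝ≥0) (f : ℝ≥0 → ℝ≥0∞) (hf : Measurable f) :
    ∫⁻ t in Ioi c, f t ∂timeMeasure = ∫⁻ u, f (c + u) ∂timeMeasure := by
  rw [setLIntegral_timeMeasure measurableSet_Ioi, lintegral_timeMeasure,
    setLIntegral_congr (Ioi_ae_eq_Ici (μ := volume) (a := (0 : ℝ))).symm]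
  have h1 : Ici (0 : ℝ) ∩ Real.toNNReal ⁻¹' Ioi c = Ioi (c : ℝ) := by
    ext t
    simp only [mem_inter_iff, mem_Ici, mem_preimage, mem_Ioi, Real.lt_toNNReal_iff_coe_lt]
    exact ⟨fun h => h.2, fun h => ⟨c.coe_nonneg.trans h.le, h⟩⟩
  rw [h1]
  have h2 : (fun x : ℝ => (c : ℝ) + x) ⁻¹' Ioi (c : ℝ) = Ioi 0 := by ext; simp
  rw [← (measurePreserving_add_left volume (c : ℝ)).setLIntegral_comp_preimage measurableSet_Ioi
    (by fun_prop), h2]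
  refine setLIntegral_congr_fun measurableSet_Ioi fun t ht => ?_
  have ht : (0 : ℝ) < t := ht
  rw [Real.toNNReal_add c.coe_nonneg ht.le, Real.toNNReal_coe]

/-! ### Survival functions of bounded hazard rates -/

/-- `exp(-∫_D r)`, the probability of no jump in `D` under the hazard rate `r`. -/
noncomputable def hazardSurvival (r : ℝ≥0 → ℝ≥0∞) (D : Set ℝ≥0) : ℝ≥0∞ :=
  EReal.exp (-((∫⁻ v in D, r v ∂timeMeasure : ℝ≥0∞) : EReal))

lemma hazardSurvival_eq_ofReal {r : ℝ≥0 → ℝ≥0∞} {D : Set ℝ≥0}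
    (h : ∫⁻ v in D, r v ∂timeMeasure ≠ ⊤) :
    hazardSurvival r D = ENNReal.ofReal (Real.exp (-(∫⁻ v in D, r v ∂timeMeasure).toReal)) := by
  rw [hazardSurvival, ← EReal.exp_coe, EReal.coe_neg, EReal.coe_ennreal_toReal h]

/-- With R(t) = ∫₀ᵗ q the integrand is -(exp(-R))'. As q is only measurable, R need not be
differentiable everywhere; but 0 ≤ q ≤ C makes exp(-R) Lipschitz on [0, b], hence absolutely
continuous, and Lebesgue differentiation gives R' = q almost everywhere. -/
lemma setIntegral_mul_exp_neg_integral {q : ℝ → ℝ} (hq : Measurable q) {C : ℝ}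
    (h0 : ∀ t, 0 ≤ q t) (hC : ∀ t, q t ≤ C) {b : ℝ} (hb : 0 ≤ b) :
    ∫ t in (0 : ℝ)..b, q t * Real.exp (-∫ s in (0 : ℝ)..t, q s) =
      1 - Real.exp (-∫ s in (0 : ℝ)..b, q s) := by
  have hC0 : 0 ≤ C := (h0 0).trans (hC 0)
  have hint : ∀ x y, IntervalIntegrable q volume x y := fun x y =>
    (intervalIntegrable_const (c := C)).mono_fun hq.aestronglyMeasurable
      (ae_of_all _ fun t => by simp [abs_of_nonneg (h0 t), abs_of_nonneg hC0, hC t])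
  set R : ℝ → ℝ := fun t => ∫ s in (0 : ℝ)..t, q s with hR
  have hRac : AbsolutelyContinuousOnInterval R 0 b :=
    (hint 0 b).absolutelyContinuousOnInterval_intervalIntegral (by simp)
  have hRmono : ∀ x y, x ≤ y → R x ≤ R y := by
    intro x y hxy
    have := intervalIntegral.integral_interval_sub_left (hint 0 y) (hint 0 x)
    have h2 : 0 ≤ ∫ s in x..y, q s := intervalIntegral.integral_nonneg hxy fun t _ => h0 t
    simp only [hR]; linarith
  have hRlip : ∀ x y, x ≤ y → R y - R x ≤ C * (y - x) := by
    intro x y hxy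
    have := intervalIntegral.integral_interval_sub_left (hint 0 y) (hint 0 x)
    simp only [hR]; rw [this]
    calc ∫ s in x..y, q s ≤ ∫ s in x..y, C :=
          intervalIntegral.integral_mono_on hxy (hint _ _) (by simp) fun t _ => hC t
      _ = C * (y - x) := by simp [mul_comm]
  have hR0 : R 0 = 0 := by simp [hR]
  have hexp : ∀ x y, 0 ≤ x → x ≤ y →
      |Real.exp (-R x) - Real.exp (-R y)| ≤ C * (y - x) := by
    intro x y hx hxy
    have h1 : 0 ≤ R x := hR0 ▸ hRmono 0 x hx
    have h2 := hRmono x y hxy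
    have h3 : Real.exp (-R y) ≤ Real.exp (-R x) := Real.exp_le_exp.2 (by linarith)
    rw [abs_of_nonneg (by linarith)]
    have h4 : Real.exp (-R y) = Real.exp (-R x) * Real.exp (-(R y - R x)) := by
      rw [← Real.exp_add]; ring_nf
    have h5 := Real.add_one_le_exp (-(R y - R x))
    have h6 : Real.exp (-R x) ≤ 1 := by simpa using h1
    have h7 := hRlip x y hxy
    have h8 := Real.exp_pos (-R x)
    rw [h4]
    nlinarith
  have hlip : LipschitzOnWith C.toNNReal (fun t => Real.exp (-R t)) (uIcc 0 b) := by
    refine LipschitzOnWith.of_dist_le_mul fun x hx y hy => ?_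
    rw [uIcc_of_le hb] at hx hy
    rw [Real.coe_toNNReal _ hC0, Real.dist_eq, Real.dist_eq]
    rcases le_total x y with h | h
    · rw [abs_sub_comm x y, abs_of_nonneg (by linarith : 0 ≤ y - x)]
      exact hexp x y hx.1 h
    · rw [abs_sub_comm, abs_of_nonneg (by linarith : 0 ≤ x - y)]
      exact hexp y x hy.1 h
  have key := hlip.absolutelyContinuousOnInterval.integral_deriv_eq_sub
  have hd : ∀ᵐ t, t ∈ uIoc 0 b →
      deriv (fun t => Real.exp (-R t)) t = -(q t * Real.exp (-R t)) := by
    filter_upwards [(hint 0 b).ae_hasDerivAt_integral] with t ht htm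
    have h1 : HasDerivAt R (q t) t := ht (uIoc_subset_uIcc htm) 0 (by simp)
    refine (h1.neg.exp.congr_deriv ?_).deriv
    simp only [Pi.neg_apply]; ring
  rw [intervalIntegral.integral_congr_ae hd, intervalIntegral.integral_neg] at key
  rw [hR0] at key
  simp only [neg_zero, Real.exp_zero] at key
  linarith

section Hazard

variable {r : ℝ≥0 → ℝ≥0∞} {C : ℝ≥0}

lemma setLIntegral_Iic_eq_ofReal (hr : Measurable r) (hC : ∀ v, r v ≤ C) (u : ℝ≥0) :
    ∫⁻ v in Iic u, r v ∂timeMeasure =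
      ENNReal.ofReal (∫ s in (0 : ℝ)..u, (r s.toNNReal).toReal) := by
  rw [setLIntegral_Iic_timeMeasure, intervalIntegral.integral_of_le u.coe_nonneg,
    ofReal_integral_eq_lintegral_ofReal]
  · refine lintegral_congr fun t => ?_
    rw [ENNReal.ofReal_toReal (ne_top_of_le_ne_top ENNReal.coe_ne_top (hC _))]
  · refine Measure.integrableOn_of_bounded (M := C) (by simp) ?_ (ae_of_all _ fun t => ?_)
    · exact (hr.comp measurable_real_toNNReal).ennreal_toReal.aestronglyMeasurable
    · rw [Real.norm_of_nonneg ENNReal.toReal_nonneg]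
      simpa using ENNReal.toReal_mono ENNReal.coe_ne_top (hC t.toNNReal)
  · exact ae_of_all _ fun t => ENNReal.toReal_nonneg

lemma hazardSurvival_Iic (hr : Measurable r) (hC : ∀ v, r v ≤ C) (u : ℝ≥0) :
    hazardSurvival r (Iic u) =
      ENNReal.ofReal (Real.exp (-∫ s in (0 : ℝ)..u, (r s.toNNReal).toReal)) := by
  have h := setLIntegral_Iic_eq_ofReal hr hC u
  rw [hazardSurvival_eq_ofReal (by rw [h]; exact ENNReal.ofReal_ne_top), h,
    ENNReal.toReal_ofReal]
  exact intervalIntegral.integral_nonneg u.coe_nonneg fun t _ => ENNReal.toReal_nonneg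

lemma setLIntegral_Iic_mul_hazardSurvival (hr : Measurable r) (hC : ∀ v, r v ≤ C) (u : ℝ≥0) :
    ∫⁻ v in Iic u, r v * hazardSurvival r (Iic v) ∂timeMeasure + hazardSurvival r (Iic u) = 1 := by
  set q : ℝ → ℝ := fun s => (r s.toNNReal).toReal with hq
  have hqm : Measurable q := (hr.comp measurable_real_toNNReal).ennreal_toReal
  have h0 : ∀ t, 0 ≤ q t := fun t => ENNReal.toReal_nonneg
  have hqC : ∀ t, q t ≤ C := fun t => by
    simpa using ENNReal.toReal_mono ENNReal.coe_ne_top (hC t.toNNReal)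
  have hint : ∀ x y, IntervalIntegrable q volume x y := fun x y =>
    (intervalIntegrable_const (c := (C : ℝ))).mono_fun hqm.aestronglyMeasurable
      (ae_of_all _ fun t => by simp [abs_of_nonneg (h0 t), hqC t])
  have hcont : Continuous fun t => ∫ s in (0 : ℝ)..t, q s :=
    intervalIntegral.continuous_primitive hint 0
  have hnn : ∀ t, 0 ≤ t → 0 ≤ ∫ s in (0 : ℝ)..t, q s := fun t ht =>
    intervalIntegral.integral_nonneg ht fun t _ => h0 t
  have key := setIntegral_mul_exp_neg_integral hqm h0 hqC u.coe_nonneg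
  have h1 : ∫⁻ v in Iic u, r v * hazardSurvival r (Iic v) ∂timeMeasure =
      ENNReal.ofReal (∫ t in (0 : ℝ)..u, q t * Real.exp (-∫ s in (0 : ℝ)..t, q s)) := by
    rw [setLIntegral_Iic_timeMeasure, intervalIntegral.integral_of_le u.coe_nonneg,
      ofReal_integral_eq_lintegral_ofReal]
    · refine setLIntegral_congr_fun measurableSet_Ioc fun t ht => ?_
      have ht0 : 0 ≤ t := ht.1.le
      rw [hazardSurvival_Iic hr hC, Real.coe_toNNReal _ ht0, ENNReal.ofReal_mul (h0 t), hq,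
        ENNReal.ofReal_toReal (ne_top_of_le_ne_top ENNReal.coe_ne_top (hC _))]
    · refine Measure.integrableOn_of_bounded (M := C) (by simp)
        (hqm.mul (by fun_prop)).aestronglyMeasurable ?_
      refine (ae_restrict_iff' measurableSet_Ioc).2 (ae_of_all _ fun t ht => ?_)
      rw [Real.norm_of_nonneg (mul_nonneg (h0 t) (Real.exp_pos _).le)]
      have : Real.exp (-∫ s in (0 : ℝ)..t, q s) ≤ 1 := by simpa using hnn t ht.1.le
      nlinarith [h0 t, hqC t, Real.exp_pos (-∫ s in (0 : ℝ)..t, q s)]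
    · exact ae_of_all _ fun t => mul_nonneg (h0 t) (Real.exp_pos _).le
  rw [h1, key, hazardSurvival_Iic hr hC, ← ENNReal.ofReal_add _ (Real.exp_pos _).le]
  · simp [hq]
  · have : Real.exp (-∫ s in (0 : ℝ)..u, q s) ≤ 1 := by simpa using hnn u u.coe_nonneg
    linarith

lemma tendsto_setLIntegral_Iic_natCast (f : ℝ≥0 → ℝ≥0∞) :
    Tendsto (fun n : ℕ => ∫⁻ v in Iic (n : ℝ≥0), f v ∂timeMeasure) atTop
      (𝓝 (∫⁻ v, f v ∂timeMeasure)) := by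
  have hU : (⋃ n : ℕ, Iic (n : ℝ≥0)) = univ := iUnion_Iic_of_not_bddAbove_range
    (by simpa using not_bddAbove_iff.2 fun x => by
          obtain ⟨n, hn⟩ := exists_nat_gt x
          exact ⟨n, ⟨n, rfl⟩, hn⟩)
  have hmono : Monotone fun n : ℕ => Iic (n : ℝ≥0) := fun a b hab => Iic_subset_Iic.2 (by exact_mod_cast hab)
  rw [← setLIntegral_univ, ← hU, setLIntegral_iUnion_of_directed _ hmono.directed_le]
  exact tendsto_atTop_iSup fun a b hab => lintegral_mono_set (hmono hab)

/-- Let u → ∞ in the balance on [0, u]. The survival term may stay positive: it is the mass of the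
atom at θ = ∞. -/
lemma lintegral_mul_hazardSurvival (hr : Measurable r) (hC : ∀ v, r v ≤ C) :
    ∫⁻ v, r v * hazardSurvival r (Iic v) ∂timeMeasure + hazardSurvival r univ = 1 := by
  have h1 := tendsto_setLIntegral_Iic_natCast fun v => r v * hazardSurvival r (Iic v)
  have h2 : Tendsto (fun n : ℕ => hazardSurvival r (Iic (n : ℝ≥0))) atTop
      (𝓝 (hazardSurvival r univ)) := by
    have h := tendsto_setLIntegral_Iic_natCast r
    rw [← setLIntegral_univ] at h
    exact (ENNReal.continuous_exp.tendsto _).comp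
      ((continuous_neg.tendsto _).comp ((continuous_coe_ennreal_ereal.tendsto _).comp h))
  have h3 := h1.add h2
  simp only [setLIntegral_Iic_mul_hazardSurvival hr hC] at h3
  exact tendsto_nhds_unique h3 tendsto_const_nhds

lemma hazardSurvival_add_const (hr : Measurable r) (hC : ∀ v, r v ≤ C) (α u : ℝ≥0) :
    hazardSurvival (fun v => α + r v) (Iic u) =
      ENNReal.ofReal (Real.exp (-(α * u))) * hazardSurvival r (Iic u) := by
  have hfin : ∫⁻ v in Iic u, r v ∂timeMeasure ≠ ⊤ := by
    rw [setLIntegral_Iic_eq_ofReal hr hC]; exact ENNReal.ofReal_ne_top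
  have h1 : ∫⁻ v in Iic u, ((α : ℝ≥0∞) + r v) ∂timeMeasure =
      α * u + ∫⁻ v in Iic u, r v ∂timeMeasure := by
    rw [lintegral_add_left measurable_const, setLIntegral_Iic_timeMeasure]
    simp
  have hfin2 : (α : ℝ≥0∞) * u ≠ ⊤ := ENNReal.mul_ne_top ENNReal.coe_ne_top ENNReal.coe_ne_top
  rw [hazardSurvival_eq_ofReal (by rw [h1]; exact ENNReal.add_ne_top.2 ⟨hfin2, hfin⟩),
    hazardSurvival_eq_ofReal hfin, ← ENNReal.ofReal_mul (Real.exp_pos _).le, ← Real.exp_add, h1,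
    ENNReal.toReal_add hfin2 hfin]
  congr 2
  simp
  ring

/-- Discounting acts as independent killing at rate α: exp(-αv) times the survival function of r is
the survival function of α + r. The total hazard of α + r is infinite, so no mass is left at
infinity. This identity lets a value collected at a jump time be spread over the stage that follows
it. -/
lemma lintegral_exp_mul_add_mul_hazardSurvival (hr : Measurable r) (hC : ∀ v, r v ≤ C)
    {α : ℝ≥0} (hα : 0 < α) :
    ∫⁻ v, ENNReal.ofReal (Real.exp (-(α * v))) * ((α + r v) * hazardSurvival r (Iic v))
      ∂timeMeasure = 1 := by
  have h := lintegral_mul_hazardSurvival (r := fun v => α + r v) (C := α + C) (by fun_prop)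
    (fun v => by push_cast; gcongr; exact hC v)
  have htop : ∫⁻ v, ((α : ℝ≥0∞) + r v) ∂timeMeasure = ⊤ := by
    refine top_unique ?_
    calc (⊤ : ℝ≥0∞) = ∫⁻ _, (α : ℝ≥0∞) ∂timeMeasure := by
          rw [lintegral_const, timeMeasure_univ, ENNReal.mul_top (by exact_mod_cast hα.ne')]
      _ ≤ _ := lintegral_mono fun v => le_self_add
  have hz : hazardSurvival (fun v => α + r v) univ = 0 := by
    rw [hazardSurvival, setLIntegral_univ, htop]; simp
  rw [hz, add_zero] at h
  rw [← h]
  refine lintegral_congr fun v => ?_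
  rw [hazardSurvival_add_const hr hC]
  ring

end Hazard

/-! ### Trajectories -/

namespace Trajectory

variable {S : Type*}

lemma eq_of_state_sojourn {ω ω' : Trajectory S} (h1 : ∀ m, ω.state m = ω'.state m)
    (h2 : ∀ m, ω.sojourn m = ω'.sojourn m) : ω = ω' := by
  obtain ⟨s, t, _, _, _, _⟩ := ω
  obtain ⟨s', t', _, _, _, _⟩ := ω'
  obtain rfl : s = s' := funext h1
  obtain rfl : t = t' := funext h2
  rfl

lemma jumpTime_zero (ω : Trajectory S) : ω.jumpTime 0 = 0 := by simp [jumpTime]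

lemma jumpTime_succ (ω : Trajectory S) (k : ℕ) :
    ω.jumpTime (k + 1) = ω.jumpTime k + ω.sojourn k := by
  simp [jumpTime, Finset.sum_range_succ]

lemma jumpTime_mono (ω : Trajectory S) : Monotone ω.jumpTime :=
  monotone_nat_of_le_succ fun k => by rw [jumpTime_succ]; exact le_self_add

lemma sojourn_eq_top_of_le (ω : Trajectory S) {i j : ℕ} (hij : i ≤ j) (h : ω.sojourn i = ⊤) :
    ω.sojourn j = ⊤ := by
  induction j, hij using Nat.le_induction with
  | base => exact h
  | succ j _ ih => exact ω.absorbed j ih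

lemma sojourn_eq_top_of_jumpTime (ω : Trajectory S) {k : ℕ} (h : ω.jumpTime k = ⊤) :
    ω.sojourn k = ⊤ := by
  obtain ⟨i, hi, hi'⟩ := ENNReal.sum_eq_top.1 h
  exact ω.sojourn_eq_top_of_le (Finset.mem_range.1 hi).le hi'

lemma state_succ_of_jumpTime (ω : Trajectory S) {k : ℕ} (h : ω.jumpTime k = ⊤) :
    ω.state (k + 1) = Sum.inr () :=
  (ω.sojourn_eq_top_iff k).1 (ω.sojourn_eq_top_of_jumpTime h)

lemma jumpTime_lt_top_iff (ω : Trajectory S) (k : ℕ) :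
    ω.jumpTime k < ⊤ ↔ ∃ x, ω.state k = Sum.inl x := by
  cases k with
  | zero => simp [jumpTime_zero, ω.state_zero]
  | succ k =>
    rw [jumpTime_succ, ENNReal.add_lt_top, lt_top_iff_ne_top (a := ω.sojourn k), Ne,
      ω.sojourn_eq_top_iff k]
    constructor
    · rintro ⟨_, h⟩
      cases hs : ω.state (k + 1) with
      | inl x => exact ⟨x, rfl⟩
      | inr u => exact absurd hs h
    · rintro ⟨x, hx⟩
      refine ⟨?_, by simp [hx]⟩
      rw [lt_top_iff_ne_top]
      intro h
      rw [ω.state_succ_of_jumpTime h] at hx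
      cases hx

/-! #### Frozen trajectories -/

lemma freeze_state_of_le (ω : Trajectory S) {k m : ℕ} (h : m ≤ k) :
    (ω.freeze k).state m = ω.state m := by simp [freeze, h]

lemma freeze_state_of_lt (ω : Trajectory S) {k m : ℕ} (h : k < m) :
    (ω.freeze k).state m = Sum.inr () := by simp [freeze, h]

lemma freeze_sojourn_of_lt (ω : Trajectory S) {k m : ℕ} (h : m < k) :
    (ω.freeze k).sojourn m = ω.sojourn m := by simp [freeze, h]

lemma freeze_sojourn_of_le (ω : Trajectory S) {k m : ℕ} (h : k ≤ m) :
    (ω.freeze k).sojourn m = ⊤ := by simp [freeze, h]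

lemma freeze_jumpTime_of_le (ω : Trajectory S) {k m : ℕ} (h : m ≤ k) :
    (ω.freeze k).jumpTime m = ω.jumpTime m :=
  Finset.sum_congr rfl fun _ hi =>
    ω.freeze_sojourn_of_lt ((Finset.mem_range.1 hi).trans_le h)

lemma freeze_jumpTime_of_lt (ω : Trajectory S) {k m : ℕ} (h : k < m) :
    (ω.freeze k).jumpTime m = ⊤ :=
  ENNReal.sum_eq_top.2 ⟨k, Finset.mem_range.2 h, ω.freeze_sojourn_of_le le_rfl⟩

lemma freeze_freeze (ω : Trajectory S) {k m : ℕ} (h : k ≤ m) :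
    (ω.freeze m).freeze k = ω.freeze k := by
  refine eq_of_state_sojourn (fun i => ?_) fun i => ?_
  · by_cases hi : i ≤ k
    · simp [freeze, hi, hi.trans h]
    · simp [freeze, hi]
  · by_cases hi : i < k
    · simp [freeze, hi, hi.trans_le h]
    · simp [freeze, hi]

lemma freeze_freeze_self (ω : Trajectory S) (k : ℕ) : (ω.freeze k).freeze k = ω.freeze k :=
  ω.freeze_freeze le_rfl

/-! #### The left limit -/

lemma leftState_eq_state (ω : Trajectory S) {k : ℕ} {t : ℝ≥0} (h1 : ω.jumpTime k < t)
    (h2 : (t : ℝ≥0∞) ≤ ω.jumpTime (k + 1)) : ω.leftState t = ω.state k := by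
  classical
  have h : ∃ m, ω.jumpTime m < (t : ℝ≥0∞) ∧ (t : ℝ≥0∞) ≤ ω.jumpTime (m + 1) := ⟨k, h1, h2⟩
  have hfind : Nat.find h = k := by
    obtain ⟨h3, h4⟩ := Nat.find_spec h
    refine le_antisymm (Nat.find_min' h ⟨h1, h2⟩) ?_
    by_contra hlt
    exact absurd (h4.trans (ω.jumpTime_mono (by omega : Nat.find h + 1 ≤ k))) (not_le.2 h1)
  rw [leftState, dif_pos h, ← hfind]

lemma leftState_zero (ω : Trajectory S) : ω.leftState 0 = ω.state 0 := by
  rw [leftState, dif_neg (by simp), if_pos rfl]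

lemma leftState_of_forall_lt (ω : Trajectory S) {t : ℝ≥0} (ht : t ≠ 0)
    (h : ∀ m, ω.jumpTime m < t) : ω.leftState t = Sum.inr () := by
  rw [leftState, dif_neg, if_neg ht]
  rintro ⟨m, _, hm⟩
  exact absurd (h (m + 1)) (not_lt.2 hm)

lemma exists_jumpTime_lt_le (ω : Trajectory S) {t : ℝ≥0} (ht : t ≠ 0) :
    (∃ m, ω.jumpTime m < (t : ℝ≥0∞) ∧ (t : ℝ≥0∞) ≤ ω.jumpTime (m + 1)) ∨
      ∀ m, ω.jumpTime m < t := by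
  by_cases h : ∀ m, ω.jumpTime m < t
  · exact Or.inr h
  · left
    push Not at h
    classical
    have hpos : Nat.find h ≠ 0 := by
      intro h0
      have := Nat.find_spec h
      rw [h0, jumpTime_zero] at this
      exact ht (by simpa using this)
    refine ⟨Nat.find h - 1, ?_, ?_⟩
    · exact not_le.1 (Nat.find_min h (by omega))
    · rw [Nat.sub_add_cancel (Nat.pos_of_ne_zero hpos)]
      exact Nat.find_spec h

/-- After freezing there is no (k+1)-st jump, so the state x_k persists for ever and t needs no
upper bound. -/
lemma leftState_freeze (ω : Trajectory S) {k : ℕ} {t : ℝ≥0} (h : ω.jumpTime k < t) :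
    (ω.freeze k).leftState t = ω.state k := by
  rw [leftState_eq_state (k := k), freeze_state_of_le _ le_rfl]
  · rwa [freeze_jumpTime_of_le _ le_rfl]
  · rw [freeze_jumpTime_of_lt _ (Nat.lt_succ_self k)]; exact le_top

/-! #### Extending a trajectory by one jump -/

open Classical in
/-- The pair `(θ, y)` itself if it can follow the `k`-component history of `ω`, and `(∞, x_∞)`
otherwise. -/
noncomputable def nextJump (k : ℕ) (ω : Trajectory S) (p : ℝ≥0∞ × (S ⊕ Unit)) :
    ℝ≥0∞ × (S ⊕ Unit) :=
  if ω.jumpTime k < ⊤ ∧ 0 < p.1 ∧ p.1 < ⊤ ∧ p.2.isLeft then p else (⊤, Sum.inr ())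

lemma nextJump_fst_pos (k : ℕ) (ω : Trajectory S) (p : ℝ≥0∞ × (S ⊕ Unit)) :
    0 < (nextJump k ω p).1 := by
  unfold nextJump
  split_ifs with h
  · exact h.2.1
  · exact ENNReal.zero_lt_top

lemma nextJump_fst_eq_top_iff (k : ℕ) (ω : Trajectory S) (p : ℝ≥0∞ × (S ⊕ Unit)) :
    (nextJump k ω p).1 = ⊤ ↔ (nextJump k ω p).2 = Sum.inr () := by
  unfold nextJump
  split_ifs with h
  · obtain ⟨θ, y⟩ := p
    obtain ⟨_, _, h3, h4⟩ := h
    cases y with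
    | inl y => simpa using h3.ne
    | inr y => simp at h4
  · simp

lemma nextJump_fst_of_jumpTime (k : ℕ) (ω : Trajectory S) (p : ℝ≥0∞ × (S ⊕ Unit))
    (h : ω.jumpTime k = ⊤) : (nextJump k ω p).1 = ⊤ := by
  simp [nextJump, h]

lemma nextJump_self (k : ℕ) (ω : Trajectory S) :
    nextJump k ω (ω.sojourn k, ω.state (k + 1)) = (ω.sojourn k, ω.state (k + 1)) := by
  unfold nextJump
  split_ifs with h
  · rfl
  · have htop : ω.sojourn k = ⊤ := by
      by_contra hne
      have hk : ω.jumpTime k < ⊤ := by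
        rw [lt_top_iff_ne_top]
        exact fun h' => hne (ω.sojourn_eq_top_of_jumpTime h')
      refine h ⟨hk, ω.sojourn_pos k, lt_top_iff_ne_top.2 hne, ?_⟩
      have hne' := mt (ω.sojourn_eq_top_iff k).2 hne
      cases hs : ω.state (k + 1) with
      | inl x => rfl
      | inr u => exact absurd hs hne'
    rw [(ω.sojourn_eq_top_iff k).1 htop, htop]

/-- The trajectory with the `k`-component history of `ω`, the `(k+1)`-st jump `p` (or no jump, if
`p` cannot follow that history) and no further jumps. -/
noncomputable def extend (k : ℕ) (ω : Trajectory S) (p : ℝ≥0∞ × (S ⊕ Unit)) : Trajectory S where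
  state m := if m ≤ k then ω.state m else if m = k + 1 then (nextJump k ω p).2 else Sum.inr ()
  sojourn m := if m < k then ω.sojourn m else if m = k then (nextJump k ω p).1 else ⊤
  state_zero := by simpa using ω.state_zero
  sojourn_pos m := by
    split_ifs
    · exact ω.sojourn_pos m
    · exact nextJump_fst_pos k ω p
    · exact ENNReal.zero_lt_top
  sojourn_eq_top_iff m := by
    rcases lt_trichotomy m k with h | rfl | h
    · simp only [h, if_true, Nat.succ_le_of_lt h]
      exact ω.sojourn_eq_top_iff m
    · simpa using nextJump_fst_eq_top_iff m ω p
    · simp [h.not_gt, h.ne']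
  absorbed m := by
    rcases lt_trichotomy (m + 1) k with h | rfl | h
    · simp only [h, if_true, (Nat.lt_succ_self m).trans h]
      exact ω.absorbed m
    · simp only [Nat.lt_succ_self, if_true, lt_irrefl, if_false]
      intro h
      refine nextJump_fst_of_jumpTime _ ω p ?_
      rw [jumpTime_succ, h, add_top]
    · simp [h.not_gt, h.ne']

lemma extend_state_succ (k : ℕ) (ω : Trajectory S) (p : ℝ≥0∞ × (S ⊕ Unit)) :
    (extend k ω p).state (k + 1) = (nextJump k ω p).2 := by simp [extend]

lemma extend_sojourn_self (k : ℕ) (ω : Trajectory S) (p : ℝ≥0∞ × (S ⊕ Unit)) :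
    (extend k ω p).sojourn k = (nextJump k ω p).1 := by simp [extend]

lemma freeze_extend (k : ℕ) (ω : Trajectory S) (p : ℝ≥0∞ × (S ⊕ Unit)) :
    (extend k ω p).freeze k = ω.freeze k := by
  refine eq_of_state_sojourn (fun i => ?_) fun i => ?_
  · by_cases hi : i ≤ k <;> simp [freeze, extend, hi]
  · by_cases hi : i < k <;> simp [freeze, extend, hi]

lemma freeze_succ_extend (k : ℕ) (ω : Trajectory S) (p : ℝ≥0∞ × (S ⊕ Unit)) :
    (extend k ω p).freeze (k + 1) = extend k ω p := by
  refine eq_of_state_sojourn (fun i => ?_) fun i => ?_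
  · rcases lt_trichotomy i (k + 1) with h | rfl | h
    · simp [freeze, h.le]
    · simp [freeze]
    · have h' : ¬ i ≤ k := by omega
      simp [freeze, extend, h.not_ge, h.ne', h']
  · rcases lt_trichotomy i k with h | rfl | h
    · simp [freeze, extend, h, h.le]
    · simp [freeze]
    · simp [freeze, extend, h.not_gt, h.ne']

/-- A history is rebuilt from its truncation and the observed next pair; hence the one-step laws
determine the laws of all histories. -/
lemma extend_freeze_self (k : ℕ) (ω : Trajectory S) :
    extend k (ω.freeze k) (ω.sojourn k, ω.state (k + 1)) = ω.freeze (k + 1) := by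
  have h : nextJump k (ω.freeze k) (ω.sojourn k, ω.state (k + 1)) =
      (ω.sojourn k, ω.state (k + 1)) := by
    have := nextJump_self k ω
    simpa only [nextJump, freeze_jumpTime_of_le ω le_rfl] using this
  refine eq_of_state_sojourn (fun i => ?_) fun i => ?_
  · simp only [extend, h]
    rcases lt_trichotomy i (k + 1) with h | rfl | h
    · simp [freeze, h.le, Nat.lt_succ_iff.1 h]
    · simp [freeze]
    · have h' : ¬ i ≤ k := by omega
      simp [freeze, h.not_ge, h.ne', h']
  · simp only [extend, h]
    rcases lt_trichotomy i k with h | rfl | h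
    · simp [freeze, h, h.le]
    · simp [freeze]
    · simp [freeze, h.not_gt, h.not_ge, h.ne']

/-- The trajectory that stays at `x` forever. -/
def start (x : S) : Trajectory S where
  state m := if m = 0 then Sum.inl x else Sum.inr ()
  sojourn _ := ⊤
  state_zero := ⟨x, rfl⟩
  sojourn_pos _ := ENNReal.zero_lt_top
  sojourn_eq_top_iff m := by simp
  absorbed m := by simp

lemma freeze_zero_start (x : S) : (start x).freeze 0 = start x := by
  refine eq_of_state_sojourn (fun i => ?_) fun i => ?_
  · by_cases hi : i = 0 <;> simp [freeze, start, hi]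
  · simp [freeze, start]

/-- The trajectory with the `k`-component histories of a consistent family `(ω_k)`. -/
def glue (η : ℕ → Trajectory S) (h : ∀ k, (η (k + 1)).freeze k = η k) : Trajectory S where
  state m := (η m).state m
  sojourn m := (η (m + 1)).sojourn m
  state_zero := (η 0).state_zero
  sojourn_pos m := (η (m + 1)).sojourn_pos m
  sojourn_eq_top_iff m := (η (m + 1)).sojourn_eq_top_iff m
  absorbed m hm := by
    rw [← h (m + 1), freeze_sojourn_of_lt _ (Nat.lt_succ_self m)] at hm
    exact (η (m + 1 + 1)).absorbed m hm

lemma freeze_glue (η : ℕ → Trajectory S) (h : ∀ k, (η (k + 1)).freeze k = η k) (k : ℕ) :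
    (glue η h).freeze k = η k := by
  -- Consistency of successive histories propagates to every pair m ≤ k, because freezing later and
  -- then earlier is freezing earlier.
  have hle : ∀ m k, m ≤ k → (η k).freeze m = η m := by
    intro m k hmk
    induction k, hmk using Nat.le_induction with
    | base => rw [← h m, freeze_freeze_self]
    | succ k hk ih => rw [← ih, ← h k, freeze_freeze _ hk]
  have hself := hle k k le_rfl
  refine eq_of_state_sojourn (fun i => ?_) fun i => ?_
  · by_cases hi : i ≤ k
    · rw [freeze_state_of_le _ hi]
      change (η i).state i = _
      rw [← hle i k hi, freeze_state_of_le _ le_rfl]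
    · rw [← hself, freeze_state_of_lt _ (not_le.1 hi), freeze_state_of_lt _ (not_le.1 hi)]
  · by_cases hi : i < k
    · rw [freeze_sojourn_of_lt _ hi]
      change (η (i + 1)).sojourn i = _
      rw [← hle (i + 1) k hi, freeze_sojourn_of_lt _ (Nat.lt_succ_self i)]
    · rw [← hself, freeze_sojourn_of_le _ (not_lt.1 hi), freeze_sojourn_of_le _ (not_lt.1 hi)]

/-! #### Measurability -/

variable [MeasurableSpace S]

lemma measurable_of_state_sojourn {X : Type*} [MeasurableSpace X] {f : X → Trajectory S}
    (h1 : ∀ m, Measurable fun x => (f x).state m) (h2 : ∀ m, Measurable fun x => (f x).sojourn m) :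
    Measurable f := by
  refine measurable_comap_iff.2 ?_
  exact (measurable_pi_iff.2 h1).prodMk (measurable_pi_iff.2 h2)

lemma measurable_freeze (k : ℕ) : Measurable fun ω : Trajectory S => ω.freeze k := by
  refine measurable_of_state_sojourn (fun m => ?_) fun m => ?_
  · by_cases h : m ≤ k
    · simpa [freeze, h] using measurable_state m
    · simp [freeze, h]
  · by_cases h : m < k
    · simpa [freeze, h] using measurable_sojourn m
    · simp [freeze, h]

lemma measurable_nextJump (k : ℕ) : Measurable fun p : Trajectory S × (ℝ≥0∞ × (S ⊕ Unit)) =>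
    nextJump k p.1 p.2 := by
  classical
  have hl : MeasurableSet {y : S ⊕ Unit | y.isLeft} := by
    have : {y : S ⊕ Unit | y.isLeft} = Sum.inl '' (univ : Set S) := by
      ext y; cases y <;> simp
    rw [this]
    exact MeasurableSet.univ.inl_image
  have h1 : Measurable fun p : Trajectory S × (ℝ≥0∞ × (S ⊕ Unit)) => p.1.jumpTime k :=
    (measurable_jumpTime k).comp measurable_fst
  have h2 : Measurable fun p : Trajectory S × (ℝ≥0∞ × (S ⊕ Unit)) => p.2.1 := by fun_prop
  have h3 : Measurable fun p : Trajectory S × (ℝ≥0∞ × (S ⊕ Unit)) => p.2.2 := by fun_prop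
  unfold nextJump
  refine Measurable.ite ?_ measurable_snd measurable_const
  exact (measurableSet_lt h1 measurable_const).inter ((measurableSet_lt measurable_const h2).inter
    ((measurableSet_lt h2 measurable_const).inter (h3 hl)))

lemma measurable_extend (k : ℕ) : Measurable fun p : Trajectory S × (ℝ≥0∞ × (S ⊕ Unit)) =>
    extend k p.1 p.2 := by
  refine measurable_of_state_sojourn (fun m => ?_) fun m => ?_
  · simp only [extend]
    split_ifs
    · exact (measurable_state m).comp measurable_fst
    · exact (measurable_nextJump k).snd
    · exact measurable_const
  · simp only [extend]
    split_ifs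
    · exact (measurable_sojourn m).comp measurable_fst
    · exact (measurable_nextJump k).fst
    · exact measurable_const

lemma measurable_start : Measurable (start : S → Trajectory S) := by
  refine measurable_of_state_sojourn (fun m => ?_) fun m => measurable_const
  simp only [start]
  split_ifs
  · exact measurable_inl
  · exact measurable_const

lemma measurable_glue {X : Type*} [MeasurableSpace X] {η : X → ℕ → Trajectory S}
    {h : ∀ x k, (η x (k + 1)).freeze k = η x k} (hη : ∀ k, Measurable fun x => η x k) :
    Measurable fun x => glue (η x) (h x) :=
  measurable_of_state_sojourn
    (fun m => show Measurable fun x => (η x m).state m from (measurable_state m).comp (hη m))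
    fun m => show Measurable fun x => (η x (m + 1)).sojourn m from
      (measurable_sojourn m).comp (hη (m + 1))

/-- Events of the history σ-algebra do not change when the trajectory is frozen. -/
lemma mem_iff_freeze_mem {k : ℕ} {C : Set (Trajectory S)}
    (hC : MeasurableSet[historySigma S k] C) (ω : Trajectory S) : ω ∈ C ↔ ω.freeze k ∈ C := by
  obtain ⟨B, -, rfl⟩ := hC
  have h1 : ∀ i : Fin (k + 1), (ω.freeze k).state i = ω.state i := fun i =>
    ω.freeze_state_of_le (Nat.lt_succ_iff.1 i.2)
  have h2 : ∀ i : Fin k, (ω.freeze k).sojourn i = ω.sojourn i := fun i =>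
    ω.freeze_sojourn_of_lt i.2
  simp only [mem_preimage, h1, h2]

lemma historySigma_le (k : ℕ) : historySigma S k ≤ (inferInstance : MeasurableSpace (Trajectory S)) := by
  refine Measurable.comap_le ?_
  exact (measurable_pi_iff.2 fun i => measurable_state _).prodMk
    (measurable_pi_iff.2 fun i => measurable_sojourn _)

lemma measurable_historySigma_freeze (k : ℕ) :
    Measurable[historySigma S k] fun ω : Trajectory S => ω.freeze k := by
  have hb : Measurable[historySigma S k] fun ω : Trajectory S =>
    ((fun i : Fin (k + 1) => ω.state i), (fun i : Fin k => ω.sojourn i)) := comap_measurable _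
  refine @measurable_of_state_sojourn S _ _ (historySigma S k) _ (fun m => ?_) fun m => ?_
  · by_cases h : m ≤ k
    · simp only [freeze, h, if_true]
      exact (measurable_pi_apply (⟨m, Nat.lt_succ_iff.2 h⟩ : Fin (k + 1))).comp
        (measurable_fst.comp hb)
    · simp [freeze, h]
  · by_cases h : m < k
    · simp only [freeze, h, if_true]
      exact (measurable_pi_apply (⟨m, h⟩ : Fin k)).comp (measurable_snd.comp hb)
    · simp [freeze, h]

/-- Measures on the space of trajectories are determined by the laws of all histories. -/
lemma ext_of_map_freeze {P Q : Measure (Trajectory S)} [IsProbabilityMeasure P]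
    [IsProbabilityMeasure Q] (h : ∀ k, P.map (freeze · k) = Q.map (freeze · k)) : P = Q := by
  have hgen : (inferInstance : MeasurableSpace (Trajectory S)) = MeasurableSpace.generateFrom
      {E | ∃ k, ∃ B : Set (Trajectory S), MeasurableSet B ∧ E = {ω | ω.freeze k ∈ B}} := by
    refine le_antisymm ?_ (MeasurableSpace.generateFrom_le ?_)
    · let m0 : MeasurableSpace (Trajectory S) := MeasurableSpace.generateFrom
        {E | ∃ k, ∃ B : Set (Trajectory S), MeasurableSet B ∧ E = {ω | ω.freeze k ∈ B}}
      have hid : @Measurable _ _ m0 instMeasurableSpace (id : Trajectory S → Trajectory S) := by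
        refine @measurable_of_state_sojourn S _ _ m0 _ (fun m => ?_) fun m => ?_
        · intro s hs
          refine MeasurableSpace.measurableSet_generateFrom
            ⟨m, {ω | ω.state m ∈ s}, measurable_state m hs, ?_⟩
          ext ω
          simp [freeze]
        · intro s hs
          refine MeasurableSpace.measurableSet_generateFrom
            ⟨m + 1, {ω | ω.sojourn m ∈ s}, measurable_sojourn m hs, ?_⟩
          ext ω
          simp [freeze]
      exact fun s hs => hid hs
    · rintro E ⟨k, B, hB, rfl⟩
      exact measurable_freeze k hB
  refine ext_of_generate_finite _ hgen ?_ ?_ (by simp)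
  -- Both events are functions of the longer of the two histories, so the generating sets form a
  -- π-system.
  · rintro E ⟨k, B, hB, rfl⟩ E' ⟨k', B', hB', rfl⟩ -
    refine ⟨max k k', {ω | ω.freeze k ∈ B ∧ ω.freeze k' ∈ B'},
      (measurable_freeze k hB).inter (measurable_freeze k' hB'), ?_⟩
    ext ω
    simp [freeze_freeze]
  · rintro E ⟨k, B, hB, rfl⟩
    have := congrArg (fun μ => μ B) (h k)
    simp only [Measure.map_apply (measurable_freeze k) hB] at this
    exact this

end Trajectory

section

open ProbabilityTheory

/-! ### Predictable sets and policies -/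

/-- Serves to show that information available before the next jump cannot separate a trajectory from
its frozen version; by induction it suffices to look at generators. -/
lemma MeasurableSpace.mem_iff_mem_of_generateFrom {α : Type*} {G : Set (Set α)} {p q : α}
    (h : ∀ E ∈ G, p ∈ E ↔ q ∈ E) {D : Set α} (hD : MeasurableSet[MeasurableSpace.generateFrom G] D) :
    p ∈ D ↔ q ∈ D := by
  induction D, hD using MeasurableSpace.generateFrom_induction with
  | hC E hE _ => exact h E hE
  | empty => simp
  | compl E _ ih => simp [ih]
  | iUnion E _ ih => simp [ih]

namespace Trajectory

/-- The negated clause amounts to t ≤ T_{m+1}, since T_{m+1} < t already forces x_{m+1} ∈ S. It is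
written with the redundant state condition so that every event has the form {T_m < t, x_m ∈ Γ},
whose predictability is easy. -/
lemma leftState_mem_inl_iff {S : Type*} (ω : Trajectory S) (t : ℝ≥0) (Γ : Set S) :
    ω.leftState t ∈ Sum.inl '' Γ ↔ (t = 0 ∧ ω.state 0 ∈ Sum.inl '' Γ) ∨
      ∃ m, (ω.jumpTime m < t ∧ ω.state m ∈ Sum.inl '' Γ) ∧
        ¬ (ω.jumpTime (m + 1) < t ∧ ω.state (m + 1) ∈ Sum.inl '' (univ : Set S)) := by
  have hstate : ∀ m, ω.jumpTime m < t → ω.state m ∈ Sum.inl '' (univ : Set S) := fun m hm => by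
    obtain ⟨x, hx⟩ := (ω.jumpTime_lt_top_iff m).1 (hm.trans_le le_top)
    exact ⟨x, mem_univ x, hx.symm⟩
  constructor
  · intro h
    by_cases ht : t = 0
    · subst ht
      exact Or.inl ⟨rfl, by rwa [leftState_zero] at h⟩
    · right
      rcases ω.exists_jumpTime_lt_le ht with ⟨m, h1, h2⟩ | hlt
      · rw [ω.leftState_eq_state h1 h2] at h
        exact ⟨m, ⟨h1, h⟩, fun h3 => absurd h3.1 (not_lt.2 h2)⟩
      · rw [ω.leftState_of_forall_lt ht hlt] at h
        simp at h
  · rintro (⟨rfl, h⟩ | ⟨m, ⟨h1, h2⟩, h3⟩)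
    · rwa [leftState_zero]
    · have h4 : (t : ℝ≥0∞) ≤ ω.jumpTime (m + 1) := by
        by_contra hlt
        exact h3 ⟨not_le.1 hlt, hstate _ (not_le.1 hlt)⟩
      rwa [ω.leftState_eq_state h1 h4]

variable {S : Type*} [MeasurableSpace S]

/-- A generator with index m ≤ k involves only data kept by freezing. One with m > k holds for
neither trajectory: T_m exceeds s in ω and is infinite after freezing. -/
lemma filtration_mem_iff {s : ℝ≥0} {k : ℕ} {ω : Trajectory S} (hs : (s : ℝ≥0∞) < ω.jumpTime (k + 1))
    {C : Set (Trajectory S)} (hC : MeasurableSet[filtration S s] C) : ω ∈ C ↔ ω.freeze k ∈ C := by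
  refine MeasurableSpace.mem_iff_mem_of_generateFrom ?_ hC
  rintro E ⟨s', hs', m, Γ, -, rfl⟩
  have hs'' : (s' : ℝ≥0∞) < ω.jumpTime (k + 1) := lt_of_le_of_lt (by exact_mod_cast hs') hs
  by_cases hm : m ≤ k
  · simp only [mem_ofPred_eq, freeze_jumpTime_of_le _ hm, freeze_state_of_le _ hm]
  · have h1 : ¬ ω.jumpTime m ≤ s' := not_le.2 (hs''.trans_le (ω.jumpTime_mono (by omega)))
    simp [h1, freeze_jumpTime_of_lt _ (not_le.1 hm)]

/-- Predictable sets do not see the next jump. -/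
lemma predictable_mem_iff {k : ℕ} {ω : Trajectory S} {t : ℝ≥0} (h1 : ω.jumpTime k < t)
    (h2 : (t : ℝ≥0∞) ≤ ω.jumpTime (k + 1)) {D : Set (ℝ≥0 × Trajectory S)}
    (hD : MeasurableSet[(filtration S).predictable] D) : (t, ω) ∈ D ↔ (t, ω.freeze k) ∈ D := by
  refine MeasurableSpace.mem_iff_mem_of_generateFrom ?_ hD
  rintro E (⟨C, -, rfl⟩ | ⟨s, C, hC, rfl⟩)
  · have ht : t ≠ 0 := by
      rintro rfl
      simp at h1
    simp [ht]
  · simp only [mem_prod, mem_Ioi]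
    refine and_congr_right fun hst => filtration_mem_iff (lt_of_lt_of_le ?_ h2) hC
    exact_mod_cast hst

lemma predictable_le :
    (filtration S).predictable ≤ (inferInstance : MeasurableSpace (ℝ≥0 × Trajectory S)) := by
  refine MeasurableSpace.generateFrom_le ?_
  rintro E (⟨C, hC, rfl⟩ | ⟨s, C, hC, rfl⟩)
  · exact (measurableSet_singleton _).prod ((filtration S).le _ _ hC)
  · exact measurableSet_Ioi.prod ((filtration S).le _ _ hC)

lemma measurableSet_predictable_jumpTime_lt (m : ℕ) {Γ : Set S} (hΓ : MeasurableSet Γ) :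
    MeasurableSet[(filtration S).predictable] {p : ℝ≥0 × Trajectory S |
      p.2.jumpTime m < (p.1 : ℝ≥0∞) ∧ p.2.state m ∈ Sum.inl '' Γ} := by
  have h : {p : ℝ≥0 × Trajectory S |
      p.2.jumpTime m < (p.1 : ℝ≥0∞) ∧ p.2.state m ∈ Sum.inl '' Γ} =
      -- T_m < t means T_m ≤ s < t for some rational s, which writes the event as a countable union
      -- of the rectangles that generate the predictable σ-algebra.
      ⋃ s : ℚ, Ioi (Real.toNNReal s) ×ˢ
        {ω | ω.jumpTime m ≤ (Real.toNNReal s : ℝ≥0∞) ∧ ω.state m ∈ Sum.inl '' Γ} := by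
    ext ⟨t, ω⟩
    simp only [mem_ofPred_eq, mem_iUnion, mem_prod, mem_Ioi]
    constructor
    · rintro ⟨h1, h2⟩
      obtain ⟨q, -, hq1, hq2⟩ := ENNReal.lt_iff_exists_rat_btwn.1 h1
      exact ⟨q, by exact_mod_cast hq2, hq1.le, h2⟩
    · rintro ⟨q, hq1, hq2, hq3⟩
      exact ⟨hq2.trans_lt (by exact_mod_cast hq1), hq3⟩
  rw [h]
  refine @MeasurableSet.iUnion _ _ ((filtration S).predictable) _ _ fun s => ?_
  exact measurableSet_predictable_Ioi_prod
    (MeasurableSpace.measurableSet_generateFrom ⟨_, le_rfl, m, Γ, hΓ, rfl⟩)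

/-- The left limit `ξ_{t-}` is a predictable process. -/
lemma measurable_predictable_leftState :
    Measurable[(filtration S).predictable] fun p : ℝ≥0 × Trajectory S => p.2.leftState p.1 := by
  let mp : MeasurableSpace (ℝ≥0 × Trajectory S) := (filtration S).predictable
  have hinl : ∀ Γ : Set S, MeasurableSet Γ →
      MeasurableSet[mp] {p : ℝ≥0 × Trajectory S | p.2.leftState p.1 ∈ Sum.inl '' Γ} := by
    intro Γ hΓ
    have h : {p : ℝ≥0 × Trajectory S | p.2.leftState p.1 ∈ Sum.inl '' Γ} =
        ({⊥} ×ˢ {ω | ω.jumpTime 0 ≤ ((0 : ℝ≥0) : ℝ≥0∞) ∧ ω.state 0 ∈ Sum.inl '' Γ}) ∪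
          ⋃ m, {p : ℝ≥0 × Trajectory S |
              p.2.jumpTime m < (p.1 : ℝ≥0∞) ∧ p.2.state m ∈ Sum.inl '' Γ} \
            {p : ℝ≥0 × Trajectory S |
              p.2.jumpTime (m + 1) < (p.1 : ℝ≥0∞) ∧ p.2.state (m + 1) ∈ Sum.inl '' univ} := by
      ext ⟨t, ω⟩
      rw [mem_ofPred_eq, leftState_mem_inl_iff]
      simp only [mem_union, mem_iUnion, Set.mem_sdiff, mem_ofPred_eq, mem_prod, mem_singleton_iff,
        jumpTime_zero, bot_eq_zero', true_and, ENNReal.coe_zero, le_refl]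
    rw [h]
    refine MeasurableSet.union ?_ (MeasurableSet.iUnion fun m => ?_)
    · exact measurableSet_predictable_singleton_bot_prod
        (MeasurableSpace.measurableSet_generateFrom ⟨0, le_rfl, 0, Γ, hΓ, rfl⟩)
    · exact (measurableSet_predictable_jumpTime_lt m hΓ).diff
        (measurableSet_predictable_jumpTime_lt (m + 1) MeasurableSet.univ)
  intro B hB
  have hB' : (fun p : ℝ≥0 × Trajectory S => p.2.leftState p.1) ⁻¹' B =
      {p | p.2.leftState p.1 ∈ Sum.inl '' (Sum.inl ⁻¹' B)} ∪
        ({p | p.2.leftState p.1 ∈ Sum.inl '' (univ : Set S)}ᶜ ∩ {_p | Sum.inr () ∈ B}) := by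
    ext ⟨t, ω⟩
    cases h : ω.leftState t <;> simp [h]
  rw [hB']
  exact (hinl _ (measurable_inl hB)).union
    ((hinl _ MeasurableSet.univ).compl.inter (MeasurableSet.const _))

end Trajectory

namespace CTMDP

open Trajectory

variable {S A : Type*} [MeasurableSpace S] [MeasurableSpace A]

lemma isPolicy_stationaryPolicy (M : CTMDP S A) {φ : S → A} (hφ : Measurable φ)
    (hadm : ∀ x, φ x ∈ M.admissible x) (hset : ∀ x, MeasurableSet (M.admissible x)) :
    M.IsPolicy (stationaryPolicy φ) where
  isProbability ω t := by unfold stationaryPolicy; infer_instance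
  predictable B hB := by
    have hm : Measurable (Sum.map φ (id : Unit → Unit)) := hφ.sumMap measurable_id
    have h : (fun p : ℝ≥0 × Trajectory S => stationaryPolicy φ p.2 p.1 B) =
        (Measure.dirac · B) ∘ (Sum.map φ id) ∘ fun p : ℝ≥0 × Trajectory S => p.2.leftState p.1 := rfl
    rw [h]
    exact ((Measure.measurable_coe hB).comp Measure.measurable_dirac).comp
      (hm.comp measurable_predictable_leftState)
  concentrated ω t := by
    unfold stationaryPolicy
    cases h : ω.leftState t with
    | inl x =>
      rw [Measure.dirac_apply' _ (by simpa [admissibleExt] using hset x)]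
      simp [admissibleExt, hadm x]
    | inr u =>
      have hr : MeasurableSet ({Sum.inr ()} : Set (A ⊕ Unit)) := by
        rw [← image_singleton]
        exact (measurableSet_singleton ()).inr_image
      rw [Measure.dirac_apply' _ (by simpa [admissibleExt] using hr)]
      simp [admissibleExt]

/-- A policy as a kernel from time-trajectory pairs to actions. -/
noncomputable def policyKernel {M : CTMDP S A} {π : Trajectory S → ℝ≥0 → Measure (A ⊕ Unit)}
    (hπ : M.IsPolicy π) : Kernel (ℝ≥0 × Trajectory S) (A ⊕ Unit) where
  toFun p := π p.2 p.1
  measurable' := Measure.measurable_of_measurable_coe _ fun B hB =>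
    (hπ.predictable B hB).mono predictable_le le_rfl

instance {M : CTMDP S A} {π : Trajectory S → ℝ≥0 → Measure (A ⊕ Unit)} (hπ : M.IsPolicy π) :
    IsMarkovKernel (policyKernel hπ) := ⟨fun p => hπ.isProbability p.2 p.1⟩

lemma IsPolicy.eq_freeze {M : CTMDP S A} {π : Trajectory S → ℝ≥0 → Measure (A ⊕ Unit)}
    (hπ : M.IsPolicy π) {k : ℕ} {ω : Trajectory S} {t : ℝ≥0} (h1 : ω.jumpTime k < t)
    (h2 : (t : ℝ≥0∞) ≤ ω.jumpTime (k + 1)) : π ω t = π (ω.freeze k) t := by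
  ext B hB
  -- The set where the probability of B equals its value at the frozen point is predictable and
  -- contains that point, hence also the unfrozen one.
  have h := predictable_mem_iff h1 h2
    (hπ.predictable B hB (measurableSet_singleton (π (ω.freeze k) t B)))
  simpa using h

lemma actionIntegral_freeze {M : CTMDP S A} {π : Trajectory S → ℝ≥0 → Measure (A ⊕ Unit)}
    (hπ : M.IsPolicy π) (f : S → A → ℝ≥0∞) {k : ℕ} {ω : Trajectory S} {t : ℝ≥0}
    (h1 : ω.jumpTime k < t) (h2 : (t : ℝ≥0∞) ≤ ω.jumpTime (k + 1)) :
    actionIntegral π f ω t = actionIntegral π f (ω.freeze k) t := by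
  rw [actionIntegral, actionIntegral, ω.leftState_eq_state h1 h2, ω.leftState_freeze h1,
    hπ.eq_freeze h1 h2]

end CTMDP

end

section

open ProbabilityTheory

/-! ### Stage-wise description of the controlled law -/

lemma measurable_hazardSurvival_Iic {X : Type*} [MeasurableSpace X] {r : X → ℝ≥0 → ℝ≥0∞}
    (hr : Measurable (Function.uncurry r)) :
    Measurable fun p : X × ℝ≥0 => hazardSurvival (r p.1) (Iic p.2) := by
  have h : (fun p : X × ℝ≥0 => ∫⁻ v in Iic p.2, r p.1 v ∂timeMeasure) =
      fun p : X × ℝ≥0 => ∫⁻ v, {q : (X × ℝ≥0) × ℝ≥0 | q.2 ≤ q.1.2}.indicator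
        (fun q => r q.1.1 q.2) (p, v) ∂timeMeasure := by
    ext p
    rw [← lintegral_indicator measurableSet_Iic]
    rfl
  have hm : Measurable ({q : (X × ℝ≥0) × ℝ≥0 | q.2 ≤ q.1.2}.indicator
      (fun q : (X × ℝ≥0) × ℝ≥0 => r q.1.1 q.2)) := by
    refine Measurable.indicator ?_ (measurableSet_le measurable_snd (by fun_prop))
    exact hr.comp (measurable_fst.fst.prodMk measurable_snd)
  unfold hazardSurvival
  refine Measurable.ereal_exp (Measurable.neg (Measurable.coe_ereal_ennreal ?_))
  rw [h]
  exact hm.lintegral_prod_right'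

lemma measurable_hazardSurvival_univ {X : Type*} [MeasurableSpace X] {r : X → ℝ≥0 → ℝ≥0∞}
    (hr : Measurable (Function.uncurry r)) :
    Measurable fun x : X => hazardSurvival (r x) univ := by
  unfold hazardSurvival
  refine Measurable.ereal_exp (Measurable.neg (Measurable.coe_ereal_ennreal ?_))
  simp only [Measure.restrict_univ]
  exact hr.lintegral_prod_right'

lemma hazardSurvival_zero (D : Set ℝ≥0) : hazardSurvival (fun _ => 0) D = 1 := by
  simp [hazardSurvival]

/-- The instant of the jump itself is a null set; it has to be excluded because there the left limit
may still be the previous state. -/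
lemma hazardSurvival_congr {r r' : ℝ≥0 → ℝ≥0∞} (h : ∀ u, u ≠ 0 → r u = r' u) (D : Set ℝ≥0) :
    hazardSurvival r D = hazardSurvival r' D := by
  have : ∀ᵐ u ∂(timeMeasure.restrict D), r u = r' u := by
    refine ae_restrict_of_ae ?_
    filter_upwards [compl_mem_ae_iff.2 (measure_singleton (0 : ℝ≥0))] with u hu
    exact h u hu
  rw [hazardSurvival, lintegral_congr_ae this, hazardSurvival]

namespace CTMDP

open Trajectory

variable {S A : Type*}

/-- The extension of a function on `S × A` by zero to `x_∞` and `a_∞`. -/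
def extendZero (f : S → A → ℝ≥0∞) (s : S ⊕ Unit) (a : A ⊕ Unit) : ℝ≥0∞ :=
  Sum.elim (fun x => Sum.elim (f x) (fun _ => 0) a) (fun _ => 0) s

lemma extendZero_add (f f' : S → A → ℝ≥0∞) (s : S ⊕ Unit) (a : A ⊕ Unit) :
    extendZero (fun x b => f x b + f' x b) s a = extendZero f s a + extendZero f' s a := by
  cases s <;> cases a <;> simp [extendZero]

lemma extendZero_mul_left (f : S → A → ℝ≥0∞) (v : S → ℝ≥0∞) (s : S ⊕ Unit) (a : A ⊕ Unit) :
    extendZero (fun x b => f x b * v x) s a = extendZero f s a * Sum.elim v (fun _ => 0) s := by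
  cases s <;> cases a <;> simp [extendZero]

variable [MeasurableSpace A]

/-- The integral of `f(x_k, ·)` against the policy at time `T_k + u`, `u > 0`, given that the
`(k+1)`-st jump has not occurred by then. -/
noncomputable def stageIntegral (π : Trajectory S → ℝ≥0 → Measure (A ⊕ Unit)) (f : S → A → ℝ≥0∞)
    (k : ℕ) (ω : Trajectory S) (u : ℝ≥0) : ℝ≥0∞ :=
  -- At u = 0 the left limit may still be the previous state, so the policy need not be concentrated
  -- on the actions of x_k. Setting this single value to 0 makes the bounds below hold at every u.
  if u = 0 then 0 else
    ∫⁻ a, extendZero f (ω.state k) a ∂(π (ω.freeze k) ((ω.jumpTime k).toNNReal + u))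

section

variable {π : Trajectory S → ℝ≥0 → Measure (A ⊕ Unit)}

lemma stageIntegral_freeze (f : S → A → ℝ≥0∞) (k : ℕ) (ω : Trajectory S) :
    stageIntegral π f k (ω.freeze k) = stageIntegral π f k ω := by
  ext u
  simp only [stageIntegral, freeze_state_of_le _ le_rfl, freeze_freeze_self,
    freeze_jumpTime_of_le _ le_rfl]

lemma stageIntegral_of_state_inr (f : S → A → ℝ≥0∞) {k : ℕ} {ω : Trajectory S}
    (h : ω.state k = Sum.inr ()) (u : ℝ≥0) : stageIntegral π f k ω u = 0 := by
  simp [stageIntegral, h, extendZero]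

lemma jumpTime_lt_coe_toNNReal_add {ω : Trajectory S} {k : ℕ} (h : ω.jumpTime k < ⊤) {u : ℝ≥0}
    (hu : u ≠ 0) : ω.jumpTime k < (((ω.jumpTime k).toNNReal + u : ℝ≥0) : ℝ≥0∞) := by
  rw [ENNReal.coe_add, ENNReal.coe_toNNReal h.ne]
  exact ENNReal.lt_add_right h.ne (by exact_mod_cast hu)

lemma actionIntegral_eq_stageIntegral (f : S → A → ℝ≥0∞) {k : ℕ} {ω : Trajectory S}
    (h : ω.jumpTime k < ⊤) {u : ℝ≥0} (hu : u ≠ 0) :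
    actionIntegral π f (ω.freeze k) ((ω.jumpTime k).toNNReal + u) = stageIntegral π f k ω u := by
  rw [actionIntegral, ω.leftState_freeze (jumpTime_lt_coe_toNNReal_add h hu), stageIntegral,
    if_neg hu]
  rfl

end

variable [MeasurableSpace S]

lemma measurable_extendZero {f : S → A → ℝ≥0∞} (hf : Measurable (Function.uncurry f)) :
    Measurable (Function.uncurry (extendZero f)) := by
  have he : MeasurableEmbedding (Prod.map Sum.inl Sum.inl : S × A → (S ⊕ Unit) × (A ⊕ Unit)) :=
    MeasurableEmbedding.prodMap ⟨Sum.inl_injective, measurable_inl, fun _ hs => hs.inl_image⟩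
      ⟨Sum.inl_injective, measurable_inl, fun _ hs => hs.inl_image⟩
  have h : Function.uncurry (extendZero f) =
      Function.extend (Prod.map Sum.inl Sum.inl) (Function.uncurry f) (fun _ => 0) := by
    ext ⟨s, a⟩
    have hno : ∀ q : (S ⊕ Unit) × (A ⊕ Unit), q ∉ range (Prod.map Sum.inl Sum.inl : S × A → _) →
        Function.extend (Prod.map Sum.inl Sum.inl) (Function.uncurry f) (fun _ => 0) q = 0 :=
      fun q hq => Function.extend_apply' _ _ _ hq
    cases s with
    | inr s => rw [hno _ (by rintro ⟨p, hp⟩; simp [Prod.map] at hp)]; rfl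
    | inl s =>
      cases a with
      | inr a => rw [hno _ (by rintro ⟨p, hp⟩; simp [Prod.map] at hp)]; rfl
      | inl a =>
        exact (he.injective.extend_apply (Function.uncurry f) (fun _ => 0) (s, a)).symm
  rw [h]
  exact he.measurable_extend hf measurable_const

lemma measurable_extendZero_right {f : S → A → ℝ≥0∞} (hf : Measurable (Function.uncurry f))
    (s : S ⊕ Unit) : Measurable (extendZero f s) :=
  (measurable_extendZero hf).comp measurable_prodMk_left

variable {M : CTMDP S A} {π : Trajectory S → ℝ≥0 → Measure (A ⊕ Unit)}

lemma measurable_stageIntegral (hπ : M.IsPolicy π) {f : S → A → ℝ≥0∞}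
    (hf : Measurable (Function.uncurry f)) (k : ℕ) :
    Measurable (Function.uncurry (stageIntegral π f k)) := by
  have hm : Measurable fun p : Trajectory S × ℝ≥0 =>
      (((p.1.jumpTime k).toNNReal + p.2, p.1.freeze k) : ℝ≥0 × Trajectory S) :=
    ((((measurable_jumpTime k).comp measurable_fst).ennreal_toNNReal).add measurable_snd).prodMk
      ((measurable_freeze k).comp measurable_fst)
  have hF : Measurable (Function.uncurry fun (p : Trajectory S × ℝ≥0) (a : A ⊕ Unit) =>
      extendZero f (p.1.state k) a) :=
    (measurable_extendZero hf).comp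
      (((measurable_state k).comp measurable_fst.fst).prodMk measurable_snd)
  have := Measurable.lintegral_kernel_prod_right (κ := (policyKernel hπ).comap _ hm) hF
  exact Measurable.ite (measurable_snd (measurableSet_singleton 0)) measurable_const this

lemma ae_admissible (hπ : M.IsPolicy π) {k : ℕ} {ω : Trajectory S} {x : S}
    (hx : ω.state k = Sum.inl x) {u : ℝ≥0} (hu : u ≠ 0) :
    ∀ᵐ a ∂(π (ω.freeze k) ((ω.jumpTime k).toNNReal + u)), a ∈ Sum.inl '' M.admissible x := by
  have h := hπ.concentrated (ω.freeze k) ((ω.jumpTime k).toNNReal + u)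
  rw [ω.leftState_freeze
    (jumpTime_lt_coe_toNNReal_add ((ω.jumpTime_lt_top_iff k).2 ⟨x, hx⟩) hu), hx] at h
  exact h

lemma stageIntegral_mono (hπ : M.IsPolicy π) {f f' : S → A → ℝ≥0∞}
    (h : ∀ x, ∀ a ∈ M.admissible x, f x a ≤ f' x a) (k : ℕ) (ω : Trajectory S) (u : ℝ≥0) :
    stageIntegral π f k ω u ≤ stageIntegral π f' k ω u := by
  unfold stageIntegral
  split_ifs with hu
  · exact le_rfl
  · cases hs : ω.state k with
    | inr s => simp [extendZero]
    | inl x =>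
      refine lintegral_mono_ae ?_
      filter_upwards [ae_admissible hπ hs hu]
      rintro _ ⟨a, ha, rfl⟩
      exact h x a ha

lemma stageIntegral_congr (hπ : M.IsPolicy π) {f f' : S → A → ℝ≥0∞}
    (h : ∀ x, ∀ a ∈ M.admissible x, f x a = f' x a) (k : ℕ) (ω : Trajectory S) (u : ℝ≥0) :
    stageIntegral π f k ω u = stageIntegral π f' k ω u :=
  le_antisymm (stageIntegral_mono hπ (fun x a ha => (h x a ha).le) k ω u)
    (stageIntegral_mono hπ (fun x a ha => (h x a ha).ge) k ω u)

lemma stageIntegral_add {f f' : S → A → ℝ≥0∞}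
    (hf : Measurable (Function.uncurry f)) (k : ℕ) (ω : Trajectory S) (u : ℝ≥0) :
    stageIntegral π (fun x a => f x a + f' x a) k ω u =
      stageIntegral π f k ω u + stageIntegral π f' k ω u := by
  unfold stageIntegral
  split_ifs
  · simp
  · simp only [extendZero_add]
    exact lintegral_add_left (measurable_extendZero_right hf _) _

lemma stageIntegral_mul {f : S → A → ℝ≥0∞} (hf : Measurable (Function.uncurry f)) (v : S → ℝ≥0∞)
    (k : ℕ) (ω : Trajectory S) (u : ℝ≥0) :
    stageIntegral π (fun x a => f x a * v x) k ω u =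
      stageIntegral π f k ω u * Sum.elim v (fun _ => 0) (ω.state k) := by
  unfold stageIntegral
  split_ifs
  · simp
  · simp only [extendZero_mul_left]
    exact lintegral_mul_const _ (measurable_extendZero_right hf _)

lemma stageIntegral_const (hπ : M.IsPolicy π) (c : ℝ≥0∞) {k : ℕ} {ω : Trajectory S} {x : S}
    (hx : ω.state k = Sum.inl x) {u : ℝ≥0} (hu : u ≠ 0) :
    stageIntegral π (fun _ _ => c) k ω u = c := by
  have := hπ.isProbability (ω.freeze k) ((ω.jumpTime k).toNNReal + u)
  have h : ∫⁻ a, extendZero (fun _ _ => c) (ω.state k) a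
      ∂(π (ω.freeze k) ((ω.jumpTime k).toNNReal + u)) =
      ∫⁻ _, c ∂(π (ω.freeze k) ((ω.jumpTime k).toNNReal + u)) := by
    refine lintegral_congr_ae ?_
    filter_upwards [ae_admissible hπ hx hu]
    rintro _ ⟨a, ha, rfl⟩
    simp [extendZero, hx]
  rw [stageIntegral, if_neg hu, h]
  simp

/-- The jump rates factor as `q(Γ ∖ {x} | x, a) = g(x, a) ν(Γ | x)`, where the total rate `g` is
bounded by `G(x)` on `A(x)`. -/
structure HasJumpKernel (M : CTMDP S A) (g : S → A → ℝ≥0∞) (ν : Kernel S S) (G : S → ℝ≥0) :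
    Prop where
  measurable_rate : Measurable (Function.uncurry g)
  rate_eq : ∀ x, ∀ a ∈ M.admissible x, ∀ Γ : Set S, MeasurableSet Γ →
    ENNReal.ofReal (M.rate x a (Γ \ {x})) = g x a * ν x Γ
  rate_le : ∀ x, ∀ a ∈ M.admissible x, g x a ≤ G x

/-- The law of the state after a jump, with no mass at `x_∞`. -/
noncomputable def nextLaw (ν : Kernel S S) : Kernel (S ⊕ Unit) S where
  toFun := Sum.elim ν fun _ => 0
  measurable' := ν.measurable.sumElim measurable_const

@[simp] lemma nextLaw_inl (ν : Kernel S S) (x : S) : nextLaw ν (Sum.inl x) = ν x := rfl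

@[simp] lemma nextLaw_inr (ν : Kernel S S) (y : Unit) : nextLaw ν (Sum.inr y) = 0 := rfl

instance (ν : Kernel S S) [IsMarkovKernel ν] : IsFiniteKernel (nextLaw ν) := by
  refine ⟨1, ENNReal.one_lt_top, fun s => ?_⟩
  cases s <;> simp

section

variable {g : S → A → ℝ≥0∞} {ν : Kernel S S} {G : S → ℝ≥0}

/-- Jump rates may be unbounded over the state space, but within a stage the state is fixed, so the
hazard has a finite bound there. The survival identities require no more. -/
lemma HasJumpKernel.stageIntegral_le (hM : M.HasJumpKernel g ν G) (hπ : M.IsPolicy π) (k : ℕ)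
    (ω : Trajectory S) (u : ℝ≥0) :
    stageIntegral π g k ω u ≤ (Sum.elim G (fun _ => 0) (ω.state k) : ℝ≥0) := by
  cases hs : ω.state k with
  | inr s => rw [stageIntegral_of_state_inr g hs]; exact zero_le
  | inl x =>
    rw [stageIntegral]
    split_ifs with hu
    · exact zero_le
    · have := hπ.isProbability (ω.freeze k) ((ω.jumpTime k).toNNReal + u)
      calc _ ≤ ∫⁻ _, (G x : ℝ≥0∞) ∂(π (ω.freeze k) ((ω.jumpTime k).toNNReal + u)) := by
            refine lintegral_mono_ae ?_
            filter_upwards [ae_admissible hπ hs hu]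
            rintro _ ⟨a, ha, rfl⟩
            simpa [extendZero, hs] using hM.rate_le x a ha
        _ = _ := by simp

/-- Because the action influences only the total rate, the intensity is a product: given the history
and that a jump occurs, its time and its target are independent. -/
lemma HasJumpKernel.historyIntensity_eq (hM : M.HasJumpKernel g ν G) (hπ : M.IsPolicy π)
    [IsMarkovKernel ν] {k : ℕ} {ω : Trajectory S} (h : ω.jumpTime k < ⊤) {u : ℝ≥0} (hu : u ≠ 0)
    {Γ : Set S} (hΓ : MeasurableSet Γ) :
    M.historyIntensity π k Γ ω u = stageIntegral π g k ω u * nextLaw ν (ω.state k) Γ := by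
  obtain ⟨x, hx⟩ := (ω.jumpTime_lt_top_iff k).1 h
  rw [historyIntensity, intensity, actionIntegral_eq_stageIntegral _ h hu,
    stageIntegral_congr hπ (f' := fun x a => g x a * ν x Γ)
      (fun x a ha => hM.rate_eq x a ha Γ hΓ), stageIntegral_mul hM.measurable_rate, hx]
  rfl

lemma HasJumpKernel.survival_eq (hM : M.HasJumpKernel g ν G) (hπ : M.IsPolicy π)
    [IsMarkovKernel ν] {k : ℕ} {ω : Trajectory S} (h : ω.jumpTime k < ⊤) (D : Set ℝ≥0) :
    M.survival π k ω D = hazardSurvival (stageIntegral π g k ω) D := by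
  obtain ⟨x, hx⟩ := (ω.jumpTime_lt_top_iff k).1 h
  refine hazardSurvival_congr (fun u hu => ?_) D
  rw [hM.historyIntensity_eq hπ h hu MeasurableSet.univ, hx]
  simp

/-- The conditional law of `(θ_{k+1}, x_{k+1})` given the `k`-component history. -/
noncomputable def stepKernel (π : Trajectory S → ℝ≥0 → Measure (A ⊕ Unit)) (g : S → A → ℝ≥0∞)
    (ν : Kernel S S) [IsMarkovKernel ν] (k : ℕ) : Kernel (Trajectory S) (ℝ≥0∞ × (S ⊕ Unit)) :=
  ((Kernel.const _ timeMeasure ×ₖ (nextLaw ν).comap _ (measurable_state k)).withDensity fun ω p =>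
      stageIntegral π g k ω p.1 * hazardSurvival (stageIntegral π g k ω) (Iic p.1)).map
      (Prod.map (↑) Sum.inl) +
    (Kernel.const _ (Measure.dirac (⊤, Sum.inr ()))).withDensity fun ω _ =>
      hazardSurvival (stageIntegral π g k ω) univ

variable [IsMarkovKernel ν]

lemma stepKernel_eq (hM : M.HasJumpKernel g ν G) (hπ : M.IsPolicy π) (k : ℕ) (ω : Trajectory S) :
    stepKernel π g ν k ω =
      ((timeMeasure.prod (nextLaw ν (ω.state k))).withDensity fun p =>
        stageIntegral π g k ω p.1 * hazardSurvival (stageIntegral π g k ω) (Iic p.1)).map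
        (Prod.map (↑) Sum.inl) +
      hazardSurvival (stageIntegral π g k ω) univ • Measure.dirac (⊤, Sum.inr ()) := by
  have hs := measurable_stageIntegral hπ hM.measurable_rate k
  have hinl : Measurable (Prod.map (↑) Sum.inl : ℝ≥0 × S → ℝ≥0∞ × (S ⊕ Unit)) :=
    measurable_coe_nnreal_ennreal.prodMap measurable_inl
  have h1 : Measurable (Function.uncurry fun (ω : Trajectory S) (p : ℝ≥0 × S) =>
      stageIntegral π g k ω p.1 * hazardSurvival (stageIntegral π g k ω) (Iic p.1)) :=
    (hs.comp (measurable_fst.prodMk measurable_snd.fst)).mul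
      ((measurable_hazardSurvival_Iic hs).comp (measurable_fst.prodMk measurable_snd.fst))
  have h2 : Measurable (Function.uncurry fun (ω : Trajectory S) (_ : ℝ≥0∞ × (S ⊕ Unit)) =>
      hazardSurvival (stageIntegral π g k ω) univ) :=
    (measurable_hazardSurvival_univ hs).comp measurable_fst
  rw [stepKernel, add_apply, Kernel.map_apply _ hinl, Kernel.withDensity_apply _ h1,
    Kernel.withDensity_apply _ h2, Kernel.prod_apply, withDensity_const]
  rfl

lemma lintegral_stepKernel (hM : M.HasJumpKernel g ν G) (hπ : M.IsPolicy π) (k : ℕ)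
    (ω : Trajectory S) {F : ℝ≥0∞ × (S ⊕ Unit) → ℝ≥0∞} (hF : Measurable F) :
    ∫⁻ p, F p ∂(stepKernel π g ν k ω) =
      ∫⁻ u, stageIntegral π g k ω u * hazardSurvival (stageIntegral π g k ω) (Iic u) *
        ∫⁻ y, F ((u : ℝ≥0∞), Sum.inl y) ∂(nextLaw ν (ω.state k)) ∂timeMeasure +
      hazardSurvival (stageIntegral π g k ω) univ * F (⊤, Sum.inr ()) := by
  have hs := measurable_stageIntegral hπ hM.measurable_rate k
  have hinl : Measurable (Prod.map (↑) Sum.inl : ℝ≥0 × S → ℝ≥0∞ × (S ⊕ Unit)) :=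
    measurable_coe_nnreal_ennreal.prodMap measurable_inl
  have hd : Measurable fun u : ℝ≥0 =>
      stageIntegral π g k ω u * hazardSurvival (stageIntegral π g k ω) (Iic u) :=
    (hs.comp (measurable_const.prodMk measurable_id)).mul
      ((measurable_hazardSurvival_Iic hs).comp (measurable_const.prodMk measurable_id))
  have h := lintegral_withDensity_eq_lintegral_mul
    (timeMeasure.prod (nextLaw ν (ω.state k))) (hd.comp measurable_fst) (hF.comp hinl)
  rw [lintegral_prod _ ((hd.comp measurable_fst).mul (hF.comp hinl)).aemeasurable] at h
  rw [stepKernel_eq hM hπ, lintegral_add_measure, lintegral_map hF hinl, lintegral_smul_measure,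
    lintegral_dirac' _ hF, smul_eq_mul]
  congr 1
  refine h.trans ?_
  refine lintegral_congr fun u => ?_
  simp only [Pi.mul_apply]
  exact lintegral_const_mul (stageIntegral π g k ω u *
    hazardSurvival (stageIntegral π g k ω) (Iic u)) (f := fun y => F ((u : ℝ≥0∞), Sum.inl y))
    (hF.comp (measurable_const.prodMk measurable_inl))

lemma stepKernel_prod (hM : M.HasJumpKernel g ν G) (hπ : M.IsPolicy π) (k : ℕ)
    (ω : Trajectory S) {I : Set ℝ≥0∞} (hI : MeasurableSet I) {Γ : Set (S ⊕ Unit)}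
    (hΓ : MeasurableSet Γ) :
    stepKernel π g ν k ω (I ×ˢ Γ) =
      (∫⁻ u in (↑) ⁻¹' I, stageIntegral π g k ω u *
        hazardSurvival (stageIntegral π g k ω) (Iic u) ∂timeMeasure) *
        nextLaw ν (ω.state k) (Sum.inl ⁻¹' Γ) +
      hazardSurvival (stageIntegral π g k ω) univ * (I ×ˢ Γ).indicator 1 (⊤, Sum.inr ()) := by
  have hs := measurable_stageIntegral hπ hM.measurable_rate k
  have hd : Measurable fun u : ℝ≥0 =>
      stageIntegral π g k ω u * hazardSurvival (stageIntegral π g k ω) (Iic u) :=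
    (hs.comp (measurable_const.prodMk measurable_id)).mul
      ((measurable_hazardSurvival_Iic hs).comp (measurable_const.prodMk measurable_id))
  rw [← lintegral_indicator_one (hI.prod hΓ), lintegral_stepKernel hM hπ k ω
    (measurable_one.indicator (hI.prod hΓ)), ← lintegral_mul_const _ hd,
    ← lintegral_indicator (measurable_coe_nnreal_ennreal hI)]
  congr 1
  refine lintegral_congr fun u => ?_
  by_cases hu : (u : ℝ≥0∞) ∈ I
  · have h1 : ∫⁻ y, (I ×ˢ Γ).indicator 1 ((u : ℝ≥0∞), Sum.inl y) ∂(nextLaw ν (ω.state k)) =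
        nextLaw ν (ω.state k) (Sum.inl ⁻¹' Γ) := by
      rw [← lintegral_indicator_one (measurable_inl hΓ)]
      refine lintegral_congr fun y => ?_
      by_cases hy : (Sum.inl y : S ⊕ Unit) ∈ Γ <;> simp [hu, hy]
    rw [h1, indicator_of_mem (by exact hu)]
  · have h1 : ∫⁻ y, (I ×ˢ Γ).indicator 1 ((u : ℝ≥0∞), Sum.inl y) ∂(nextLaw ν (ω.state k)) =
        0 := by simp [hu]
    rw [h1, indicator_of_notMem (by exact hu), mul_zero]

/-- From a state in S the density and the atom share the unit mass by
`lintegral_mul_hazardSurvival`. At x_∞ the hazard is zero and the atom carries all of it. -/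
lemma isMarkovKernel_stepKernel (hM : M.HasJumpKernel g ν G) (hπ : M.IsPolicy π) (k : ℕ) :
    IsMarkovKernel (stepKernel π g ν k) := by
  refine ⟨fun ω => ⟨?_⟩⟩
  rw [← univ_prod_univ, stepKernel_prod hM hπ k ω MeasurableSet.univ MeasurableSet.univ]
  cases hs : ω.state k with
  | inl x =>
    have hm := measurable_stageIntegral hπ hM.measurable_rate k
    have h := lintegral_mul_hazardSurvival (r := stageIntegral π g k ω)
      (hm.comp (measurable_const.prodMk measurable_id)) (hM.stageIntegral_le hπ k ω)
    simpa using h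
  | inr y =>
    have : stageIntegral π g k ω = fun _ => 0 := funext (stageIntegral_of_state_inr g hs)
    simp [this, hazardSurvival_zero]

lemma stepKernel_freeze (hM : M.HasJumpKernel g ν G) (hπ : M.IsPolicy π) (k : ℕ)
    (ω : Trajectory S) : stepKernel π g ν k (ω.freeze k) = stepKernel π g ν k ω := by
  simp only [stepKernel_eq hM hπ, stageIntegral_freeze, freeze_state_of_le _ le_rfl]

end

end CTMDP

end

section

open ProbabilityTheory

namespace CTMDP

open Trajectory

variable {S A : Type*} [MeasurableSpace S] [MeasurableSpace A] {M : CTMDP S A}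
  {π : Trajectory S → ℝ≥0 → Measure (A ⊕ Unit)} {g : S → A → ℝ≥0∞} {ν : Kernel S S} {G : S → ℝ≥0}
  [IsMarkovKernel ν]

/-- The pair `(θ_{k+1}, x_{k+1})` lies in `I × Γ`. -/
def jumpEvent (S : Type*) (k : ℕ) (I : Set ℝ≥0∞) (Γ : Set (S ⊕ Unit)) : Set (Trajectory S) :=
  {ω | ω.sojourn k ∈ I ∧ ω.state (k + 1) ∈ Γ}

lemma measurableSet_jumpEvent (k : ℕ) {I : Set ℝ≥0∞} (hI : MeasurableSet I) {Γ : Set (S ⊕ Unit)}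
    (hΓ : MeasurableSet Γ) : MeasurableSet (jumpEvent S k I Γ) :=
  (measurable_sojourn k hI).inter (measurable_state (k + 1) hΓ)

lemma measurable_stepJump (k : ℕ) : Measurable fun ω : Trajectory S =>
    (ω.freeze k, (ω.sojourn k, ω.state (k + 1))) :=
  (measurable_freeze k).prodMk ((measurable_sojourn k).prodMk (measurable_state (k + 1)))

lemma measurableSet_inr : MeasurableSet ({Sum.inr ()} : Set (S ⊕ Unit)) := by
  rw [← image_singleton]
  exact (measurableSet_singleton ()).inr_image

lemma measurableSet_coe_image {I : Set ℝ≥0} (hI : MeasurableSet I) :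
    MeasurableSet (((↑) : ℝ≥0 → ℝ≥0∞) '' I) := by
  have h : ((↑) : ℝ≥0 → ℝ≥0∞) '' I = ENNReal.toNNReal ⁻¹' I ∩ {⊤}ᶜ := by
    ext x
    constructor
    · rintro ⟨y, hy, rfl⟩
      simpa using hy
    · rintro ⟨h1, h2⟩
      exact ⟨x.toNNReal, h1, ENNReal.coe_toNNReal h2⟩
  rw [h]
  exact (ENNReal.measurable_toNNReal hI).inter (measurableSet_singleton _).compl

lemma stepKernel_jump (hM : M.HasJumpKernel g ν G) (hπ : M.IsPolicy π) (k : ℕ) (ω : Trajectory S)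
    {I : Set ℝ≥0} (hI : MeasurableSet I) {Γ : Set S} (hΓ : MeasurableSet Γ) :
    stepKernel π g ν k ω (((↑) '' I) ×ˢ (Sum.inl '' Γ)) =
      {ω : Trajectory S | ω.jumpTime k < ⊤}.indicator (fun ω =>
        ∫⁻ u in I, M.historyIntensity π k Γ ω u * M.survival π k ω (Iic u) ∂timeMeasure) ω := by
  have hm := measurable_stageIntegral hπ hM.measurable_rate k
  have hd : Measurable fun u : ℝ≥0 =>
      stageIntegral π g k ω u * hazardSurvival (stageIntegral π g k ω) (Iic u) :=
    (hm.comp (measurable_const.prodMk measurable_id)).mul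
      ((measurable_hazardSurvival_Iic hm).comp (measurable_const.prodMk measurable_id))
  rw [stepKernel_prod hM hπ k ω (measurableSet_coe_image hI) hΓ.inl_image,
    preimage_image_eq _ ENNReal.coe_injective, preimage_image_eq _ Sum.inl_injective,
    indicator_of_notMem (by simp), mul_zero, add_zero]
  by_cases h : ω.jumpTime k < ⊤
  · rw [indicator_of_mem (by exact h), ← lintegral_mul_const _ hd]
    refine lintegral_congr_ae ?_
    refine ae_restrict_of_ae ?_
    filter_upwards [compl_mem_ae_iff.2 (measure_singleton (0 : ℝ≥0))] with u hu
    rw [hM.historyIntensity_eq hπ h hu hΓ, hM.survival_eq hπ h]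
    ring
  · rw [indicator_of_notMem (by exact h)]
    cases hs : ω.state k with
    | inl x => exact absurd ((ω.jumpTime_lt_top_iff k).2 ⟨x, hs⟩) h
    | inr y => simp

lemma stepKernel_noJump (hM : M.HasJumpKernel g ν G) (hπ : M.IsPolicy π) (k : ℕ)
    (ω : Trajectory S) :
    stepKernel π g ν k ω ({⊤} ×ˢ {Sum.inr ()}) =
      {ω : Trajectory S | ω.jumpTime k = ⊤}.indicator 1 ω +
      {ω : Trajectory S | ω.jumpTime k < ⊤}.indicator (fun ω => M.survival π k ω univ) ω := by
  rw [stepKernel_prod hM hπ k ω (measurableSet_singleton _) measurableSet_inr]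
  have h0 : (Sum.inl ⁻¹' {Sum.inr ()} : Set S) = ∅ := by ext; simp
  rw [h0, measure_empty, mul_zero, zero_add, indicator_of_mem (by simp), Pi.one_apply, mul_one]
  by_cases h : ω.jumpTime k < ⊤
  · rw [indicator_of_notMem (by simpa using h.ne), indicator_of_mem (by exact h),
      hM.survival_eq hπ h, zero_add]
  · rw [indicator_of_mem (by simpa using h), indicator_of_notMem (by exact h)]
    cases hs : ω.state k with
    | inl x => exact absurd ((ω.jumpTime_lt_top_iff k).2 ⟨x, hs⟩) h
    | inr y =>
      have : stageIntegral π g k ω = fun _ => 0 := funext (stageIntegral_of_state_inr g hs)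
      simp [this, hazardSurvival_zero]

/-- The kernel is carried by finite times paired with states in S, together with the point (∞, x_∞).
So its values on the two kinds of sets that occur in `IsControlledLaw` determine it on all
rectangles. -/
lemma stepKernel_eq_jump_add_noJump (hM : M.HasJumpKernel g ν G) (hπ : M.IsPolicy π) (k : ℕ)
    (ω : Trajectory S) {I : Set ℝ≥0∞} (hI : MeasurableSet I) {Γ : Set (S ⊕ Unit)}
    (hΓ : MeasurableSet Γ) :
    stepKernel π g ν k ω (I ×ˢ Γ) =
      stepKernel π g ν k ω (((↑) '' ((↑) ⁻¹' I : Set ℝ≥0)) ×ˢ (Sum.inl '' (Sum.inl ⁻¹' Γ))) +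
      (I ×ˢ Γ).indicator 1 (⊤, Sum.inr ()) * stepKernel π g ν k ω ({⊤} ×ˢ {Sum.inr ()}) := by
  rw [stepKernel_prod hM hπ k ω hI hΓ, stepKernel_prod hM hπ k ω
    (measurableSet_coe_image (measurable_coe_nnreal_ennreal hI)) (measurable_inl hΓ).inl_image,
    stepKernel_prod hM hπ k ω (measurableSet_singleton _) measurableSet_inr,
    preimage_image_eq _ ENNReal.coe_injective, preimage_image_eq _ Sum.inl_injective]
  have h0 : (Sum.inl ⁻¹' {Sum.inr ()} : Set S) = ∅ := by ext; simp
  rw [h0, measure_empty, mul_zero, zero_add, indicator_of_notMem (s := _ ×ˢ (Sum.inl '' _)) (by simp),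
    indicator_of_mem (s := {⊤} ×ˢ {Sum.inr ()}) (by simp), mul_zero, add_zero, Pi.one_apply, mul_one,
    mul_comm (hazardSurvival _ _)]

/-- The counterpart of `stepKernel_eq_jump_add_noJump` for P: on every trajectory θ_{k+1} = ∞
exactly when x_{k+1} = x_∞, so mixed pairs never occur. -/
lemma measure_inter_jumpEvent (P : Measure (Trajectory S)) {C : Set (Trajectory S)}
    (hC : MeasurableSet C) (k : ℕ) (I : Set ℝ≥0∞) (Γ : Set (S ⊕ Unit)) :
    P (C ∩ jumpEvent S k I Γ) =
      P (C ∩ jumpEvent S k ((↑) '' ((↑) ⁻¹' I : Set ℝ≥0)) (Sum.inl '' (Sum.inl ⁻¹' Γ))) +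
      (I ×ˢ Γ).indicator 1 (⊤, Sum.inr ()) * P (C ∩ jumpEvent S k {⊤} {Sum.inr ()}) := by
  have hmem : ∀ ω : Trajectory S, ω ∈ jumpEvent S k I Γ ↔
      ω ∈ jumpEvent S k ((↑) '' ((↑) ⁻¹' I : Set ℝ≥0)) (Sum.inl '' (Sum.inl ⁻¹' Γ)) ∨
      ((⊤ : ℝ≥0∞), (Sum.inr () : S ⊕ Unit)) ∈ I ×ˢ Γ ∧ ω ∈ jumpEvent S k {⊤} {Sum.inr ()} := by
    intro ω
    have h := ω.sojourn_eq_top_iff k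
    simp only [jumpEvent, mem_ofPred_eq, mem_singleton_iff, mem_prod, mem_image, mem_preimage]
    cases hs : ω.state (k + 1) with
    | inl x =>
      have ht : ω.sojourn k ≠ ⊤ := fun h' => by simp [hs] at h; exact h h'
      lift ω.sojourn k to ℝ≥0 using ht with t
      simp
    | inr y =>
      have ht : ω.sojourn k = ⊤ := h.2 hs
      simp [ht]
  by_cases hc : ((⊤ : ℝ≥0∞), (Sum.inr () : S ⊕ Unit)) ∈ I ×ˢ Γ
  · have h1 : C ∩ jumpEvent S k I Γ =
        (C ∩ jumpEvent S k ((↑) '' ((↑) ⁻¹' I : Set ℝ≥0)) (Sum.inl '' (Sum.inl ⁻¹' Γ))) ∪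
          (C ∩ jumpEvent S k {⊤} {Sum.inr ()}) := by
      ext ω
      rw [mem_inter_iff, hmem]
      simp only [hc, true_and, mem_union, mem_inter_iff]
      tauto
    rw [h1, measure_union, indicator_of_mem hc, Pi.one_apply, one_mul]
    · rw [Set.disjoint_left]
      rintro ω ⟨-, -, y, -, h2⟩ ⟨-, -, h3⟩
      rw [← h2] at h3
      simp at h3
    · exact hC.inter (measurableSet_jumpEvent k (measurableSet_singleton _) measurableSet_inr)
  · have h1 : C ∩ jumpEvent S k I Γ =
        C ∩ jumpEvent S k ((↑) '' ((↑) ⁻¹' I : Set ℝ≥0)) (Sum.inl '' (Sum.inl ⁻¹' Γ)) := by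
      ext ω
      rw [mem_inter_iff, hmem]
      simp only [hc, false_and, or_false, mem_inter_iff]
    rw [h1, indicator_of_notMem hc, zero_mul, add_zero]

/-- The events of the history σ-algebra are the preimages of measurable sets under freezing, so
testing the joint law of history and next pair on rectangles is the same as testing on such events.
-/
lemma map_step_eq_iff (hM : M.HasJumpKernel g ν G) (hπ : M.IsPolicy π) (P : Measure (Trajectory S))
    [IsProbabilityMeasure P] (k : ℕ) :
    P.map (fun ω => (ω.freeze k, (ω.sojourn k, ω.state (k + 1)))) =
        (P.map (freeze · k)) ⊗ₘ stepKernel π g ν k ↔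
      ∀ C, MeasurableSet[historySigma S k] C → ∀ I, MeasurableSet I → ∀ Γ, MeasurableSet Γ →
        P (C ∩ jumpEvent S k I Γ) = ∫⁻ ω in C, stepKernel π g ν k ω (I ×ˢ Γ) ∂P := by
  have := isMarkovKernel_stepKernel hM hπ k
  have hR : ∀ C, MeasurableSet C → ∀ I, MeasurableSet I → ∀ Γ, MeasurableSet Γ →
      ((P.map (freeze · k)) ⊗ₘ stepKernel π g ν k) (C ×ˢ I ×ˢ Γ) =
        ∫⁻ ω in (freeze · k) ⁻¹' C, stepKernel π g ν k ω (I ×ˢ Γ) ∂P := by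
    intro C hC I hI Γ hΓ
    have : SFinite (P.map (freeze · k)) := inferInstance
    rw [Measure.compProd_apply_prod hC (hI.prod hΓ), setLIntegral_map hC
      ((stepKernel π g ν k).measurable_coe (hI.prod hΓ)) (measurable_freeze k)]
    simp only [stepKernel_freeze hM hπ]
  have hL : ∀ C, MeasurableSet C → ∀ I, MeasurableSet I → ∀ Γ, MeasurableSet Γ →
      P.map (fun ω => (ω.freeze k, (ω.sojourn k, ω.state (k + 1)))) (C ×ˢ I ×ˢ Γ) =
        P ((freeze · k) ⁻¹' C ∩ jumpEvent S k I Γ) := by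
    intro C hC I hI Γ hΓ
    rw [Measure.map_apply (measurable_stepJump k) (hC.prod (hI.prod hΓ))]
    rfl
  constructor
  · intro h C hC I hI Γ hΓ
    have hCm : MeasurableSet C := historySigma_le k C hC
    have hCe : (freeze · k) ⁻¹' C = C := by ext ω; exact (mem_iff_freeze_mem hC ω).symm
    have h1 := congrArg (fun μ => μ (C ×ˢ I ×ˢ Γ)) h
    simp only [hR C hCm I hI Γ hΓ, hL C hCm I hI Γ hΓ, hCe] at h1
    exact h1
  · intro h
    have : IsProbabilityMeasure
        (P.map (fun ω => (ω.freeze k, (ω.sojourn k, ω.state (k + 1))))) :=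
      Measure.isProbabilityMeasure_map (measurable_stepJump k).aemeasurable
    refine Measure.ext_prod₃ fun {C} {I} {Γ} hC hI hΓ => ?_
    rw [hR C hC I hI Γ hΓ, hL C hC I hI Γ hΓ]
    exact h _ (measurable_historySigma_freeze k hC) I hI Γ hΓ

/-- The controlled law is characterized by the initial law and the one-step conditional laws. -/
lemma isControlledLaw_iff (hM : M.HasJumpKernel g ν G) (hπ : M.IsPolicy π) {γ : Measure S}
    [IsProbabilityMeasure γ] (P : Measure (Trajectory S)) [IsProbabilityMeasure P] :
    M.IsControlledLaw γ π P ↔ P.map (fun ω => ω.state 0) = γ.map Sum.inl ∧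
      ∀ k, P.map (fun ω => (ω.freeze k, (ω.sojourn k, ω.state (k + 1)))) =
        (P.map (freeze · k)) ⊗ₘ stepKernel π g ν k := by
  have hlt : ∀ k, MeasurableSet {ω : Trajectory S | ω.jumpTime k < ⊤} := fun k =>
    measurableSet_lt (measurable_jumpTime k) measurable_const
  have htop : ∀ k, MeasurableSet {ω : Trajectory S | ω.jumpTime k = ⊤} := fun k =>
    measurable_jumpTime k (measurableSet_singleton ⊤)
  have hinit : (∀ Γ : Set S, MeasurableSet Γ → P {ω | ω.state 0 ∈ Sum.inl '' Γ} = γ Γ) ↔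
      P.map (fun ω => ω.state 0) = γ.map Sum.inl := by
    constructor
    · intro h
      ext B hB
      rw [Measure.map_apply (measurable_state 0) hB, Measure.map_apply measurable_inl hB,
        ← h _ (measurable_inl hB)]
      congr 1
      ext ω
      obtain ⟨x, hx⟩ := ω.state_zero
      simp [hx]
    · intro h Γ hΓ
      have := congrArg (fun μ => μ (Sum.inl '' Γ)) h
      simp only [Measure.map_apply (measurable_state 0) hΓ.inl_image,
        Measure.map_apply measurable_inl hΓ.inl_image, preimage_image_eq _ Sum.inl_injective] at this
      exact this
  have hjump : ∀ k C, MeasurableSet C → ∀ I : Set ℝ≥0, MeasurableSet I → ∀ Γ : Set S,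
      MeasurableSet Γ →
      ∫⁻ ω in C, stepKernel π g ν k ω (((↑) '' I) ×ˢ (Sum.inl '' Γ)) ∂P =
      ∫⁻ ω in C ∩ {ω | ω.jumpTime k < ⊤},
        (∫⁻ u in I, M.historyIntensity π k Γ ω u * M.survival π k ω (Iic u) ∂timeMeasure) ∂P := by
    intro k C hC I hI Γ hΓ
    simp only [stepKernel_jump hM hπ k _ hI hΓ]
    rw [lintegral_indicator (hlt k), Measure.restrict_restrict (hlt k), inter_comm]
  have hno : ∀ k C, MeasurableSet C →
      ∫⁻ ω in C, stepKernel π g ν k ω ({⊤} ×ˢ {Sum.inr ()}) ∂P =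
      P (C ∩ {ω | ω.jumpTime k = ⊤}) +
        ∫⁻ ω in C ∩ {ω | ω.jumpTime k < ⊤}, M.survival π k ω univ ∂P := by
    intro k C hC
    simp only [stepKernel_noJump hM hπ k]
    rw [lintegral_add_left (measurable_one.indicator (htop k)), lintegral_indicator (hlt k),
      Measure.restrict_restrict (hlt k), inter_comm _ C, lintegral_indicator_one (htop k),
      Measure.restrict_apply (htop k), inter_comm _ C]
  constructor
  · intro h
    refine ⟨hinit.1 h.initial, fun k => (map_step_eq_iff hM hπ P k).2 ?_⟩
    intro C hC I hI Γ hΓ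
    have hCm : MeasurableSet C := historySigma_le k C hC
    simp only [stepKernel_eq_jump_add_noJump hM hπ k _ hI hΓ]
    rw [measure_inter_jumpEvent P hCm k I Γ, lintegral_add_left
      ((stepKernel π g ν k).measurable_coe ((measurableSet_coe_image
        (measurable_coe_nnreal_ennreal hI)).prod (measurable_inl hΓ).inl_image)),
      lintegral_const_mul _ ((stepKernel π g ν k).measurable_coe
        ((measurableSet_singleton _).prod measurableSet_inr)),
      hjump k C hCm _ (measurable_coe_nnreal_ennreal hI) _ (measurable_inl hΓ), hno k C hCm]
    congr 1
    · exact h.jump k C hC _ (measurable_coe_nnreal_ennreal hI) _ (measurable_inl hΓ)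
    · congr 1
      exact h.no_jump k C hC
  · rintro ⟨h0, h⟩
    refine ⟨inferInstance, hinit.2 h0, fun k C hC I hI Γ hΓ => ?_, fun k C hC => ?_⟩
    · have hCm : MeasurableSet C := historySigma_le k C hC
      rw [← hjump k C hCm I hI Γ hΓ]
      exact (map_step_eq_iff hM hπ P k).1 (h k) C hC _ (measurableSet_coe_image hI) _ hΓ.inl_image
    · have hCm : MeasurableSet C := historySigma_le k C hC
      rw [← hno k C hCm]
      exact (map_step_eq_iff hM hπ P k).1 (h k) C hC _ (measurableSet_singleton _) _
        measurableSet_inr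

/-! ### Uniqueness and existence of the controlled law -/

lemma map_freeze_succ {P : Measure (Trajectory S)}
    [IsProbabilityMeasure P] {k : ℕ}
    (h : P.map (fun ω => (ω.freeze k, (ω.sojourn k, ω.state (k + 1)))) =
      (P.map (freeze · k)) ⊗ₘ stepKernel π g ν k) :
    P.map (freeze · (k + 1)) =
      ((P.map (freeze · k)) ⊗ₘ stepKernel π g ν k).map fun p => extend k p.1 p.2 := by
  rw [← h, Measure.map_map (measurable_extend k) (measurable_stepJump k)]
  congr 1
  ext ω
  exact (extend_freeze_self k ω).symm

lemma map_freeze_zero [Nonempty S] {γ : Measure S} {P : Measure (Trajectory S)}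
    (h : P.map (fun ω => ω.state 0) = γ.map Sum.inl) : P.map (freeze · 0) = γ.map start := by
  -- The value assigned to x_∞ plays no role, since the initial state of a trajectory lies in S.
  let x₀ : S := Classical.arbitrary S
  have hm : Measurable (Sum.elim start fun _ => start x₀ : S ⊕ Unit → Trajectory S) :=
    measurable_start.sumElim measurable_const
  have h1 : (freeze · 0 : Trajectory S → Trajectory S) =
      (Sum.elim start fun _ => start x₀) ∘ fun ω => ω.state 0 := by
    ext ω
    obtain ⟨x, hx⟩ := ω.state_zero
    simp only [Function.comp_apply, hx, Sum.elim_inl]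
    refine eq_of_state_sojourn (fun i => ?_) fun i => ?_
    · by_cases hi : i = 0
      · subst hi; simp [freeze, start, hx]
      · simp [freeze, start, hi]
    · simp [freeze, start]
  rw [h1, ← Measure.map_map hm (measurable_state 0), h, Measure.map_map hm measurable_inl]
  rfl

/-- The initial law fixes the zeroth history, and the common step kernel passes the law of each
history on to the next. -/
lemma IsControlledLaw.unique [Nonempty S] (hM : M.HasJumpKernel g ν G) (hπ : M.IsPolicy π)
    {γ : Measure S} [IsProbabilityMeasure γ] {P Q : Measure (Trajectory S)}
    (hP : M.IsControlledLaw γ π P) (hQ : M.IsControlledLaw γ π Q) : P = Q := by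
  have := hP.isProbability
  have := hQ.isProbability
  obtain ⟨hP0, hP⟩ := (isControlledLaw_iff hM hπ P).1 hP
  obtain ⟨hQ0, hQ⟩ := (isControlledLaw_iff hM hπ Q).1 hQ
  refine ext_of_map_freeze fun k => ?_
  induction k with
  | zero => rw [map_freeze_zero hP0, map_freeze_zero hQ0]
  | succ k ih => rw [map_freeze_succ (hP k), map_freeze_succ (hQ k), ih]

end CTMDP

end

/-! ### Construction of the controlled law from independent noise -/

section

open ProbabilityTheory

namespace CTMDP

open Trajectory

variable {S A : Type*} [MeasurableSpace S] [MeasurableSpace A] {M : CTMDP S A}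
  {π : Trajectory S → ℝ≥0 → Measure (A ⊕ Unit)} {g : S → A → ℝ≥0∞} {ν : Kernel S S} {G : S → ℝ≥0}

/-- The histories driven by noise: `x₀` is the first component of the zeroth coordinate, and the
`(k+1)`-st jump is a function of the history and of the `(k+1)`-st coordinate. -/
noncomputable def noisyHistory (f : ℕ → Trajectory S → unitInterval → ℝ≥0∞ × (S ⊕ Unit)) :
    ℕ → (ℕ → S × unitInterval) → Trajectory S
  | 0, s => start (s 0).1
  | k + 1, s => extend k (noisyHistory f k s) (f k (noisyHistory f k s) (s (k + 1)).2)

section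

variable {f : ℕ → Trajectory S → unitInterval → ℝ≥0∞ × (S ⊕ Unit)}

omit [MeasurableSpace S] in
lemma freeze_noisyHistory (k : ℕ) (s : ℕ → S × unitInterval) :
    (noisyHistory f k s).freeze k = noisyHistory f k s := by
  cases k with
  | zero => exact freeze_zero_start _
  | succ k => exact freeze_succ_extend k _ _

omit [MeasurableSpace S] in
lemma freeze_noisyHistory_succ (s : ℕ → S × unitInterval) (k : ℕ) :
    (noisyHistory f (k + 1) s).freeze k = noisyHistory f k s := by
  rw [noisyHistory, freeze_extend, freeze_noisyHistory]

lemma measurable_noisyHistory (hf : ∀ k, Measurable (Function.uncurry (f k))) (k : ℕ) :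
    Measurable (noisyHistory f k) := by
  induction k with
  | zero => exact measurable_start.comp (measurable_pi_apply 0).fst
  | succ k ih =>
    exact (measurable_extend k).comp
      (ih.prodMk ((hf k).comp (ih.prodMk (measurable_pi_apply (k + 1)).snd)))

omit [MeasurableSpace S] in
lemma noisyHistory_congr {k : ℕ} {s s' : ℕ → S × unitInterval} (h : ∀ i ≤ k, s i = s' i) :
    noisyHistory f k s = noisyHistory f k s' := by
  induction k with
  | zero => rw [noisyHistory, noisyHistory, h 0 le_rfl]
  | succ k ih => rw [noisyHistory, noisyHistory, ih fun i hi => h i (by omega), h _ le_rfl]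

/-- The first k+1 noise coordinates determine the k-th history, so it is independent of the noise
that drives the next jump. -/
lemma map_noisyHistory_prodMk [Nonempty S] (hf : ∀ k, Measurable (Function.uncurry (f k)))
    (γ : Measure S) [IsProbabilityMeasure γ] (k : ℕ) :
    (Measure.infinitePi fun _ : ℕ => γ.prod (volume : Measure unitInterval)).map
        (fun s => (noisyHistory f k s, (s (k + 1)).2)) =
      ((Measure.infinitePi fun _ : ℕ => γ.prod (volume : Measure unitInterval)).map
        (noisyHistory f k)).prod volume := by
  classical
  set Q := Measure.infinitePi fun _ : ℕ => γ.prod (volume : Measure unitInterval) with hQ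
  have hind : iIndepFun (fun (i : ℕ) (s : ℕ → S × unitInterval) => s i) Q :=
    iIndepFun_infinitePi (X := fun _ x => x) (by fun_prop)
  have hfin := hind.indepFun_finset (Finset.range (k + 1)) {k + 1} (by simp) (by fun_prop)
  let d : S × unitInterval := (Classical.arbitrary S, 0)
  -- Extends the first k+1 coordinates to a whole sequence; the padding `d` is never read by
  -- `noisyHistory f k`.
  let e : (Finset.range (k + 1) → S × unitInterval) → ℕ → S × unitInterval :=
    fun r i => if h : i ∈ Finset.range (k + 1) then r ⟨i, h⟩ else d
  have he : Measurable e := by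
    refine measurable_pi_iff.2 fun i => ?_
    by_cases h : i ∈ Finset.range (k + 1)
    · simp only [e, h, dif_pos]; fun_prop
    · simp only [e, h, dif_neg, not_false_eq_true]; exact measurable_const
  have hcomp := hfin.comp ((measurable_noisyHistory hf k).comp he)
    (measurable_pi_apply (⟨k + 1, by simp⟩ : ({k + 1} : Finset ℕ))).snd
  have h1 : (noisyHistory f k ∘ e) ∘ (fun s (i : Finset.range (k + 1)) => s i) =
      noisyHistory f k := by
    ext s
    refine noisyHistory_congr fun i hi => ?_
    simp only [e, dif_pos (Finset.mem_range.2 (Nat.lt_succ_iff.2 hi))]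
  have h2 := hcomp.map_prod_eq_prod_map_map
    (((measurable_noisyHistory hf k).comp he).comp (by fun_prop)).aemeasurable
    ((measurable_pi_apply (⟨k + 1, by simp⟩ : ({k + 1} : Finset ℕ))).snd.comp
      (by fun_prop)).aemeasurable
  have h3 : Q.map (fun s => (s (k + 1)).2) = volume := by
    have : (fun s : ℕ → S × unitInterval => (s (k + 1)).2) = Prod.snd ∘ fun s => s (k + 1) := rfl
    rw [this, ← Measure.map_map measurable_snd (measurable_pi_apply _), hQ,
      Measure.infinitePi_map_eval]
    simp
  rw [h1] at h2
  rw [← h3]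
  exact h2

end

variable [IsMarkovKernel ν]

/-- The kernel is carried by the pairs (u, y) with 0 < u < ∞ and y ∈ S, which occur only if T_k < ∞,
and by (∞, x_∞). A map fixing these points cannot change it. -/
lemma map_stepKernel_eq_self (hM : M.HasJumpKernel g ν G) (hπ : M.IsPolicy π) (k : ℕ)
    (ω : Trajectory S) {T : ℝ≥0∞ × (S ⊕ Unit) → ℝ≥0∞ × (S ⊕ Unit)} (hT : Measurable T)
    (h1 : ω.jumpTime k < ⊤ → ∀ u : ℝ≥0, u ≠ 0 → ∀ y : S,
      T ((u : ℝ≥0∞), Sum.inl y) = ((u : ℝ≥0∞), Sum.inl y))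
    (h2 : T (⊤, Sum.inr ()) = (⊤, Sum.inr ())) :
    (stepKernel π g ν k ω).map T = stepKernel π g ν k ω := by
  refine Measure.ext_of_lintegral _ fun F hF => ?_
  rw [lintegral_map hF hT, lintegral_stepKernel hM hπ k ω (F := fun p => F (T p)) (hF.comp hT),
    lintegral_stepKernel hM hπ k ω hF, h2]
  congr 1
  refine lintegral_congr_ae ?_
  filter_upwards [compl_mem_ae_iff.2 (measure_singleton (0 : ℝ≥0))] with u hu
  cases hs : ω.state k with
  | inl x =>
    congr 1
    exact lintegral_congr fun y => by rw [h1 ((ω.jumpTime_lt_top_iff k).2 ⟨x, hs⟩) u hu y]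
  | inr y => simp

lemma map_nextJump_stepKernel (hM : M.HasJumpKernel g ν G) (hπ : M.IsPolicy π) (k : ℕ)
    (ω : Trajectory S) :
    (stepKernel π g ν k ω).map (nextJump k ω) = stepKernel π g ν k ω := by
  refine map_stepKernel_eq_self hM hπ k ω
    ((measurable_nextJump k).comp (measurable_const.prodMk measurable_id)) (fun h u hu y => ?_) ?_
  · simp [nextJump, h, pos_iff_ne_zero, hu]
  · simp [nextJump]

/-- A Markov kernel into a standard Borel space is the law of a measurable function of a uniform
variable. The pair is first coded in ℝ≥0∞ × S by sending x_∞ to an arbitrary state; nothing is lost,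
because θ = ∞ marks the pairs with x_∞. -/
lemma exists_map_eq_stepKernel [StandardBorelSpace S] [Nonempty S] (hM : M.HasJumpKernel g ν G)
    (hπ : M.IsPolicy π) (k : ℕ) :
    ∃ f : Trajectory S → unitInterval → ℝ≥0∞ × (S ⊕ Unit), Measurable (Function.uncurry f) ∧
      ∀ ω, volume.map (f ω) = stepKernel π g ν k ω := by
  classical
  have := isMarkovKernel_stepKernel hM hπ k
  let proj : ℝ≥0∞ × (S ⊕ Unit) → ℝ≥0∞ × S :=
    Prod.map id (Sum.elim id fun _ => Classical.arbitrary S)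
  let lift : ℝ≥0∞ × S → ℝ≥0∞ × (S ⊕ Unit) :=
    fun p => if p.1 = ⊤ then (⊤, Sum.inr ()) else (p.1, Sum.inl p.2)
  have hproj : Measurable proj := measurable_id.prodMap (measurable_id.sumElim measurable_const)
  have hlift : Measurable lift := Measurable.ite (measurable_fst (measurableSet_singleton ⊤))
    measurable_const (measurable_fst.prodMk (measurable_inl.comp measurable_snd))
  have : IsMarkovKernel ((stepKernel π g ν k).map proj) := Kernel.IsMarkovKernel.map _ hproj
  obtain ⟨f, hf, hfmap⟩ :=
    Kernel.exists_measurable_map_eq_unitInterval ((stepKernel π g ν k).map proj)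
  refine ⟨fun ω u => lift (f ω u), hlift.comp hf, fun ω => ?_⟩
  have hfω : Measurable (f ω) := hf.comp (measurable_const.prodMk measurable_id)
  have h1 : (volume : Measure unitInterval).map (fun u => lift (f ω u)) =
      (volume.map (f ω)).map lift := (Measure.map_map hlift hfω).symm
  rw [h1, hfmap, Kernel.map_apply _ hproj, Measure.map_map hlift hproj]
  refine map_stepKernel_eq_self hM hπ k ω (hlift.comp hproj) (fun _ u _ y => ?_) ?_
  · simp [lift, proj]
  · simp [lift, proj]

lemma map_prod_nextJump (hM : M.HasJumpKernel g ν G) (hπ : M.IsPolicy π) (k : ℕ)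
    {f : Trajectory S → unitInterval → ℝ≥0∞ × (S ⊕ Unit)} (hf : Measurable (Function.uncurry f))
    (hfmap : ∀ ω, volume.map (f ω) = stepKernel π g ν k ω) (μ : Measure (Trajectory S))
    [IsProbabilityMeasure μ] :
    (μ.prod volume).map (fun p => (p.1, nextJump k p.1 (f p.1 p.2))) =
      μ ⊗ₘ stepKernel π g ν k := by
  have := isMarkovKernel_stepKernel hM hπ k
  have hT : Measurable fun p : Trajectory S × unitInterval =>
      (p.1, nextJump k p.1 (f p.1 p.2)) :=
    measurable_fst.prodMk ((measurable_nextJump k).comp (measurable_fst.prodMk hf))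
  refine Measure.ext_of_lintegral _ fun F hF => ?_
  rw [lintegral_map hF hT, 
    lintegral_prod (fun p => F (p.1, nextJump k p.1 (f p.1 p.2))) (hF.comp hT).aemeasurable,
    Measure.lintegral_compProd hF]
  refine lintegral_congr fun ω => ?_
  have hfω : Measurable (f ω) := hf.comp (measurable_const.prodMk measurable_id)
  have hn : Measurable (nextJump k ω) :=
    (measurable_nextJump k).comp (measurable_const.prodMk measurable_id)
  have hFω : Measurable fun q => F (ω, q) := hF.comp (measurable_const.prodMk measurable_id)
  conv_rhs => rw [← map_nextJump_stepKernel hM hπ k ω, ← hfmap ω, Measure.map_map hn hfω,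
    lintegral_map hFω (hn.comp hfω)]
  rfl

/-- The law is the image of a product measure under the map gluing the noise-driven histories. By
construction the next pair is a function of the history and fresh uniform noise, with the step
kernel as its conditional law. -/
lemma exists_isControlledLaw [StandardBorelSpace S] [Nonempty S] (hM : M.HasJumpKernel g ν G)
    (hπ : M.IsPolicy π) (γ : Measure S) [IsProbabilityMeasure γ] :
    ∃ P, M.IsControlledLaw γ π P := by
  choose f hf hfmap using exists_map_eq_stepKernel (ν := ν) hM hπ
  set Q := Measure.infinitePi fun _ : ℕ => γ.prod (volume : Measure unitInterval) with hQ
  let traj : (ℕ → S × unitInterval) → Trajectory S :=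
    fun s => glue (fun k => noisyHistory f k s) (freeze_noisyHistory_succ s)
  have htraj : Measurable traj := measurable_glue fun k => measurable_noisyHistory hf k
  have hfreeze : ∀ s k, (traj s).freeze k = noisyHistory f k s := fun s k => freeze_glue _ _ k
  have hP : IsProbabilityMeasure (Q.map traj) :=
    Measure.isProbabilityMeasure_map htraj.aemeasurable
  refine ⟨Q.map traj, (isControlledLaw_iff hM hπ _).2 ⟨?_, fun k => ?_⟩⟩
  · rw [Measure.map_map (measurable_state 0) htraj]
    have h0 : (fun ω : Trajectory S => ω.state 0) ∘ traj =
        Sum.inl ∘ Prod.fst ∘ fun s : ℕ → S × unitInterval => s 0 := by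
      ext s
      rfl
    rw [h0, ← Measure.map_map measurable_inl (measurable_fst.comp (measurable_pi_apply 0)),
      ← Measure.map_map measurable_fst (measurable_pi_apply 0), hQ, Measure.infinitePi_map_eval]
    simp
  · have h1 : (Q.map traj).map (freeze · k) = Q.map (noisyHistory f k) := by
      rw [Measure.map_map (measurable_freeze k) htraj]
      congr 1
      ext s
      exact hfreeze s k
    have h2 : (fun ω : Trajectory S => (ω.freeze k, (ω.sojourn k, ω.state (k + 1)))) ∘ traj =
        (fun p : Trajectory S × unitInterval => (p.1, nextJump k p.1 (f k p.1 p.2))) ∘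
          fun s => (noisyHistory f k s, (s (k + 1)).2) := by
      ext s : 1
      refine Prod.ext (hfreeze s k) (Prod.ext ?_ ?_)
      · exact extend_sojourn_self k _ _
      · exact extend_state_succ k _ _
    have hm := measurable_noisyHistory hf k
    have hprob : IsProbabilityMeasure (Q.map (noisyHistory f k)) :=
      Measure.isProbabilityMeasure_map hm.aemeasurable
    have hg : Measurable fun p : Trajectory S × unitInterval =>
        (p.1, nextJump k p.1 (f k p.1 p.2)) :=
      measurable_fst.prodMk ((measurable_nextJump k).comp (measurable_fst.prodMk (hf k)))
    rw [h1, Measure.map_map (measurable_stepJump k) htraj, h2, ← Measure.map_map hg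
      (hm.prodMk (measurable_pi_apply (k + 1)).snd), map_noisyHistory_prodMk hf γ k]
    exact map_prod_nextJump hM hπ k (hf k) (hfmap k) _

lemma existsUnique_isControlledLaw [StandardBorelSpace S] [Nonempty S]
    (hM : M.HasJumpKernel g ν G) (hπ : M.IsPolicy π) (γ : Measure S) [IsProbabilityMeasure γ] :
    ∃! P, M.IsControlledLaw γ π P := by
  obtain ⟨P, hP⟩ := exists_isControlledLaw (ν := ν) hM hπ γ
  exact ⟨P, hP, fun Q hQ => hQ.unique hM hπ hP⟩

lemma isControlledLaw_controlledLaw [StandardBorelSpace S] [Nonempty S]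
    (hM : M.HasJumpKernel g ν G) (hπ : M.IsPolicy π) (γ : Measure S) [IsProbabilityMeasure γ] :
    M.IsControlledLaw γ π (M.controlledLaw γ π) := by
  have h := exists_isControlledLaw (ν := ν) hM hπ γ
  rw [controlledLaw, dif_pos h]
  exact h.choose_spec

end CTMDP

end

section

open ProbabilityTheory

namespace CTMDP

open Trajectory

/-! ### Discounted occupation of the stages -/

/-- The discount factor `exp(-αt)` in `[0, ∞]`. -/
noncomputable def discountAt (α : ℝ) (t : ℝ≥0) : ℝ≥0∞ := ENNReal.ofReal (Real.exp (-(α * t)))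

lemma measurable_discountAt (α : ℝ) : Measurable (discountAt α) := by
  unfold discountAt; fun_prop

lemma discountAt_zero (α : ℝ) : discountAt α 0 = 1 := by simp [discountAt]

lemma discountAt_add (α : ℝ) (s t : ℝ≥0) :
    discountAt α (s + t) = discountAt α s * discountAt α t := by
  rw [discountAt, discountAt, discountAt, ← ENNReal.ofReal_mul (Real.exp_pos _).le,
    ← Real.exp_add]
  congr 2
  push_cast
  ring

variable {S A : Type*} [MeasurableSpace S] [MeasurableSpace A] {M : CTMDP S A}
  {π : Trajectory S → ℝ≥0 → Measure (A ⊕ Unit)} {g : S → A → ℝ≥0∞} {ν : Kernel S S} {G : S → ℝ≥0}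

/-- The time axis is cut into the intervals (T_k, T_{k+1}] and each is shifted by T_k. On such an
interval the policy may be evaluated at the frozen trajectory, so the next pair enters only through
the indicator of u ≤ θ_{k+1}. -/
lemma lintegral_discountAt_mul_actionIntegral (hπ : M.IsPolicy π) (α : ℝ) {f : S → A → ℝ≥0∞}
    (hf : Measurable (Function.uncurry f)) (ω : Trajectory S) :
    ∫⁻ t, discountAt α t * actionIntegral π f ω t ∂timeMeasure =
      ∑' k, discountAt α (ω.jumpTime k).toNNReal * ∫⁻ u, discountAt α u *
        (stageIntegral π f k ω u * {θ | (u : ℝ≥0∞) ≤ θ}.indicator 1 (ω.sojourn k))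
          ∂timeMeasure := by
  have hmeas : ∀ k, MeasurableSet {t : ℝ≥0 | ω.jumpTime k < t ∧ (t : ℝ≥0∞) ≤ ω.jumpTime (k + 1)} :=
    fun k => (measurableSet_lt measurable_const measurable_coe_nnreal_ennreal).inter
      (measurableSet_le measurable_coe_nnreal_ennreal measurable_const)
  have hdisj : Pairwise (Function.onFun Disjoint fun k =>
      {t : ℝ≥0 | ω.jumpTime k < t ∧ (t : ℝ≥0∞) ≤ ω.jumpTime (k + 1)}) := by
    refine (pairwise_disjoint_on _).2 fun i j hij => disjoint_left.2 ?_
    rintro t ⟨_, h1⟩ ⟨h2, _⟩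
    exact absurd (h1.trans (ω.jumpTime_mono hij)) h2.not_ge
  have hU : ∫⁻ t, discountAt α t * actionIntegral π f ω t ∂timeMeasure =
      ∫⁻ t in ⋃ k, {t : ℝ≥0 | ω.jumpTime k < t ∧ (t : ℝ≥0∞) ≤ ω.jumpTime (k + 1)},
        discountAt α t * actionIntegral π f ω t ∂timeMeasure := by
    rw [← lintegral_indicator (MeasurableSet.iUnion hmeas)]
    refine lintegral_congr_ae ?_
    filter_upwards [compl_mem_ae_iff.2 (measure_singleton (0 : ℝ≥0))] with t ht
    rcases ω.exists_jumpTime_lt_le (t := t) ht with h | h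
    · rw [indicator_of_mem (mem_iUnion.2 h)]
    -- From the explosion time on the left limit is x_∞, where nothing is collected.
    · have h0 : discountAt α t * actionIntegral π f ω t = 0 := by
        simp [actionIntegral, leftState_of_forall_lt ω ht h]
      exact h0.trans (indicator_apply_eq_zero
        (f := fun t => discountAt α t * actionIntegral π f ω t).2 fun _ => h0).symm
  rw [hU, lintegral_iUnion hmeas hdisj]
  refine tsum_congr fun k => ?_
  by_cases hk : ω.jumpTime k < ⊤
  · set c := (ω.jumpTime k).toNNReal with hc
    have hcT : (c : ℝ≥0∞) = ω.jumpTime k := ENNReal.coe_toNNReal hk.ne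
    have hstage : Measurable (stageIntegral π f k ω) :=
      (measurable_stageIntegral hπ hf k).comp (measurable_const.prodMk measurable_id)
    have hind : Measurable fun u : ℝ≥0 =>
        {θ : ℝ≥0∞ | (u : ℝ≥0∞) ≤ θ}.indicator (1 : ℝ≥0∞ → ℝ≥0∞) (ω.sojourn k) := by
      have : (fun u : ℝ≥0 =>
          {θ : ℝ≥0∞ | (u : ℝ≥0∞) ≤ θ}.indicator (1 : ℝ≥0∞ → ℝ≥0∞) (ω.sojourn k)) =
          {u : ℝ≥0 | (u : ℝ≥0∞) ≤ ω.sojourn k}.indicator 1 := by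
        ext u; simp only [indicator_apply, mem_ofPred_eq, Pi.one_apply]
      rw [this]
      exact measurable_one.indicator
        (measurableSet_le measurable_coe_nnreal_ennreal measurable_const)
    let h : ℝ≥0 → ℝ≥0∞ := fun t => discountAt α t * (stageIntegral π f k ω (t - c) *
      {θ | ((t - c : ℝ≥0) : ℝ≥0∞) ≤ θ}.indicator 1 (ω.sojourn k))
    have hsub : Measurable fun t : ℝ≥0 => t - c := by fun_prop
    have hh : Measurable h :=
      (measurable_discountAt α).mul ((hstage.comp hsub).mul (hind.comp hsub))
    have h1 : ∫⁻ t in {t : ℝ≥0 | ω.jumpTime k < t ∧ (t : ℝ≥0∞) ≤ ω.jumpTime (k + 1)},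
        discountAt α t * actionIntegral π f ω t ∂timeMeasure = ∫⁻ t in Ioi c, h t ∂timeMeasure := by
      rw [← lintegral_indicator (hmeas k), ← lintegral_indicator measurableSet_Ioi]
      refine lintegral_congr fun t => ?_
      by_cases ht : c < t
      · have ht' : ω.jumpTime k < t := by rw [← hcT]; exact_mod_cast ht
        have hadd : c + (t - c) = t := add_tsub_cancel_of_le ht.le
        have hle : (t : ℝ≥0∞) ≤ ω.jumpTime (k + 1) ↔ ((t - c : ℝ≥0) : ℝ≥0∞) ≤ ω.sojourn k := by
          conv_lhs => rw [jumpTime_succ, ← hcT, ← hadd, ENNReal.coe_add]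
          exact ENNReal.add_le_add_iff_left ENNReal.coe_ne_top
        rw [indicator_of_mem (show t ∈ Ioi c from ht)]
        by_cases hs : ((t - c : ℝ≥0) : ℝ≥0∞) ≤ ω.sojourn k
        · rw [indicator_of_mem (by exact ⟨ht', hle.2 hs⟩), actionIntegral_freeze hπ f ht' (hle.2 hs)]
          have := actionIntegral_eq_stageIntegral (π := π) f hk (u := t - c) (tsub_pos_of_lt ht).ne'
          rw [← hc, hadd] at this
          simp only [h]
          rw [this, indicator_of_mem (by exact hs)]
          simp
        · rw [indicator_of_notMem (fun hm => hs (hle.1 hm.2))]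
          simp only [h]
          rw [indicator_of_notMem (by exact hs)]
          simp
      · have ht' : ¬ ω.jumpTime k < t := by rw [← hcT]; exact_mod_cast ht
        rw [indicator_of_notMem (fun hm => ht' hm.1), indicator_of_notMem (by exact ht)]
    have hm : Measurable fun u : ℝ≥0 => discountAt α u * (stageIntegral π f k ω u *
        {θ : ℝ≥0∞ | (u : ℝ≥0∞) ≤ θ}.indicator 1 (ω.sojourn k)) :=
      (measurable_discountAt α).mul (hstage.mul hind)
    rw [h1, setLIntegral_Ioi_timeMeasure_add c h hh, ← lintegral_const_mul _ hm]
    refine lintegral_congr fun u => ?_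
    simp only [h, discountAt_add, add_tsub_cancel_left, mul_assoc]
  · have hk' : ω.jumpTime k = ⊤ := not_lt_top_iff.1 hk
    have hs : ω.state k = Sum.inr () := by
      cases hx : ω.state k with
      | inl x => exact absurd ((ω.jumpTime_lt_top_iff k).2 ⟨x, hx⟩) hk
      | inr _ => rfl
    have he : {t : ℝ≥0 | ω.jumpTime k < t ∧ (t : ℝ≥0∞) ≤ ω.jumpTime (k + 1)} = ∅ := by
      ext t; simp [hk']
    simp [he, stageIntegral_of_state_inr f hs]

/-- The expected discounted total of `∫ f(x_k, a) π(da)` over the stage `(T_k, T_{k+1}]`, when the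
jump rate is `g` and the law of the process is `P`. -/
noncomputable def stageTotal (α : ℝ) (π : Trajectory S → ℝ≥0 → Measure (A ⊕ Unit))
    (g : S → A → ℝ≥0∞) (P : Measure (Trajectory S)) (k : ℕ) (f : S → A → ℝ≥0∞) : ℝ≥0∞ :=
  ∫⁻ ω, discountAt α (ω.jumpTime k).toNNReal * ∫⁻ u, discountAt α u *
    (stageIntegral π f k ω u * hazardSurvival (stageIntegral π g k ω) (Iic u)) ∂timeMeasure ∂P

/-- The expectation of `exp(-αT_k) v(x_k)` on `T_k < ∞`. -/
noncomputable def jumpTotal (α : ℝ) (P : Measure (Trajectory S)) (k : ℕ) (v : S → ℝ≥0∞) : ℝ≥0∞ :=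
  ∫⁻ ω, discountAt α (ω.jumpTime k).toNNReal * Sum.elim v (fun _ => 0) (ω.state k) ∂P

lemma stageTotal_mono (hπ : M.IsPolicy π) {α : ℝ} {P : Measure (Trajectory S)} {k : ℕ}
    {f f' : S → A → ℝ≥0∞} (h : ∀ x, ∀ a ∈ M.admissible x, f x a ≤ f' x a) :
    stageTotal α π g P k f ≤ stageTotal α π g P k f' := by
  unfold stageTotal
  gcongr with ω u
  exact stageIntegral_mono hπ h k ω u

section

variable (hM : M.HasJumpKernel g ν G) (hπ : M.IsPolicy π)
include hM hπ

lemma measurable_stageTotal_integrand {f : S → A → ℝ≥0∞} (hf : Measurable (Function.uncurry f))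
    (α : ℝ) (k : ℕ) : Measurable fun p : Trajectory S × ℝ≥0 => discountAt α p.2 *
      (stageIntegral π f k p.1 p.2 * hazardSurvival (stageIntegral π g k p.1) (Iic p.2)) :=
  ((measurable_discountAt α).comp measurable_snd).mul ((measurable_stageIntegral hπ hf k).mul
    (measurable_hazardSurvival_Iic (measurable_stageIntegral hπ hM.measurable_rate k)))

lemma stageTotal_add {α : ℝ} {P : Measure (Trajectory S)} {k : ℕ} {f f' : S → A → ℝ≥0∞}
    (hf : Measurable (Function.uncurry f)) :
    stageTotal α π g P k (fun x a => f x a + f' x a) =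
      stageTotal α π g P k f + stageTotal α π g P k f' := by
  have hm := measurable_stageTotal_integrand hM hπ hf α k
  unfold stageTotal
  rw [← lintegral_add_left]
  · refine lintegral_congr fun ω => ?_
    have hmω : Measurable fun u => discountAt α u *
        (stageIntegral π f k ω u * hazardSurvival (stageIntegral π g k ω) (Iic u)) :=
      hm.comp (measurable_const.prodMk measurable_id)
    rw [← mul_add, ← lintegral_add_left hmω]
    simp only [stageIntegral_add hf, mul_add, add_mul]
  · exact ((measurable_discountAt α).comp (measurable_jumpTime k).ennreal_toNNReal).mul
      hm.lintegral_prod_right'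

/-- The state is constant during the stage, so v(x_k) factors out, and the remaining weight
exp(-αu)(α + r(u)) times survival integrates to 1. -/
lemma jumpTotal_eq_stageTotal {α : ℝ≥0} (hα : 0 < α) (P : Measure (Trajectory S)) (k : ℕ) (v : S → ℝ≥0∞) :
    jumpTotal α P k v = stageTotal α π g P k fun x a => (α + g x a) * v x := by
  unfold jumpTotal stageTotal
  refine lintegral_congr fun ω => ?_
  congr 1
  have hg := hM.measurable_rate
  have hg' : Measurable (Function.uncurry fun x a => (α : ℝ≥0∞) + g x a) := measurable_const.add hg
  have hs := (measurable_stageIntegral hπ hM.measurable_rate k).comp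
    (measurable_const (a := ω).prodMk measurable_id)
  cases hx : ω.state k with
  | inr y => simp [stageIntegral_of_state_inr _ hx]
  | inl x =>
    have h1 := lintegral_exp_mul_add_mul_hazardSurvival (r := stageIntegral π g k ω) hs
      (hM.stageIntegral_le hπ k ω) hα
    have hm : Measurable fun u : ℝ≥0 => ENNReal.ofReal (Real.exp (-(α * u))) *
        ((α + stageIntegral π g k ω u) * hazardSurvival (stageIntegral π g k ω) (Iic u)) :=
      (measurable_discountAt α).mul ((measurable_const.add hs).mul
        ((measurable_hazardSurvival_Iic (measurable_stageIntegral hπ hg k)).comp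
          (measurable_const (a := ω).prodMk measurable_id)))
    rw [Sum.elim_inl, ← one_mul (v x), ← h1, ← lintegral_mul_const _ hm]
    refine lintegral_congr_ae ?_
    filter_upwards [compl_mem_ae_iff.2 (measure_singleton (0 : ℝ≥0))] with u hu
    rw [stageIntegral_mul hg', stageIntegral_add (f := fun _ _ => (α : ℝ≥0∞)) measurable_const,
      stageIntegral_const hπ _ hx hu, hx, Sum.elim_inl, discountAt]
    ring

variable [IsMarkovKernel ν]

/-- The complement has the mass of the jump density before u, and this is 1 minus the survival at u;
weak and strict inequalities agree because time has no atoms. -/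
lemma stepKernel_Ici (k : ℕ) (ω : Trajectory S) (u : ℝ≥0) :
    stepKernel π g ν k ω {p | (u : ℝ≥0∞) ≤ p.1} =
      hazardSurvival (stageIntegral π g k ω) (Iic u) := by
  have := isMarkovKernel_stepKernel hM hπ k
  have hs := (measurable_stageIntegral hπ hM.measurable_rate k).comp
    (measurable_const (a := ω).prodMk measurable_id)
  have hc : {p : ℝ≥0∞ × (S ⊕ Unit) | (u : ℝ≥0∞) ≤ p.1} = (Iio (u : ℝ≥0∞) ×ˢ univ)ᶜ := by
    ext p; simp
  have h1 := setLIntegral_Iic_mul_hazardSurvival (r := stageIntegral π g k ω) hs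
    (hM.stageIntegral_le hπ k ω) u
  have hpre : ((↑) : ℝ≥0 → ℝ≥0∞) ⁻¹' Iio (u : ℝ≥0∞) = Iio u := by ext v; simp
  have h2 : stepKernel π g ν k ω (Iio (u : ℝ≥0∞) ×ˢ univ) = ∫⁻ v in Iic u,
      stageIntegral π g k ω v * hazardSurvival (stageIntegral π g k ω) (Iic v) ∂timeMeasure := by
    rw [stepKernel_prod hM hπ k ω measurableSet_Iio MeasurableSet.univ, hpre,
      setLIntegral_congr Iio_ae_eq_Iic]
    cases hx : ω.state k with
    | inl x => simp
    | inr y => simp [funext (stageIntegral_of_state_inr (π := π) g hx)]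
  rw [hc, prob_compl_eq_one_sub (measurableSet_Iio.prod MeasurableSet.univ), h2]
  refine ENNReal.sub_eq_of_eq_add_rev ?_ h1.symm
  exact ne_top_of_le_ne_top ENNReal.one_ne_top (by rw [← h1]; exact le_self_add)

variable {γ : Measure S} [IsProbabilityMeasure γ] {P : Measure (Trajectory S)}
  (hP : M.IsControlledLaw γ π P)
include hP

lemma lintegral_stepJump (k : ℕ) {F : Trajectory S × (ℝ≥0∞ × (S ⊕ Unit)) → ℝ≥0∞}
    (hF : Measurable F) :
    ∫⁻ ω, F (ω.freeze k, (ω.sojourn k, ω.state (k + 1))) ∂P =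
      ∫⁻ ω, ∫⁻ p, F (ω.freeze k, p) ∂(stepKernel π g ν k ω) ∂P := by
  have := hP.isProbability
  have := isMarkovKernel_stepKernel hM hπ k
  have hprob : IsProbabilityMeasure (P.map (freeze · k)) :=
    Measure.isProbabilityMeasure_map (measurable_freeze k).aemeasurable
  have h := ((isControlledLaw_iff hM hπ P).1 hP).2 k
  rw [← lintegral_map hF (measurable_stepJump k), h, Measure.lintegral_compProd hF,
    lintegral_map hF.lintegral_kernel_prod_right' (measurable_freeze k)]
  simp only [stepKernel_freeze hM hπ]

/-- In each stage the next pair is integrated out by Tonelli: the conditional expectation of the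
indicator of u ≤ θ_{k+1} is the survival probability at u. -/
lemma tsum_stageTotal (α : ℝ) {f : S → A → ℝ≥0∞} (hf : Measurable (Function.uncurry f)) :
    ∫⁻ ω, ∫⁻ t, discountAt α t * actionIntegral π f ω t ∂timeMeasure ∂P =
      ∑' k, stageTotal α π g P k f := by
  have hstage := fun k => measurable_stageIntegral hπ hf k
  have hT : ∀ k, Measurable fun ω : Trajectory S => discountAt α (ω.jumpTime k).toNNReal :=
    fun k => (measurable_discountAt α).comp (measurable_jumpTime k).ennreal_toNNReal
  have hind : Measurable fun p : ℝ≥0 × ℝ≥0∞ =>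
      {θ : ℝ≥0∞ | (p.1 : ℝ≥0∞) ≤ θ}.indicator (1 : ℝ≥0∞ → ℝ≥0∞) p.2 := by
    have : (fun p : ℝ≥0 × ℝ≥0∞ =>
        {θ : ℝ≥0∞ | (p.1 : ℝ≥0∞) ≤ θ}.indicator (1 : ℝ≥0∞ → ℝ≥0∞) p.2) =
        {p : ℝ≥0 × ℝ≥0∞ | (p.1 : ℝ≥0∞) ≤ p.2}.indicator 1 := by
      ext u; simp only [indicator_apply, mem_ofPred_eq, Pi.one_apply]
    rw [this]
    exact measurable_one.indicator (measurableSet_le (by fun_prop) measurable_snd)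
  have hI : ∀ k, Measurable fun q : (Trajectory S × (ℝ≥0∞ × (S ⊕ Unit))) × ℝ≥0 =>
      discountAt α q.2 * (stageIntegral π f k q.1.1 q.2 *
        {θ : ℝ≥0∞ | (q.2 : ℝ≥0∞) ≤ θ}.indicator 1 q.1.2.1) := fun k =>
    ((measurable_discountAt α).comp measurable_snd).mul
      (((hstage k).comp (measurable_fst.fst.prodMk measurable_snd)).mul
        (hind.comp (measurable_snd.prodMk measurable_fst.snd.fst)))
  let F : ℕ → Trajectory S × (ℝ≥0∞ × (S ⊕ Unit)) → ℝ≥0∞ := fun k q =>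
    discountAt α (q.1.jumpTime k).toNNReal * ∫⁻ u, discountAt α u *
        (stageIntegral π f k q.1 u * {θ | (u : ℝ≥0∞) ≤ θ}.indicator 1 q.2.1) ∂timeMeasure
  have hF : ∀ k, Measurable (F k) := fun k =>
    ((hT k).comp measurable_fst).mul (hI k).lintegral_prod_right'
  have hterm : ∀ k ω, discountAt α (ω.jumpTime k).toNNReal * ∫⁻ u, discountAt α u *
      (stageIntegral π f k ω u * {θ | (u : ℝ≥0∞) ≤ θ}.indicator 1 (ω.sojourn k)) ∂timeMeasure =
      F k (ω.freeze k, (ω.sojourn k, ω.state (k + 1))) := fun k ω => by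
    simp only [F, stageIntegral_freeze, freeze_jumpTime_of_le ω le_rfl]
  simp only [lintegral_discountAt_mul_actionIntegral hπ α hf, hterm]
  have hFm : ∀ k, Measurable fun ω : Trajectory S =>
      F k (ω.freeze k, (ω.sojourn k, ω.state (k + 1))) := fun k =>
    (hF k).comp (measurable_stepJump k)
  rw [lintegral_tsum fun k => (hFm k).aemeasurable]
  refine tsum_congr fun k => ?_
  rw [lintegral_stepJump hM hπ hP k (hF k), stageTotal]
  refine lintegral_congr fun ω => ?_
  have := isMarkovKernel_stepKernel hM hπ k
  have hIω : Measurable fun q : (ℝ≥0∞ × (S ⊕ Unit)) × ℝ≥0 =>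
      discountAt α q.2 * (stageIntegral π f k ω q.2 *
        {θ : ℝ≥0∞ | (q.2 : ℝ≥0∞) ≤ θ}.indicator 1 q.1.1) :=
    (hI k).comp ((measurable_const (a := ω).prodMk measurable_fst).prodMk measurable_snd)
  simp only [F, stageIntegral_freeze, freeze_jumpTime_of_le ω le_rfl]
  rw [lintegral_const_mul _ hIω.lintegral_prod_right', lintegral_lintegral_swap hIω.aemeasurable]
  congr 1
  refine lintegral_congr fun u => ?_
  have hset : MeasurableSet {p : ℝ≥0∞ × (S ⊕ Unit) | (u : ℝ≥0∞) ≤ p.1} :=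
    measurableSet_le measurable_const measurable_fst
  rw [← stepKernel_Ici hM hπ k ω u, ← lintegral_indicator_one hset,
    ← lintegral_const_mul _ (measurable_one.indicator hset),
    ← lintegral_const_mul _ (by exact measurable_const.mul (measurable_one.indicator hset))]
  refine lintegral_congr fun p => ?_
  simp only [indicator_apply, mem_ofPred_eq, Pi.one_apply]

lemma jumpTotal_zero (α : ℝ) {v : S → ℝ≥0∞} (hv : Measurable v) :
    jumpTotal α P 0 v = ∫⁻ x, v x ∂γ := by
  have := hP.isProbability
  have h := ((isControlledLaw_iff hM hπ P).1 hP).1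
  have hv' : Measurable (Sum.elim v (fun _ => 0) : S ⊕ Unit → ℝ≥0∞) :=
    hv.sumElim measurable_const
  simp only [jumpTotal, jumpTime_zero, ENNReal.toNNReal_zero, discountAt_zero, one_mul]
  rw [← lintegral_map hv' (measurable_state 0), h, lintegral_map hv' measurable_inl]
  simp

/-- Condition on the k-th history: the next jump has density g times survival and its target has law
ν(x_k). The atom at infinity contributes nothing, as v is extended by 0. -/
lemma jumpTotal_succ (α : ℝ) (k : ℕ) {v : S → ℝ≥0∞} (hv : Measurable v) :
    jumpTotal α P (k + 1) v = stageTotal α π g P k fun x a => g x a * ∫⁻ y, v y ∂(ν x) := by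
  have hv' : Measurable (Sum.elim v (fun _ => 0) : S ⊕ Unit → ℝ≥0∞) :=
    hv.sumElim measurable_const
  let F : Trajectory S × (ℝ≥0∞ × (S ⊕ Unit)) → ℝ≥0∞ := fun q =>
    discountAt α (q.1.jumpTime k).toNNReal *
      (discountAt α q.2.1.toNNReal * Sum.elim v (fun _ => 0) q.2.2)
  have hF : Measurable F :=
    ((measurable_discountAt α).comp ((measurable_jumpTime k).comp
      measurable_fst).ennreal_toNNReal).mul (((measurable_discountAt α).comp
      measurable_snd.fst.ennreal_toNNReal).mul (hv'.comp measurable_snd.snd))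
  have hterm : ∀ ω : Trajectory S, discountAt α (ω.jumpTime (k + 1)).toNNReal *
      Sum.elim v (fun _ => 0) (ω.state (k + 1)) =
      F (ω.freeze k, (ω.sojourn k, ω.state (k + 1))) := fun ω => by
    simp only [F, freeze_jumpTime_of_le ω le_rfl]
    cases hs : ω.state (k + 1) with
    | inr y => simp
    | inl y =>
      have h := (ω.jumpTime_lt_top_iff (k + 1)).2 ⟨y, hs⟩
      rw [jumpTime_succ, ENNReal.add_lt_top] at h
      rw [jumpTime_succ, ENNReal.toNNReal_add h.1.ne h.2.ne, discountAt_add, mul_assoc]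
  simp only [jumpTotal, hterm]
  rw [lintegral_stepJump hM hπ hP k hF, stageTotal]
  refine lintegral_congr fun ω => ?_
  have hFω : Measurable fun p => F (ω.freeze k, p) := hF.comp (measurable_const.prodMk measurable_id)
  have hstep : Measurable fun p : ℝ≥0∞ × (S ⊕ Unit) =>
      discountAt α p.1.toNNReal * Sum.elim v (fun _ => 0) p.2 :=
    ((measurable_discountAt α).comp measurable_fst.ennreal_toNNReal).mul (hv'.comp measurable_snd)
  simp only [F, freeze_jumpTime_of_le ω le_rfl]
  rw [lintegral_const_mul _ hstep, lintegral_stepKernel hM hπ k ω hstep]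
  simp only [Sum.elim_inr, mul_zero, add_zero, Sum.elim_inl, ENNReal.toNNReal_coe]
  congr 1
  refine lintegral_congr fun u => ?_
  rw [stageIntegral_mul hM.measurable_rate, lintegral_const_mul _ hv]
  cases ω.state k with
  | inr y => simp
  | inl x => simp only [nextLaw_inl, Sum.elim_inl]; ring

end

end CTMDP

end

section

open ProbabilityTheory

/-! ### Verification of optimality -/

/-- Telescoping without subtraction; the remainder h n is nonnegative and can be dropped. -/
lemma ENNReal.tsum_le_tsum_add_of_step {a b h : ℕ → ℝ≥0∞}
    (hstep : ∀ k, b k + h (k + 1) ≤ a k + h k) : ∑' k, b k ≤ ∑' k, a k + h 0 := by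
  have hsum : ∀ n, ∑ k ∈ Finset.range n, b k + h n ≤ ∑ k ∈ Finset.range n, a k + h 0 := by
    intro n
    induction n with
    | zero => simp
    | succ n ih =>
      rw [Finset.sum_range_succ, Finset.sum_range_succ]
      calc _ = ∑ k ∈ Finset.range n, b k + (b n + h (n + 1)) := add_assoc _ _ _
        _ ≤ ∑ k ∈ Finset.range n, b k + (a n + h n) := add_le_add le_rfl (hstep n)
        _ = (∑ k ∈ Finset.range n, b k + h n) + a n := by ring
        _ ≤ (∑ k ∈ Finset.range n, a k + h 0) + a n := by gcongr
        _ = _ := by ring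
  refine ENNReal.tsum_le_of_sum_range_le fun n => (le_self_add.trans (hsum n)).trans ?_
  gcongr
  exact ENNReal.sum_le_tsum _

/-- In this direction the remainder is on the larger side, so it has to tend to 0. -/
lemma ENNReal.tsum_add_le_tsum_of_step {a b h : ℕ → ℝ≥0∞}
    (hstep : ∀ k, a k + h k ≤ b k + h (k + 1)) (hlim : Tendsto h atTop (𝓝 0)) :
    ∑' k, a k + h 0 ≤ ∑' k, b k := by
  have hsum : ∀ n, ∑ k ∈ Finset.range n, a k + h 0 ≤ ∑ k ∈ Finset.range n, b k + h n := by
    intro n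
    induction n with
    | zero => simp
    | succ n ih =>
      rw [Finset.sum_range_succ, Finset.sum_range_succ]
      calc _ = (∑ k ∈ Finset.range n, a k + h 0) + a n := by ring
        _ ≤ (∑ k ∈ Finset.range n, b k + h n) + a n := by gcongr
        _ = ∑ k ∈ Finset.range n, b k + (a n + h n) := by ring
        _ ≤ ∑ k ∈ Finset.range n, b k + (b n + h (n + 1)) := add_le_add le_rfl (hstep n)
        _ = _ := (add_assoc _ _ _).symm
  have h1 := (ENNReal.tendsto_nat_tsum a).add (tendsto_const_nhds (x := h 0))
  have h2 := (ENNReal.tendsto_nat_tsum b).add hlim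
  rw [add_zero] at h2
  exact le_of_tendsto_of_tendsto' h1 h2 hsum

lemma EReal.sub_le_sub_of_ennreal_add_le {p n i b : ℝ≥0∞} (hn : n ≠ ⊤) (hi : i ≠ ⊤) (hb : b ≠ ⊤)
    (h : n + i ≤ p + b) : (i : EReal) - b ≤ (p : EReal) - n := by
  lift n to ℝ≥0 using hn
  lift i to ℝ≥0 using hi
  lift b to ℝ≥0 using hb
  induction p with
  | top =>
    have : ((⊤ : ℝ≥0∞) : EReal) - ((n : ℝ≥0∞) : EReal) = ⊤ := EReal.top_sub_coe (n : ℝ)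
    rw [this]
    exact le_top
  | coe p =>
    have h' : (n : ℝ) + i ≤ p + b := by exact_mod_cast h
    have : (((i : ℝ) - b : ℝ) : EReal) ≤ (((p : ℝ) - n : ℝ) : EReal) :=
      EReal.coe_le_coe_iff.2 (by linarith)
    rw [EReal.coe_sub, EReal.coe_sub] at this
    exact this

lemma EReal.sub_le_sub_of_ennreal_le_add {p n i b : ℝ≥0∞} (hn : n ≠ ⊤) (hi : i ≠ ⊤) (hb : b ≠ ⊤)
    (h : p + b ≤ n + i) : (p : EReal) - n ≤ (i : EReal) - b := by
  have hp : p ≠ ⊤ := ne_top_of_le_ne_top (ENNReal.add_ne_top.2 ⟨hn, hi⟩) (le_self_add.trans h)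
  exact EReal.sub_le_sub_of_ennreal_add_le hb hp hn (by rwa [add_comm b, add_comm i])

namespace CTMDP

lemma tendsto_jumpTotal_of_le {S : Type*} [MeasurableSpace S] {P : Measure (Trajectory S)}
    {α : ℝ} (hlim : Tendsto (fun k => jumpTotal α P k (fun _ => 1)) atTop (𝓝 0))
   
    {v : S → ℝ≥0∞} {C : ℝ≥0} (hvC : ∀ x, v x ≤ C) :
    Tendsto (fun k => jumpTotal α P k v) atTop (𝓝 0) := by
  have hle : ∀ k, jumpTotal α P k v ≤ C * jumpTotal α P k (fun _ => 1) := fun k => by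
    unfold jumpTotal
    rw [← lintegral_const_mul' _ _ ENNReal.coe_ne_top]
    refine lintegral_mono fun ω => ?_
    cases ω.state k with
    | inr y => simp
    | inl x =>
      simp only [Sum.elim_inl, mul_one]
      rw [mul_comm]
      gcongr
      exact hvC x
  have h0 : Tendsto (fun k => C * jumpTotal α P k (fun _ => 1)) atTop (𝓝 0) := by
    have := ENNReal.Tendsto.const_mul hlim (a := C) (Or.inr ENNReal.coe_ne_top)
    rwa [mul_zero] at this
  exact tendsto_of_tendsto_of_tendsto_of_le_of_le tendsto_const_nhds h0 (fun _ => zero_le) hle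

variable {S A : Type*} [MeasurableSpace S] [MeasurableSpace A] {M : CTMDP S A}
  {π : Trajectory S → ℝ≥0 → Measure (A ⊕ Unit)} {g : S → A → ℝ≥0∞} {ν : Kernel S S} {G : S → ℝ≥0}
  [IsMarkovKernel ν] {γ : Measure S} [IsProbabilityMeasure γ] {P : Measure (Trajectory S)}
  {α : ℝ≥0}

lemma discountedTotal_eq_tsum [StandardBorelSpace S] [Nonempty S] (hM : M.HasJumpKernel g ν G)
    (hπ : M.IsPolicy π) (hα : M.discount = α) {f : S → A → ℝ≥0∞}
    (hf : Measurable (Function.uncurry f)) :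
    M.discountedTotal γ π f = ∑' k, stageTotal α π g (M.controlledLaw γ π) k f := by
  rw [discountedTotal, hα]
  exact tsum_stageTotal hM hπ (isControlledLaw_controlledLaw hM hπ γ) α hf

section

variable (hM : M.HasJumpKernel g ν G) (hπ : M.IsPolicy π) (hP : M.IsControlledLaw γ π P)
  (hα : 0 < α) {M' : CTMDP S A} (hπ' : M'.IsPolicy π) {f f' : S → A → ℝ≥0∞}
  (hf : Measurable (Function.uncurry f)) (hf' : Measurable (Function.uncurry f'))
  {v : S → ℝ≥0∞} (hv : Measurable v)
include hM hπ hP hα hπ' hf hf' hv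

/-- `f' ≥ f + (generator - α) v` controls the totals of `f` by those of `f'`. -/
lemma tsum_stageTotal_le
    (h : ∀ x, ∀ a ∈ M'.admissible x,
      f x a + g x a * ∫⁻ y, v y ∂(ν x) ≤ f' x a + (α + g x a) * v x) :
    ∑' k, stageTotal α π g P k f ≤ ∑' k, stageTotal α π g P k f' + ∫⁻ x, v x ∂γ := by
  rw [← jumpTotal_zero hM hπ hP α hv]
  refine ENNReal.tsum_le_tsum_add_of_step (h := fun k => jumpTotal α P k v) fun k => ?_
  rw [jumpTotal_succ hM hπ hP α k hv, jumpTotal_eq_stageTotal hM hπ hα P k v,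
    ← stageTotal_add hM hπ hf, ← stageTotal_add hM hπ hf']
  exact stageTotal_mono hπ' h

lemma tsum_stageTotal_add_le
    (h : ∀ x, ∀ a ∈ M'.admissible x,
      f x a + (α + g x a) * v x ≤ f' x a + g x a * ∫⁻ y, v y ∂(ν x))
    (hlim : Tendsto (fun k => jumpTotal α P k v) atTop (𝓝 0)) :
    ∑' k, stageTotal α π g P k f + ∫⁻ x, v x ∂γ ≤ ∑' k, stageTotal α π g P k f' := by
  rw [← jumpTotal_zero hM hπ hP α hv]
  refine ENNReal.tsum_add_le_tsum_of_step (h := fun k => jumpTotal α P k v) (fun k => ?_) hlim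
  rw [jumpTotal_succ hM hπ hP α k hv, jumpTotal_eq_stageTotal hM hπ hα P k v,
    ← stageTotal_add hM hπ hf, ← stageTotal_add hM hπ hf']
  exact stageTotal_mono hπ' h

end

section

variable (hM : M.HasJumpKernel g ν G) (hπ : M.IsPolicy π) (hP : M.IsControlledLaw γ π P)
  (hα : 0 < α)
include hM hπ hP hα

/-- A supersolution v bounds the discounted total of f by its initial mean, with no condition at
infinity. -/
lemma tsum_stageTotal_le_lintegral {f : S → A → ℝ≥0∞} (hf : Measurable (Function.uncurry f))
    {v : S → ℝ≥0∞} (hv : Measurable v) (h : ∀ x, ∀ a ∈ M.admissible x,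
      f x a + g x a * ∫⁻ y, v y ∂(ν x) ≤ (α + g x a) * v x) :
    ∑' k, stageTotal α π g P k f ≤ ∫⁻ x, v x ∂γ := by
  have h0 : ∀ k, stageTotal α π g P k (fun _ _ => 0) = 0 := fun k => by
    have : ∀ ω u, stageIntegral π (fun _ _ => 0) k ω u = 0 := fun ω u => by
      have h1 : ∀ s, extendZero (fun (_ : S) (_ : A) => (0 : ℝ≥0∞)) s = fun _ => 0 := fun s => by
        ext a; cases s <;> cases a <;> rfl
      simp [stageIntegral, h1]
    simp [stageTotal, this]
  have := tsum_stageTotal_le hM hπ hP hα hπ hf (f' := fun _ _ => 0) measurable_const hv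
    (by simpa using h)
  simpa [h0] using this

/-- A Lyapunov function for the jump rate rules out explosion in the discounted sense. -/
lemma tendsto_jumpTotal_one {v : S → ℝ≥0∞} (hv : Measurable v) (hvγ : ∫⁻ x, v x ∂γ ≠ ⊤)
    (h : ∀ x, ∀ a ∈ M.admissible x, g x a + g x a * ∫⁻ y, v y ∂(ν x) ≤ (α + g x a) * v x) :
    Tendsto (fun k => jumpTotal α P k (fun _ => 1)) atTop (𝓝 0) := by
  have h1 : ∀ k, jumpTotal α P (k + 1) (fun _ => 1) = stageTotal α π g P k g := fun k => by
    rw [jumpTotal_succ hM hπ hP α k measurable_const]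
    simp
  refine (tendsto_add_atTop_iff_nat 1).1 ?_
  simp only [h1]
  refine ENNReal.tendsto_atTop_zero_of_tsum_ne_top (ne_top_of_le_ne_top hvγ ?_)
  exact tsum_stageTotal_le_lintegral hM hπ hP hα hM.measurable_rate hv h

/-- The constant B solves αB + gB = (α + g)B, so both comparisons apply. The lower one uses `hlim`:
explosion would cut off part of the total. -/
lemma tsum_stageTotal_const (hlim : Tendsto (fun k => jumpTotal α P k (fun _ => 1)) atTop (𝓝 0))
    (B : ℝ≥0) : ∑' k, stageTotal α π g P k (fun _ _ => (α : ℝ≥0∞) * B) = B := by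
  have hB : Measurable (Function.uncurry fun (_ : S) (_ : A) => (α : ℝ≥0∞) * B) := measurable_const
  have hz : Measurable (Function.uncurry fun (_ : S) (_ : A) => (0 : ℝ≥0∞)) := measurable_const
  have hBv : Measurable fun _ : S => (B : ℝ≥0∞) := measurable_const
  refine le_antisymm ?_ ?_
  · have := tsum_stageTotal_le_lintegral hM hπ hP hα hB hBv (fun x a _ => by simp [add_mul])
    simpa using this
  · have := tsum_stageTotal_add_le hM hπ hP hα hπ hz hB hBv (fun x a _ => by simp [add_mul])
      (tendsto_jumpTotal_of_le hlim fun _ => le_rfl)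
    simpa using le_add_self.trans this

end

/-- Verification theorem: `v - B` is the value function and `φ` is optimal if `v ≥ 0` is bounded
and satisfies the optimality inequality, with equality at the actions `φ(x)`. -/
theorem isOptimalPolicy_stationaryPolicy [StandardBorelSpace S] [Nonempty S]
    (hM : M.HasJumpKernel g ν G) (hα : 0 < α) (hdisc : M.discount = α)
    (hset : ∀ x, MeasurableSet (M.admissible x))
    (hcost : Measurable (Function.uncurry M.cost))
    {φ : S → A} (hφ : Measurable φ) (hadm : ∀ x, φ x ∈ M.admissible x)
    (hφset : ∀ x, MeasurableSet {φ x})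
    (hneg : ∀ π, M.IsPolicy π → M.negativeCost γ π < ⊤)
    {v₁ : S → ℝ≥0∞} (hv₁ : Measurable v₁) (hv₁γ : ∫⁻ x, v₁ x ∂γ ≠ ⊤)
    (hdrift : ∀ x, ∀ a ∈ M.admissible x,
      g x a + g x a * ∫⁻ y, v₁ y ∂(ν x) ≤ (α + g x a) * v₁ x)
    {v : S → ℝ≥0∞} (hv : Measurable v) {C : ℝ≥0} (hvC : ∀ x, v x ≤ C) (B : ℝ≥0)
    (hopt : ∀ x, ∀ a ∈ M.admissible x, ENNReal.ofReal (-(M.cost x a)) + (α + g x a) * v x ≤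
      (ENNReal.ofReal (M.cost x a) + α * B) + g x a * ∫⁻ y, v y ∂(ν x))
    (heq : ∀ x, (ENNReal.ofReal (M.cost x (φ x)) + α * B) + g x (φ x) * ∫⁻ y, v y ∂(ν x) ≤
      ENNReal.ofReal (-(M.cost x (φ x))) + (α + g x (φ x)) * v x) :
    M.IsOptimalPolicy γ (stationaryPolicy φ) := by
  have hpol : M.IsPolicy (stationaryPolicy φ) := isPolicy_stationaryPolicy M hφ hadm hset
  have hcp : Measurable (Function.uncurry fun x a => ENNReal.ofReal (M.cost x a)) :=
    hcost.ennreal_ofReal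
  have hcn : Measurable (Function.uncurry fun x a => ENNReal.ofReal (-(M.cost x a))) :=
    hcost.neg.ennreal_ofReal
  have hB : Measurable (Function.uncurry fun (_ : S) (_ : A) => (α : ℝ≥0∞) * B) := measurable_const
  have hcpB : Measurable (Function.uncurry fun x a => ENNReal.ofReal (M.cost x a) + α * B) :=
    hcp.add hB
  have hI : ∫⁻ x, v x ∂γ ≠ ⊤ := by
    refine ne_top_of_le_ne_top (b := (C : ℝ≥0∞)) ENNReal.coe_ne_top ?_
    calc _ ≤ ∫⁻ _, (C : ℝ≥0∞) ∂γ := lintegral_mono hvC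
      _ = C := by simp
  have hlim : ∀ π, M.IsPolicy π → Tendsto
      (fun k => jumpTotal α (M.controlledLaw γ π) k (fun _ => 1)) atTop (𝓝 0) := fun π hπ =>
    tendsto_jumpTotal_one hM hπ (isControlledLaw_controlledLaw hM hπ γ) hα hv₁ hv₁γ hdrift
  have hsplit : ∀ π, M.IsPolicy π →
      ∑' k, stageTotal α π g (M.controlledLaw γ π) k (fun x a => ENNReal.ofReal (M.cost x a) + α * B)
        = M.discountedTotal γ π (fun x a => ENNReal.ofReal (M.cost x a)) + B := fun π hπ => by
    have hP := isControlledLaw_controlledLaw (ν := ν) hM hπ γ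
    conv_rhs => rw [discountedTotal_eq_tsum hM hπ hdisc hcp,
      ← tsum_stageTotal_const hM hπ hP hα (hlim π hπ) B, ← ENNReal.tsum_add]
    exact tsum_congr fun k => stageTotal_add hM hπ hcp
  -- Summing the optimality inequality over the stages bounds every policy from below; the boundary
  -- terms vanish because v is bounded.
  have hlow : ∀ π, M.IsPolicy π →
      ((∫⁻ x, v x ∂γ : ℝ≥0∞) : EReal) - ((B : ℝ≥0∞) : EReal) ≤ M.value γ π := fun π hπ => by
    have hP := isControlledLaw_controlledLaw (ν := ν) hM hπ γ
    refine EReal.sub_le_sub_of_ennreal_add_le (hneg π hπ).ne hI ENNReal.coe_ne_top ?_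
    rw [← hsplit π hπ, negativeCost, discountedTotal_eq_tsum hM hπ hdisc hcn]
    exact tsum_stageTotal_add_le hM hπ hP hα hπ hcn hcpB hv hopt
      (tendsto_jumpTotal_of_le (hlim π hπ) hvC)
  have hup : M.value γ (stationaryPolicy φ) ≤
      ((∫⁻ x, v x ∂γ : ℝ≥0∞) : EReal) - ((B : ℝ≥0∞) : EReal) := by
    have hP := isControlledLaw_controlledLaw (ν := ν) hM hpol γ
    -- The stationary policy is also a policy of the model in which φ(x) is the only action at x, so
    -- the reverse inequality is needed at φ(x) alone.
    let M' : CTMDP S A := { M with admissible := fun x => {φ x} }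
    have hpol' : M'.IsPolicy (stationaryPolicy φ) :=
      isPolicy_stationaryPolicy M' hφ (fun x => rfl) hφset
    refine EReal.sub_le_sub_of_ennreal_le_add (hneg _ hpol).ne hI ENNReal.coe_ne_top ?_
    rw [← hsplit _ hpol, negativeCost, discountedTotal_eq_tsum hM hpol hdisc hcn]
    refine tsum_stageTotal_le hM hpol hP hα hpol' hcpB hcn hv fun x a ha => ?_
    obtain rfl : a = φ x := ha
    exact heq x
  refine ⟨hpol, le_antisymm (le_sInf ?_) (sInf_le ⟨_, hpol, rfl⟩)⟩
  rintro _ ⟨π, hπ, rfl⟩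
  exact hup.trans (hlow π hπ)

end CTMDP

end

section

open ProbabilityTheory

namespace LossQueue

/-! ### The recursion for the value of the idle state -/

section

variable {α C₁ C₂ : ℝ}

lemma continuous_u : Continuous fun p : ℝ × ℝ => u α C₁ C₂ p.1 p.2 := by
  unfold u
  fun_prop

/-- With p = αC₂x² the square root is at least p, so by concavity twice the root grows more slowly
than z, and the term -z wins. If p = 0 the root does not depend on z. -/
lemma u_lt_of_lt (hα : 0 ≤ α) (hC₁ : 0 ≤ C₁) (hC₂ : 0 ≤ C₂) {x z z' : ℝ} (hx : 0 ≤ x)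
    (hz : 0 ≤ z) (h : z < z') : u α C₁ C₂ x z' < u α C₁ C₂ x z := by
  have hp : 0 ≤ α * C₂ * x ^ 2 := by positivity
  have hq : 0 ≤ C₁ * C₂ * x ^ 3 := by positivity
  have e : ∀ t, α ^ 2 * C₂ ^ 2 * x ^ 4 + C₁ * C₂ * x ^ 3 + α * C₂ * x ^ 2 * t =
      (α * C₂ * x ^ 2) ^ 2 + C₁ * C₂ * x ^ 3 + α * C₂ * x ^ 2 * t := fun t => by ring
  unfold u
  rw [e, e]
  set p := α * C₂ * x ^ 2
  set q := C₁ * C₂ * x ^ 3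
  have hz' : 0 < z' := hz.trans_lt h
  suffices Real.sqrt (p ^ 2 + q + p * z') < Real.sqrt (p ^ 2 + q + p * z) + (z' - z) / 2 by
    linarith
  rcases hp.eq_or_lt with h0 | h0
  · rw [← h0]; simp [h]
  · have hs : p ≤ Real.sqrt (p ^ 2 + q + p * z) := Real.le_sqrt_of_sq_le (by nlinarith)
    have hsq := Real.sq_sqrt (show 0 ≤ p ^ 2 + q + p * z by positivity)
    have h1 : 0 < z' - z := by linarith
    rw [Real.sqrt_lt' (by positivity)]
    nlinarith [mul_le_mul_of_nonneg_right hs h1.le, sq_pos_of_pos h1]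

lemma neg_le_u (hα : 0 ≤ α) (hC₁ : 0 ≤ C₁) (hC₂ : 0 ≤ C₂) {x z : ℝ} (hx : 0 ≤ x)
    (hz : 0 ≤ z) : -z ≤ u α C₁ C₂ x z := by
  have h : α * C₂ * x ^ 2 ≤ Real.sqrt
      (α ^ 2 * C₂ ^ 2 * x ^ 4 + C₁ * C₂ * x ^ 3 + α * C₂ * x ^ 2 * z) := by
    refine Real.le_sqrt_of_sq_le ?_
    have : 0 ≤ C₁ * C₂ * x ^ 3 + α * C₂ * x ^ 2 * z := by positivity
    nlinarith
  unfold u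
  linarith

/-- The tangent bound √(p² + q) ≤ p + q/(2p) with p = αC₂x² and q = C₁C₂x³, written so that it also
covers p = 0. -/
lemma u_zero_right_le (hα : 0 < α) (hC₁ : 0 ≤ C₁) (hC₂ : 0 ≤ C₂) {x : ℝ} (hx : 0 ≤ x) :
    u α C₁ C₂ x 0 ≤ C₁ / α * x := by
  have h : Real.sqrt (α ^ 2 * C₂ ^ 2 * x ^ 4 + C₁ * C₂ * x ^ 3 + α * C₂ * x ^ 2 * 0) ≤
      α * C₂ * x ^ 2 + C₁ / α * x / 2 := by
    rw [Real.sqrt_le_left (by positivity)]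
    have : (α * C₂ * x ^ 2 + C₁ / α * x / 2) ^ 2 =
        α ^ 2 * C₂ ^ 2 * x ^ 4 + C₁ * C₂ * x ^ 3 + α * C₂ * x ^ 2 * 0 + (C₁ / α * x / 2) ^ 2 := by
      field_simp
      ring
    rw [this]
    linarith [sq_nonneg (C₁ / α * x / 2)]
  unfold u
  linarith

end

/-- The right-hand side of the recursion for `z⁽ⁿ⁾`. -/
noncomputable def zStep (lam α C₁ C₂ z : ℝ) : ℝ :=
  1 - 5 * lam / (α + lam) * ∫ y in (0 : ℝ)..1, u α C₁ C₂ y z * y ^ 4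

section

variable {lam α C₁ C₂ : ℝ}

lemma zSeq_succ (n : ℕ) : zSeq lam α C₁ C₂ (n + 1) = zStep lam α C₁ C₂ (zSeq lam α C₁ C₂ n) := rfl

lemma continuous_u_mul_pow (z : ℝ) : Continuous fun y => u α C₁ C₂ y z * y ^ 4 :=
  (continuous_u.comp (by fun_prop : Continuous fun y : ℝ => (y, z))).mul (by fun_prop)

lemma continuous_zStep : Continuous (zStep lam α C₁ C₂) := by
  have h : Continuous (Function.uncurry fun z y => u α C₁ C₂ y z * y ^ 4) :=
    (continuous_u.comp (by fun_prop : Continuous fun p : ℝ × ℝ => (p.2, p.1))).mul (by fun_prop)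
  have := intervalIntegral.continuous_parametric_intervalIntegral_of_continuous'
    (μ := volume) h 0 1
  unfold zStep
  fun_prop

variable (hlam : 0 < lam) (hα : 4 * lam < α) (hC₁ : 0 ≤ C₁) (hC₂ : 0 ≤ C₂)
include hlam hα hC₁ hC₂

lemma zStep_lt_zStep {z z' : ℝ} (hz : 0 ≤ z) (h : z < z') :
    zStep lam α C₁ C₂ z < zStep lam α C₁ C₂ z' := by
  have hα0 : 0 < α := by linarith
  have hk : 0 < 5 * lam / (α + lam) := by positivity
  unfold zStep
  have := intervalIntegral.integral_lt_integral_of_continuousOn_of_le_of_exists_lt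
    (zero_lt_one (α := ℝ)) (continuous_u_mul_pow (α := α) (C₁ := C₁) (C₂ := C₂) z').continuousOn
    (continuous_u_mul_pow z).continuousOn
    (fun y hy => mul_le_mul_of_nonneg_right (u_lt_of_lt hα0.le hC₁ hC₂ hy.1.le hz h).le
      (by positivity))
    ⟨1, by simp, by simpa using u_lt_of_lt hα0.le hC₁ hC₂ zero_le_one hz h⟩
  nlinarith

/-- From u ≥ -z the integral is at least -z/5, and the factor 5·lam/(α + lam) is at most 1; this is
where α > 4·lam enters. -/
lemma zStep_le {z : ℝ} (hz : 0 ≤ z) : zStep lam α C₁ C₂ z ≤ 1 + z / 5 := by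
  have hα0 : 0 < α := by linarith
  have hk : 5 * lam / (α + lam) ≤ 1 := (div_le_one (by linarith)).2 (by linarith)
  have hk0 : 0 < 5 * lam / (α + lam) := by positivity
  have h : -z / 5 ≤ ∫ y in (0 : ℝ)..1, u α C₁ C₂ y z * y ^ 4 := by
    calc -z / 5 = ∫ y in (0 : ℝ)..1, -z * y ^ 4 := by
          rw [intervalIntegral.integral_const_mul, integral_pow]; norm_num; ring
      _ ≤ _ := intervalIntegral.integral_mono_on zero_le_one
          (Continuous.intervalIntegrable (by fun_prop) _ _)
          ((continuous_u_mul_pow z).intervalIntegrable _ _) fun y hy =>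
            mul_le_mul_of_nonneg_right (neg_le_u hα0.le hC₁ hC₂ hy.1 hz) (by positivity)
  unfold zStep
  have h1 : 5 * lam / (α + lam) * (-z / 5) ≤
      5 * lam / (α + lam) * ∫ y in (0 : ℝ)..1, u α C₁ C₂ y z * y ^ 4 :=
    mul_le_mul_of_nonneg_left h hk0.le
  nlinarith

/-- The hypothesis gives u(y, 0) ≤ 2y, so the integral is at most ∫ 2y⁵ = 1/3 and the step is at
least 2/3. -/
lemma zStep_zero_pos (h : C₁ / (2 * α) ≤ 1) : 0 < zStep lam α C₁ C₂ 0 := by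
  have hα0 : 0 < α := by linarith
  have hk : 5 * lam / (α + lam) ≤ 1 := (div_le_one (by linarith)).2 (by linarith)
  have hk0 : 0 < 5 * lam / (α + lam) := by positivity
  have hC : C₁ / α ≤ 2 := by
    rw [div_le_iff₀ (by positivity)] at h ⊢
    linarith
  have h1 : ∫ y in (0 : ℝ)..1, u α C₁ C₂ y 0 * y ^ 4 ≤ 1 / 3 := by
    calc _ ≤ ∫ y in (0 : ℝ)..1, 2 * y ^ 5 :=
          intervalIntegral.integral_mono_on zero_le_one
            ((continuous_u_mul_pow 0).intervalIntegrable _ _)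
            (Continuous.intervalIntegrable (by fun_prop) _ _) fun y hy => by
              have h2 := (u_zero_right_le hα0 hC₁ hC₂ hy.1).trans
                (mul_le_mul_of_nonneg_right hC hy.1)
              calc _ ≤ 2 * y * y ^ 4 := mul_le_mul_of_nonneg_right h2 (by positivity)
                _ = _ := by ring
      _ = _ := by rw [intervalIntegral.integral_const_mul, integral_pow]; norm_num
  unfold zStep
  nlinarith [mul_le_mul_of_nonneg_left h1 hk0.le]

lemma zSeq_nonneg_and_lt_succ (h : C₁ / (2 * α) ≤ 1) (n : ℕ) :
    0 ≤ zSeq lam α C₁ C₂ n ∧ zSeq lam α C₁ C₂ n < zSeq lam α C₁ C₂ (n + 1) := by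
  induction n with
  | zero => exact ⟨le_rfl, zStep_zero_pos hlam hα hC₁ hC₂ h⟩
  | succ n ih => exact ⟨ih.1.trans ih.2.le, zStep_lt_zStep hlam hα hC₁ hC₂ ih.1 ih.2⟩

lemma strictMono_zSeq (h : C₁ / (2 * α) ≤ 1) : StrictMono (zSeq lam α C₁ C₂) :=
  strictMono_nat_of_lt_succ fun n => (zSeq_nonneg_and_lt_succ hlam hα hC₁ hC₂ h n).2

lemma zSeq_le_two (h : C₁ / (2 * α) ≤ 1) (n : ℕ) : zSeq lam α C₁ C₂ n ≤ 2 := by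
  induction n with
  | zero => simp [zSeq]
  | succ n ih =>
    have := zStep_le hlam hα hC₁ hC₂ (zSeq_nonneg_and_lt_succ hlam hα hC₁ hC₂ h n).1
    rw [zSeq_succ]
    linarith

/-- The recursion converges to a nonnegative fixed point. -/
lemma exists_tendsto_zSeq (h : C₁ / (2 * α) ≤ 1) :
    ∃ z, Tendsto (zSeq lam α C₁ C₂) atTop (𝓝 z) ∧ 0 ≤ z ∧ zStep lam α C₁ C₂ z = z := by
  have hlim := tendsto_atTop_ciSup (strictMono_zSeq hlam hα hC₁ hC₂ h).monotone
    ⟨2, forall_mem_range.2 (zSeq_le_two hlam hα hC₁ hC₂ h)⟩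
  refine ⟨_, hlim, ge_of_tendsto' hlim
    fun n => (zSeq_nonneg_and_lt_succ hlam hα hC₁ hC₂ h n).1, ?_⟩
  exact tendsto_nhds_unique ((continuous_zStep.tendsto _).comp hlim)
    ((tendsto_add_atTop_iff_nat 1).2 hlim)

end

end LossQueue

end

/-! ### Integrals against signed measures `c • (μ - ν)` -/

section

open ProbabilityTheory

lemma MeasureTheory.integrable_smul_toSignedMeasure_sub {X : Type*} [MeasurableSpace X]
    {μ ν : Measure X} [IsFiniteMeasure μ] [IsFiniteMeasure ν] {f : X → ℝ} (hμ : Integrable f μ)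
    (hν : Integrable f ν) (c : ℝ) :
    (c • (μ.toSignedMeasure - ν.toSignedMeasure)).Integrable f := by
  have h1 : μ.toSignedMeasure.Integrable f := by
    rwa [VectorMeasure.Integrable, Measure.variation_toSignedMeasure]
  have h2 : ν.toSignedMeasure.Integrable f := by
    rwa [VectorMeasure.Integrable, Measure.variation_toSignedMeasure]
  exact (h1.sub_vectorMeasure h2).smul_vectorMeasure c

lemma MeasureTheory.integral_smul_toSignedMeasure_sub {X : Type*} [MeasurableSpace X]
    {μ ν : Measure X} [IsFiniteMeasure μ] [IsFiniteMeasure ν] {f : X → ℝ} (hμ : Integrable f μ)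
    (hν : Integrable f ν) (c : ℝ) :
    ∫ᵛ y, f y ∂<•(c • (μ.toSignedMeasure - ν.toSignedMeasure)) =
      c * (∫ y, f y ∂μ - ∫ y, f y ∂ν) := by
  have h1 : μ.toSignedMeasure.Integrable f := by
    rwa [VectorMeasure.Integrable, Measure.variation_toSignedMeasure]
  have h2 : ν.toSignedMeasure.Integrable f := by
    rwa [VectorMeasure.Integrable, Measure.variation_toSignedMeasure]
  rw [VectorMeasure.integral_smul_vectorMeasure, VectorMeasure.integral_sub_vectorMeasure h1 h2,
    VectorMeasure.integral_toSignedMeasure, VectorMeasure.integral_toSignedMeasure, smul_eq_mul]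

namespace LossQueue

/-! ### Integrals with respect to the law of a job -/

lemma integrable_jobLaw_iff {F : ℝ → ℝ} : Integrable (fun y : unitInterval => F y) jobLaw ↔
    IntegrableOn (fun y => 5 * y ^ 4 * F y) (Icc 0 1) := by
  have hd : Measurable fun y : unitInterval => ENNReal.ofReal (5 * (y : ℝ) ^ 4) := by fun_prop
  rw [jobLaw, integrable_withDensity_iff_integrable_smul' hd (ae_of_all _ fun _ => ENNReal.ofReal_lt_top), IntegrableOn,
    ← unitInterval.measurePreserving_coe.integrable_comp_emb
      (MeasurableEmbedding.subtype_coe measurableSet_Icc)]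
  refine integrable_congr (ae_of_all _ fun y => ?_)
  simp only [Function.comp_apply, smul_eq_mul]
  rw [ENNReal.toReal_ofReal (by positivity)]

lemma integral_jobLaw (F : ℝ → ℝ) :
    ∫ y : unitInterval, F y ∂jobLaw = ∫ y in (0 : ℝ)..1, 5 * y ^ 4 * F y := by
  have hd : Measurable fun y : unitInterval => ENNReal.ofReal (5 * (y : ℝ) ^ 4) := by fun_prop
  rw [jobLaw, integral_withDensity_eq_integral_toReal_smul hd (ae_of_all _ fun _ => ENNReal.ofReal_lt_top),
    intervalIntegral.integral_of_le zero_le_one, ← integral_Icc_eq_integral_Ioc,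
    ← unitInterval.measurePreserving_coe.integral_comp
      (MeasurableEmbedding.subtype_coe measurableSet_Icc)]
  refine integral_congr_ae (ae_of_all _ fun y => ?_)
  simp only [smul_eq_mul]
  rw [ENNReal.toReal_ofReal (by positivity)]

lemma jobLaw_singleton_zero : jobLaw {0} = 0 := by
  rw [jobLaw, withDensity_apply _ (measurableSet_singleton _), Measure.restrict_singleton,
    lintegral_smul_measure, lintegral_dirac]
  simp

/-! ### The weight functions -/

/-- The weights `x⁻ⁿ`, with value `1` at the idle state. -/
noncomputable def weight (n : ℕ) (x : unitInterval) : ℝ := if (x : ℝ) = 0 then 1 else 1 / (x : ℝ) ^ n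

lemma coe_pos_of_ne {x : unitInterval} (hx : x ≠ 0) : 0 < (x : ℝ) := unitInterval.pos_iff_ne_zero.2 hx

lemma coe_ne_zero {x : unitInterval} (hx : x ≠ 0) : (x : ℝ) ≠ 0 := (coe_pos_of_ne hx).ne'

lemma weight_zero (n : ℕ) : weight n 0 = 1 := by simp [weight]

lemma weight_of_ne (n : ℕ) {x : unitInterval} (hx : x ≠ 0) : weight n x = 1 / (x : ℝ) ^ n :=
  if_neg (coe_ne_zero hx)

lemma measurable_weight (n : ℕ) : Measurable (weight n) :=
  Measurable.ite (measurable_subtype_coe (measurableSet_singleton 0)) measurable_const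
    (by fun_prop)

lemma one_le_weight (n : ℕ) (x : unitInterval) : 1 ≤ weight n x := by
  by_cases hx : x = 0
  · rw [hx, weight_zero]
  · rw [weight_of_ne n hx]
    exact one_le_one_div (pow_pos (coe_pos_of_ne hx) n) (pow_le_one₀ x.2.1 x.2.2)

lemma weight_mono {m n : ℕ} (h : m ≤ n) (x : unitInterval) : weight m x ≤ weight n x := by
  by_cases hx : x = 0
  · rw [hx, weight_zero, weight_zero]
  · rw [weight_of_ne m hx, weight_of_ne n hx]
    exact one_div_le_one_div_of_le (pow_pos (coe_pos_of_ne hx) n)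
      (pow_le_pow_of_le_one x.2.1 x.2.2 h)

/-- The density of the volume cancels the weight, whose mean is therefore 5. Its excess 4 over the
weight 1 of the idle state produces the drift constant 4·lam. -/
lemma ae_mul_weight_four : ∀ᵐ t : ℝ, 5 * t ^ 4 * (if t = 0 then 1 else 1 / t ^ 4) = 5 := by
  filter_upwards [compl_mem_ae_iff.2 (measure_singleton (0 : ℝ))] with t ht
  have ht' : t ≠ 0 := ht
  rw [if_neg ht']
  field_simp

lemma integrable_weight_four : Integrable (weight 4) jobLaw := by
  refine integrable_jobLaw_iff (F := fun t => if t = 0 then 1 else 1 / t ^ 4).2 ?_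
  refine (integrable_congr (ae_restrict_of_ae ae_mul_weight_four)).2 ?_
  exact integrable_const _

lemma integral_weight_four : ∫ y, weight 4 y ∂jobLaw = 5 := by
  have h := integral_jobLaw fun t => if t = 0 then 1 else 1 / t ^ 4
  rw [intervalIntegral.integral_congr_ae (g := fun _ => (5 : ℝ))
    (by filter_upwards [ae_mul_weight_four] with t ht _ using ht)] at h
  exact h.trans (by simp)

lemma integrable_weight {n : ℕ} (hn : n ≤ 4) : Integrable (weight n) jobLaw := by
  refine integrable_weight_four.mono (measurable_weight n).aestronglyMeasurable
    (ae_of_all _ fun y => ?_)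
  have h1 := one_le_weight n y
  have h2 := one_le_weight 4 y
  rw [Real.norm_of_nonneg (by linarith), Real.norm_of_nonneg (by linarith)]
  exact weight_mono hn y

lemma integral_weight_le {n : ℕ} (hn : n ≤ 4) : ∫ y, weight n y ∂jobLaw ≤ 5 := by
  rw [← integral_weight_four]
  exact integral_mono (integrable_weight hn) integrable_weight_four (weight_mono hn)

lemma integrable_weight_four_of_lintegral {γ : Measure unitInterval} [IsFiniteMeasure γ]
    (h : ∫⁻ y in {y : unitInterval | y ≠ 0}, ENNReal.ofReal (1 / (y : ℝ) ^ 4) ∂γ < ⊤) :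
    Integrable (weight 4) γ := by
  have h0 : MeasurableSet {y : unitInterval | y ≠ 0} := (measurableSet_singleton 0).compl
  rw [← integrableOn_univ, ← compl_union_self {y : unitInterval | y ≠ 0}]
  refine IntegrableOn.union ?_ ?_
  · refine (integrable_const (1 : ℝ)).congr ((ae_restrict_iff' h0.compl).2 (ae_of_all _ ?_))
    intro y hy
    have hy0 : y = 0 := by simpa using hy
    rw [hy0, weight_zero]
  · refine ⟨(measurable_weight 4).aestronglyMeasurable, ?_⟩
    rw [hasFiniteIntegral_iff_enorm]
    refine lt_of_eq_of_lt (setLIntegral_congr_fun h0 fun y hy => ?_) h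
    rw [weight_of_ne 4 hy, Real.enorm_of_nonneg (by positivity)]

/-! ### The primitives of the model -/

section

variable {lam α C₁ C₂ Abar : ℝ}

lemma admissible_zero : (model lam α C₁ C₂ Abar).admissible 0 = {0} := if_pos rfl

lemma admissible_of_ne {x : unitInterval} (hx : x ≠ 0) :
    (model lam α C₁ C₂ Abar).admissible x = {a : ℝ≥0 | (a : ℝ) ≤ Abar / (x : ℝ)} := if_neg hx

lemma rate_zero (a : ℝ≥0) : (model lam α C₁ C₂ Abar).rate 0 a =
    lam • (jobLaw.toSignedMeasure - (Measure.dirac 0).toSignedMeasure) := if_pos rfl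

lemma rate_of_ne {x : unitInterval} (hx : x ≠ 0) (a : ℝ≥0) :
    (model lam α C₁ C₂ Abar).rate x a = ((a : ℝ) / (x : ℝ)) •
      ((Measure.dirac 0).toSignedMeasure - (Measure.dirac x).toSignedMeasure) := if_neg hx

lemma cost_zero (a : ℝ≥0) : (model lam α C₁ C₂ Abar).cost 0 a = 0 := if_pos rfl

lemma cost_of_ne {x : unitInterval} (hx : x ≠ 0) (a : ℝ≥0) : (model lam α C₁ C₂ Abar).cost x a =
    C₁ * (x : ℝ) + C₂ * (a : ℝ) ^ 2 - (a : ℝ) / (x : ℝ) := if_neg hx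

lemma dirac_real_apply {Γ : Set unitInterval} (hΓ : MeasurableSet Γ) (x : unitInterval) :
    (Measure.dirac x).real Γ = Γ.indicator 1 x := by
  by_cases hx : x ∈ Γ <;> simp [Measure.real, Measure.dirac_apply' _ hΓ, hx]

lemma rate_zero_apply (a : ℝ≥0) {Γ : Set unitInterval} (hΓ : MeasurableSet Γ) :
    (model lam α C₁ C₂ Abar).rate 0 a Γ = lam * (jobLaw.real Γ - Γ.indicator 1 0) := by
  rw [rate_zero]
  simp [Measure.toSignedMeasure_apply_measurable hΓ, dirac_real_apply hΓ]

lemma rate_of_ne_apply {x : unitInterval} (hx : x ≠ 0) (a : ℝ≥0) {Γ : Set unitInterval}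
    (hΓ : MeasurableSet Γ) : (model lam α C₁ C₂ Abar).rate x a Γ =
      (a : ℝ) / (x : ℝ) * (Γ.indicator 1 0 - Γ.indicator 1 x) := by
  rw [rate_of_ne hx]
  simp [Measure.toSignedMeasure_apply_measurable hΓ, dirac_real_apply hΓ]

lemma integrable_rate {f : unitInterval → ℝ} (hf : Integrable f jobLaw) (x : unitInterval)
    (a : ℝ≥0) : ((model lam α C₁ C₂ Abar).rate x a).Integrable f := by
  by_cases hx : x = 0
  · rw [hx, rate_zero]
    exact integrable_smul_toSignedMeasure_sub hf (integrable_dirac (by simp)) _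
  · rw [rate_of_ne hx]
    exact integrable_smul_toSignedMeasure_sub (integrable_dirac (by simp))
      (integrable_dirac (by simp)) _

lemma integral_rate_zero {f : unitInterval → ℝ} (hf : Integrable f jobLaw) (a : ℝ≥0) :
    ∫ᵛ y, f y ∂<•((model lam α C₁ C₂ Abar).rate 0 a) = lam * (∫ y, f y ∂jobLaw - f 0) := by
  rw [rate_zero, integral_smul_toSignedMeasure_sub hf (integrable_dirac (by simp)),
    integral_dirac]

lemma integral_rate_of_ne (f : unitInterval → ℝ) {x : unitInterval} (hx : x ≠ 0) (a : ℝ≥0) :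
    ∫ᵛ y, f y ∂<•((model lam α C₁ C₂ Abar).rate x a) = (a : ℝ) / (x : ℝ) * (f 0 - f x) := by
  rw [rate_of_ne hx, integral_smul_toSignedMeasure_sub (integrable_dirac (by simp))
    (integrable_dirac (by simp)), integral_dirac, integral_dirac]

lemma continuous_integral_rate (f : unitInterval → ℝ) (x : unitInterval) :
    Continuous fun a => ∫ᵛ y, f y ∂<•((model lam α C₁ C₂ Abar).rate x a) := by
  by_cases hx : x = 0
  · simp only [hx, rate_zero]
    exact continuous_const
  · simp only [integral_rate_of_ne f hx]
    fun_prop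

lemma exitRate_zero (a : ℝ≥0) : (model lam α C₁ C₂ Abar).exitRate 0 a = lam := by
  rw [CTMDP.exitRate, rate_zero_apply a (measurableSet_singleton _)]
  simp [Measure.real, jobLaw_singleton_zero]

lemma exitRate_of_ne {x : unitInterval} (hx : x ≠ 0) (a : ℝ≥0) :
    (model lam α C₁ C₂ Abar).exitRate x a = (a : ℝ) / (x : ℝ) := by
  rw [CTMDP.exitRate, rate_of_ne_apply hx a (measurableSet_singleton _)]
  simp [Ne.symm hx]

lemma measurable_cost : Measurable (Function.uncurry (model lam α C₁ C₂ Abar).cost) := by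
  classical
  refine Measurable.ite (measurable_fst (measurableSet_singleton 0)) measurable_const ?_
  fun_prop

lemma isCompact_admissible (x : unitInterval) :
    IsCompact ((model lam α C₁ C₂ Abar).admissible x) := by
  by_cases hx : x = 0
  · rw [hx, admissible_zero]
    exact isCompact_singleton
  · rw [admissible_of_ne hx]
    refine (isCompact_Icc (a := (0 : ℝ≥0)) (b := (Abar / (x : ℝ)).toNNReal)).of_isClosed_subset
      (isClosed_le NNReal.continuous_coe continuous_const) fun a ha => ⟨zero_le, ?_⟩
    exact NNReal.le_toNNReal_of_coe_le ha

lemma measurableSet_admissible (x : unitInterval) :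
    MeasurableSet ((model lam α C₁ C₂ Abar).admissible x) :=
  (isCompact_admissible x).measurableSet

lemma exitRate_le {x : unitInterval} (hx : x ≠ 0) {a : ℝ≥0}
    (ha : a ∈ (model lam α C₁ C₂ Abar).admissible x) :
    (a : ℝ) / (x : ℝ) ≤ Abar / (x : ℝ) ^ 2 := by
  rw [admissible_of_ne hx] at ha
  calc (a : ℝ) / (x : ℝ) ≤ Abar / (x : ℝ) / (x : ℝ) :=
        div_le_div_of_nonneg_right ha (coe_pos_of_ne hx).le
    _ = _ := by rw [div_div, sq]

/-! ### Drift, growth and continuity conditions for the queue -/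

section

variable (hAbar : 0 ≤ Abar)
include hAbar

lemma zero_mem_admissible (x : unitInterval) : 0 ∈ (model lam α C₁ C₂ Abar).admissible x := by
  by_cases hx : x = 0
  · rw [hx, admissible_zero]
    rfl
  · rw [admissible_of_ne hx]
    exact div_nonneg hAbar (coe_pos_of_ne hx).le

lemma isGreatest_exitRate {x : unitInterval} (hx : x ≠ 0) :
    IsGreatest ((model lam α C₁ C₂ Abar).exitRate x '' (model lam α C₁ C₂ Abar).admissible x)
      (Abar / (x : ℝ) ^ 2) := by
  have h0 : 0 ≤ Abar / (x : ℝ) := div_nonneg hAbar (coe_pos_of_ne hx).le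
  refine ⟨⟨(Abar / (x : ℝ)).toNNReal, ?_, ?_⟩, ?_⟩
  · rw [admissible_of_ne hx]
    exact (Real.coe_toNNReal _ h0).le
  · rw [exitRate_of_ne hx, Real.coe_toNNReal _ h0, div_div, sq]
  · rintro _ ⟨a, ha, rfl⟩
    rw [exitRate_of_ne hx]
    exact exitRate_le hx ha

omit hAbar in
lemma supExitRate_zero : (model lam α C₁ C₂ Abar).supExitRate 0 = lam := by
  simp [CTMDP.supExitRate, admissible_zero, exitRate_zero]

lemma supExitRate_of_ne {x : unitInterval} (hx : x ≠ 0) :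
    (model lam α C₁ C₂ Abar).supExitRate x = Abar / (x : ℝ) ^ 2 :=
  (isGreatest_exitRate hAbar hx).csSup_eq

lemma isModel (hlam : 0 ≤ lam) (hα : 0 < α) : (model lam α C₁ C₂ Abar).IsModel where
  measurableSet_admissible := measurableSet_admissible
  measurableSet_pairs := by
    have h : (model lam α C₁ C₂ Abar).admissiblePairs =
        {p | p.1 = 0 ∧ p.2 = 0} ∪ {p | p.1 ≠ 0 ∧ (p.2 : ℝ) ≤ Abar / (p.1 : ℝ)} := by
      ext ⟨x, a⟩
      by_cases hx : x = 0
      · simp [CTMDP.admissiblePairs, hx, admissible_zero]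
      · simp [CTMDP.admissiblePairs, hx, admissible_of_ne hx]
    have hle : MeasurableSet {p : unitInterval × ℝ≥0 | (p.2 : ℝ) ≤ Abar / (p.1 : ℝ)} :=
      measurableSet_le (by fun_prop) (by fun_prop)
    rw [h]
    exact ((measurable_fst (measurableSet_singleton 0)).inter
      (measurable_snd (measurableSet_singleton 0))).union
        ((measurable_fst (measurableSet_singleton 0).compl).inter hle)
  exists_selector := ⟨fun _ => 0, measurable_const, zero_mem_admissible hAbar⟩
  measurable_rate Γ hΓ := by
    classical
    have h : (fun p : unitInterval × ℝ≥0 => (model lam α C₁ C₂ Abar).rate p.1 p.2 Γ) = fun p =>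
        if p.1 = 0 then lam * (jobLaw.real Γ - Γ.indicator 1 0)
        else (p.2 : ℝ) / (p.1 : ℝ) * (Γ.indicator 1 0 - Γ.indicator 1 p.1) := by
      ext ⟨x, a⟩
      by_cases hx : x = 0
      · simp only [hx, rate_zero_apply a hΓ, if_true]
      · simp only [hx, rate_of_ne_apply hx a hΓ, if_false]
    have hm : Measurable fun p : unitInterval × ℝ≥0 =>
        (model lam α C₁ C₂ Abar).rate p.1 p.2 Γ := by
      rw [h]
      refine Measurable.ite (measurable_fst (measurableSet_singleton 0)) measurable_const ?_
      have h1 : Measurable (Γ.indicator (1 : unitInterval → ℝ)) := measurable_one.indicator hΓ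
      fun_prop
    exact hm.comp measurable_subtype_coe
  rate_nonneg x a _ Γ hΓ hxΓ := by
    by_cases hx : x = 0
    · subst hx
      rw [rate_zero_apply a hΓ, indicator_of_notMem hxΓ, sub_zero]
      exact mul_nonneg hlam measureReal_nonneg
    · rw [rate_of_ne_apply hx a hΓ, indicator_of_notMem hxΓ, sub_zero]
      exact mul_nonneg (div_nonneg a.2 x.2.1) (indicator_nonneg (fun _ _ => zero_le_one) _)
  conservative x a _ := by
    by_cases hx : x = 0
    · subst hx
      simp [rate_zero_apply a MeasurableSet.univ]
    · simp [rate_of_ne_apply hx a MeasurableSet.univ]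
  stable x := by
    by_cases hx : x = 0
    · subst hx
      simp [admissible_zero]
    · exact (isGreatest_exitRate hAbar hx).bddAbove
  measurable_cost := measurable_cost.comp measurable_subtype_coe
  discount_pos := hα

-- An arrival lifts the weight from 1 to a mean of at most 5, and a completed service can only lower
-- it to 1. Hence ρ = 0 and b = 4·lam.
omit hAbar in
lemma integral_weight_rate_le (hlam : 0 ≤ lam) {n : ℕ} (hn : n ≤ 4) (x : unitInterval) (a : ℝ≥0) :
    ∫ᵛ y, weight n y ∂<•((model lam α C₁ C₂ Abar).rate x a) ≤ 0 * weight n x + 4 * lam := by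
  by_cases hx : x = 0
  · rw [hx, integral_rate_zero (integrable_weight hn), weight_zero]
    nlinarith [integral_weight_le hn]
  · rw [integral_rate_of_ne _ hx, weight_zero]
    have h1 : 0 ≤ (a : ℝ) / (x : ℝ) := div_nonneg a.2 x.2.1
    nlinarith [one_le_weight n x]

lemma regularityCondition (hlam : 0 ≤ lam) :
    (model lam α C₁ C₂ Abar).RegularityCondition (weight 4) 0 (4 * lam) where
  measurable_weight := measurable_weight 4
  one_le_weight := one_le_weight 4
  rho_nonneg := le_rfl
  b_nonneg := by positivity
  exhaustion := by
    have hmem : ∀ (l : ℕ) (x : unitInterval), x ≠ 0 → ((l : ℝ) + 1) * x < 1 →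
        (l : ℝ) + 1 ≤ weight 4 x := fun l x hx h => by
      have hpos := coe_pos_of_ne hx
      refine le_trans ?_ (weight_mono (by norm_num : 1 ≤ 4) x)
      rw [weight_of_ne 1 hx, pow_one, le_div_iff₀ hpos]
      exact h.le
    -- The exhausting sets are {0} ∪ [1/(l+1), 1]: off them the weight is at least 1/x > l + 1, and
    -- on them the exit rate is at most max(lam, Abar (l+1)²).
    refine ⟨fun l => {x | x = 0 ∨ 1 ≤ ((l : ℝ) + 1) * x}, fun l => ?_, fun l m hlm x hx => ?_, ?_,
      fun R => ?_, fun l => ?_⟩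
    · have hle : MeasurableSet {x : unitInterval | 1 ≤ ((l : ℝ) + 1) * x} :=
        measurableSet_le (by fun_prop) (by fun_prop)
      exact (measurableSet_singleton 0).union hle
    · refine hx.imp id fun h => h.trans ?_
      have : (l : ℝ) ≤ m := by exact_mod_cast hlm
      exact mul_le_mul_of_nonneg_right (by linarith) x.2.1
    · refine eq_univ_of_forall fun x => mem_iUnion.2 ?_
      by_cases hx : x = 0
      · exact ⟨0, Or.inl hx⟩
      · have hpos := coe_pos_of_ne hx
        obtain ⟨l, hl⟩ := exists_nat_gt (1 / (x : ℝ))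
        refine ⟨l, Or.inr ?_⟩
        rw [div_lt_iff₀ hpos] at hl
        linarith
    · obtain ⟨n, hn⟩ := exists_nat_gt R
      filter_upwards [eventually_ge_atTop n] with l hl x hx
      simp only [not_or, not_le] at hx
      have : (n : ℝ) ≤ l := by exact_mod_cast hl
      linarith [hmem l x hx.1 hx.2]
    · refine ⟨max lam (Abar * ((l : ℝ) + 1) ^ 2), ?_⟩
      rintro _ ⟨x, hx, rfl⟩
      by_cases h0 : x = 0
      · rw [h0, supExitRate_zero]
        exact le_max_left _ _
      · have hpos := coe_pos_of_ne h0
        have h1 : 1 ≤ ((l : ℝ) + 1) * x := hx.resolve_left h0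
        rw [supExitRate_of_ne hAbar h0]
        refine le_trans ?_ (le_max_right _ _)
        rw [div_le_iff₀ (by positivity), mul_assoc, ← mul_pow]
        exact le_mul_of_one_le_right hAbar (one_le_pow₀ h1)
  integrable_weight x a _ := integrable_rate integrable_weight_four x a
  drift x a _ := integral_weight_rate_le hlam le_rfl x a

/-- Below, the income rate is at most Abar/x², which needs a weight of exponent at least 2; above,
the action 0 costs at most C₁. -/
lemma costBound (hC₁ : 0 ≤ C₁) (hC₂ : 0 ≤ C₂) {n : ℕ} (hn : 2 ≤ n) :
    (model lam α C₁ C₂ Abar).CostBound (weight n) := by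
  refine ⟨Abar, C₁, hAbar, hC₁, fun x => ?_⟩
  have hw := one_le_weight n x
  by_cases hx : x = 0
  · subst hx
    simp only [admissible_zero, image_singleton, cost_zero, bddBelow_singleton, csInf_singleton,
      abs_zero, true_and]
    positivity
  · have hpos := coe_pos_of_ne hx
    have hlow : ∀ c ∈ (model lam α C₁ C₂ Abar).cost x '' (model lam α C₁ C₂ Abar).admissible x,
        -(Abar / (x : ℝ) ^ 2) ≤ c := by
      rintro _ ⟨a, ha, rfl⟩
      rw [cost_of_ne hx]
      have := exitRate_le hx ha
      have h1 : 0 ≤ C₁ * (x : ℝ) := by positivity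
      have h2 : 0 ≤ C₂ * (a : ℝ) ^ 2 := by positivity
      linarith
    have hbdd : BddBelow ((model lam α C₁ C₂ Abar).cost x ''
        (model lam α C₁ C₂ Abar).admissible x) := ⟨_, hlow⟩
    have hmem : (model lam α C₁ C₂ Abar).cost x 0 ∈
        (model lam α C₁ C₂ Abar).cost x '' (model lam α C₁ C₂ Abar).admissible x :=
      ⟨0, zero_mem_admissible hAbar x, rfl⟩
    have hup := csInf_le hbdd hmem
    have hlo := le_csInf ⟨_, hmem⟩ hlow
    have hcost : (model lam α C₁ C₂ Abar).cost x 0 ≤ C₁ := by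
      rw [cost_of_ne hx]
      simpa using mul_le_of_le_one_right hC₁ x.2.2
    have hA : Abar / (x : ℝ) ^ 2 ≤ Abar * weight n x := by
      have := weight_mono hn x
      rw [weight_of_ne 2 hx] at this
      calc Abar / (x : ℝ) ^ 2 = Abar * (1 / (x : ℝ) ^ 2) := by ring
        _ ≤ _ := mul_le_mul_of_nonneg_left this hAbar
    have hA0 : 0 ≤ Abar * weight n x := by positivity
    exact ⟨hbdd, abs_le.2 ⟨by linarith, by linarith⟩⟩

omit hAbar in
lemma exitRateCondition : (model lam α C₁ C₂ Abar).ExitRateCondition where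
  compact_admissible := isCompact_admissible
  usc_exitRate x := by
    refine Continuous.upperSemicontinuous ?_ |>.upperSemicontinuousOn _
    by_cases hx : x = 0
    · subst hx
      rw [funext (exitRate_zero (lam := lam) (α := α) (C₁ := C₁) (C₂ := C₂) (Abar := Abar))]
      exact continuous_const
    · rw [funext (exitRate_of_ne hx)]
      fun_prop

lemma strongRegularityCondition (hlam : 0 ≤ lam) :
    (model lam α C₁ C₂ Abar).StrongRegularityCondition (weight 4) := by
  refine ⟨Abar + lam + 1, by positivity, fun x => ?_⟩
  by_cases hx : x = 0
  · subst hx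
    rw [supExitRate_zero, weight_zero]
    exact ⟨hlam, by linarith⟩
  · have hw := weight_mono (by norm_num : 2 ≤ 4) x
    rw [weight_of_ne 2 hx] at hw
    rw [supExitRate_of_ne hAbar hx]
    refine ⟨by positivity, ?_⟩
    have h1 : Abar / (x : ℝ) ^ 2 ≤ Abar * weight 4 x := by
      calc Abar / (x : ℝ) ^ 2 = Abar * (1 / (x : ℝ) ^ 2) := by ring
        _ ≤ _ := mul_le_mul_of_nonneg_left hw hAbar
    nlinarith [one_le_weight 4 x]

/-- The exponents fit because the maximal exit rate Abar/x² times the smaller weight x⁻² is of the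
order of the larger weight x⁻⁴. -/
lemma dynamicProgrammingCondition (hlam : 0 ≤ lam) (hα : 0 < α) (hC₁ : 0 ≤ C₁) (hC₂ : 0 ≤ C₂) :
    (model lam α C₁ C₂ Abar).DynamicProgrammingCondition (weight 4) (weight 2) (Abar + lam + 1) 0
      (4 * lam) where
  measurable_weight := measurable_weight 2
  one_le_weight := one_le_weight 2
  L_nonneg := by positivity
  rho_nonneg := le_rfl
  b_nonneg := by positivity
  weight_le x := by
    by_cases hx : x = 0
    · subst hx
      rw [supExitRate_zero, weight_zero, weight_zero]
      linarith
    · have hpos := coe_pos_of_ne hx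
      have h2 := one_le_weight 2 x
      have h4 : weight 4 x = weight 2 x ^ 2 := by
        rw [weight_of_ne 2 hx, weight_of_ne 4 hx, div_pow, one_pow, ← pow_mul]
      rw [supExitRate_of_ne hAbar hx, h4, div_eq_mul_one_div, ← weight_of_ne 2 hx]
      nlinarith [mul_nonneg hlam (sq_nonneg (weight 2 x))]
  integrable_weight x a _ := integrable_rate (integrable_weight (by norm_num)) x a
  drift x a _ := integral_weight_rate_le hlam (by norm_num) x a
  rho_lt_discount := hα
  cost_bound := costBound hAbar hC₁ hC₂ le_rfl

omit hAbar in
lemma compactnessContinuityCondition :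
    (model lam α C₁ C₂ Abar).CompactnessContinuityCondition (weight 4) where
  lsc_rate f _ _ _ x :=
    ((continuous_integral_rate f x).lowerSemicontinuous).lowerSemicontinuousOn _
  integrable_weight x a _ := integrable_rate integrable_weight_four x a
  continuous_weight x := (continuous_integral_rate _ x).continuousOn
  lsc_cost x := by
    refine Continuous.lowerSemicontinuous ?_ |>.lowerSemicontinuousOn _
    by_cases hx : x = 0
    · subst hx
      rw [funext (cost_zero (lam := lam) (α := α) (C₁ := C₁) (C₂ := C₂) (Abar := Abar))]
      exact continuous_const
    · rw [funext (cost_of_ne hx)]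
      fun_prop
  compact_admissible := isCompact_admissible

end

end

end LossQueue

end

section

open ProbabilityTheory

namespace LossQueue

/-! ### The jump mechanism -/

/-- The total jump rate of the loss queue. -/
noncomputable def jumpRate (lam : ℝ) (x : unitInterval) (a : ℝ≥0) : ℝ :=
  if (x : ℝ) = 0 then lam else (a : ℝ) / (x : ℝ)

/-- The law of the state after a jump of the loss queue. -/
noncomputable def jumpLaw : Kernel unitInterval unitInterval :=
  haveI : DecidablePred (· ∈ ({0} : Set unitInterval)) := Classical.decPred _
  Kernel.piecewise (measurableSet_singleton 0) (Kernel.const _ jobLaw)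
    (Kernel.const _ (Measure.dirac 0))

lemma jumpLaw_zero : jumpLaw 0 = jobLaw := by simp [jumpLaw, Kernel.piecewise_apply]

lemma jumpLaw_of_ne {x : unitInterval} (hx : x ≠ 0) : jumpLaw x = Measure.dirac 0 := by
  simp [jumpLaw, Kernel.piecewise_apply, hx]

instance : IsMarkovKernel jumpLaw := by unfold jumpLaw; infer_instance

section

variable {lam α C₁ C₂ Abar : ℝ}

lemma jumpRate_zero (a : ℝ≥0) : jumpRate lam 0 a = lam := by simp [jumpRate]

lemma jumpRate_of_ne {x : unitInterval} (hx : x ≠ 0) (a : ℝ≥0) :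
    jumpRate lam x a = (a : ℝ) / (x : ℝ) := if_neg (coe_ne_zero hx)

lemma measurable_jumpRate : Measurable (Function.uncurry (jumpRate lam)) := by
  refine Measurable.ite ?_ measurable_const (by fun_prop)
  exact (measurable_subtype_coe.comp measurable_fst) (measurableSet_singleton 0)

lemma jumpRate_nonneg (hlam : 0 ≤ lam) (x : unitInterval) (a : ℝ≥0) : 0 ≤ jumpRate lam x a := by
  unfold jumpRate
  split_ifs
  · exact hlam
  · exact div_nonneg a.2 x.2.1

lemma hasJumpKernel (hlam : 0 ≤ lam) : (model lam α C₁ C₂ Abar).HasJumpKernel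
    (fun x a => ENNReal.ofReal (jumpRate lam x a)) jumpLaw
    (fun x => max lam.toNNReal (Abar / (x : ℝ) ^ 2).toNNReal) where
  measurable_rate := measurable_jumpRate.ennreal_ofReal
  rate_eq x a _ Γ hΓ := by
    have hm : MeasurableSet (Γ \ {x}) := hΓ.diff (measurableSet_singleton x)
    by_cases hx : x = 0
    · subst hx
      have h1 : jobLaw (Γ \ {0}) = jobLaw Γ := measure_sdiff_null jobLaw_singleton_zero
      rw [rate_zero_apply a hm, jumpRate_zero, jumpLaw_zero,
        indicator_of_notMem (fun h => h.2 rfl), sub_zero, ENNReal.ofReal_mul hlam, measureReal_def,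
        h1, ENNReal.ofReal_toReal (measure_ne_top _ _)]
    · rw [rate_of_ne_apply hx a hm, jumpRate_of_ne hx, jumpLaw_of_ne hx,
        indicator_of_notMem (s := Γ \ {x}) (a := x) (fun h => h.2 rfl), sub_zero,
        ENNReal.ofReal_mul (div_nonneg a.coe_nonneg x.2.1), Measure.dirac_apply' _ hΓ]
      by_cases h0 : (0 : unitInterval) ∈ Γ
      · rw [indicator_of_mem (show 0 ∈ Γ \ {x} from ⟨h0, Ne.symm hx⟩), indicator_of_mem h0]
        simp
      · rw [indicator_of_notMem fun h => h0 h.1, indicator_of_notMem h0]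
        simp
  rate_le x a ha := by
    by_cases hx : x = 0
    · subst hx
      rw [jumpRate_zero]
      exact ENNReal.coe_le_coe.2 (le_max_left _ _)
    · rw [jumpRate_of_ne hx]
      refine (ENNReal.ofReal_le_ofReal (exitRate_le hx ha)).trans ?_
      exact ENNReal.coe_le_coe.2 (le_max_right _ _)

/-- A Lyapunov function for the jump rate. -/
noncomputable def lyapunov (x : unitInterval) : ℝ≥0∞ := if (x : ℝ) = 0 then 1 else 2

lemma measurable_lyapunov : Measurable lyapunov :=
  Measurable.ite (measurable_subtype_coe (measurableSet_singleton 0)) measurable_const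
    measurable_const

lemma lyapunov_le_two (x : unitInterval) : lyapunov x ≤ 2 := by
  unfold lyapunov
  split_ifs
  · exact one_le_two
  · exact le_rfl

lemma lintegral_lyapunov_le (μ : Measure unitInterval) [IsProbabilityMeasure μ] :
    ∫⁻ x, lyapunov x ∂μ ≤ 2 :=
  (lintegral_mono lyapunov_le_two).trans (by simp)

/-- The function equals 1 when idle and 2 when busy, so a service lowers it by 1 and pays for its
own jump however large the rate is. At the idle state lam + 2·lam ≤ α + lam is what remains. -/
lemma lyapunov_drift (hlam : 0 ≤ lam) (hα : 2 * lam ≤ α) (x : unitInterval) (a : ℝ≥0) :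
    ENNReal.ofReal (jumpRate lam x a) +
      ENNReal.ofReal (jumpRate lam x a) * ∫⁻ y, lyapunov y ∂(jumpLaw x) ≤
      (α.toNNReal + ENNReal.ofReal (jumpRate lam x a)) * lyapunov x := by
  by_cases hx : x = 0
  · subst hx
    have h : ENNReal.ofReal lam * 2 ≤ ENNReal.ofReal α := by
      rw [← ENNReal.ofReal_ofNat 2, ← ENNReal.ofReal_mul hlam]
      exact ENNReal.ofReal_le_ofReal (by linarith)
    calc _ ≤ ENNReal.ofReal lam + ENNReal.ofReal lam * 2 := by
          rw [jumpRate_zero]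
          gcongr
          exact lintegral_lyapunov_le _
      _ ≤ ENNReal.ofReal lam + ENNReal.ofReal α := by gcongr
      _ = _ := by rw [jumpRate_zero, add_comm]; simp [lyapunov, ENNReal.ofReal]
  · have h0 : lyapunov 0 = 1 := by simp [lyapunov]
    have h2 : lyapunov x = 2 := if_neg (coe_ne_zero hx)
    rw [jumpLaw_of_ne hx, lintegral_dirac, h0, h2, mul_one, ← mul_two]
    gcongr
    exact le_add_self

/-- The only income is one unit per completed service, so the total negative cost is at most the
expected discounted number of jumps, which the Lyapunov function bounds. -/
lemma neg_cost_le_jumpRate (hlam : 0 ≤ lam) (hC₁ : 0 ≤ C₁) (hC₂ : 0 ≤ C₂) (x : unitInterval)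
    (a : ℝ≥0) : -((model lam α C₁ C₂ Abar).cost x a) ≤ jumpRate lam x a := by
  by_cases hx : x = 0
  · rw [hx, cost_zero, jumpRate_zero, neg_zero]
    exact hlam
  · rw [cost_of_ne hx, jumpRate_of_ne hx]
    have h1 : 0 ≤ C₁ * (x : ℝ) := mul_nonneg hC₁ x.2.1
    have h2 : 0 ≤ C₂ * (a : ℝ) ^ 2 := by positivity
    linarith

variable {γ : Measure unitInterval} [IsProbabilityMeasure γ]

lemma negativeCost_lt_top (hlam : 0 < lam) (hα : 2 * lam ≤ α) (hC₁ : 0 ≤ C₁) (hC₂ : 0 ≤ C₂)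
    {π : Trajectory unitInterval → ℝ≥0 → Measure (ℝ≥0 ⊕ Unit)}
    (hπ : (model lam α C₁ C₂ Abar).IsPolicy π) :
    (model lam α C₁ C₂ Abar).negativeCost γ π < ⊤ := by
  have hM := hasJumpKernel (α := α) (C₁ := C₁) (C₂ := C₂) (Abar := Abar) hlam.le
  have hα0 : 0 < α := by linarith
  have hf : Measurable (Function.uncurry fun x a =>
      ENNReal.ofReal (-((model lam α C₁ C₂ Abar).cost x a))) :=
    measurable_cost.neg.ennreal_ofReal
  rw [CTMDP.negativeCost, CTMDP.discountedTotal_eq_tsum hM hπ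
    (Real.coe_toNNReal α hα0.le).symm hf]
  refine (CTMDP.tsum_stageTotal_le_lintegral hM hπ (CTMDP.isControlledLaw_controlledLaw hM hπ γ)
    (Real.toNNReal_pos.2 hα0) hf measurable_lyapunov fun x a _ => ?_).trans_lt
    ((lintegral_lyapunov_le γ).trans_lt (by simp))
  refine le_trans ?_ (lyapunov_drift hlam.le hα x a)
  gcongr
  exact neg_cost_le_jumpRate hlam.le hC₁ hC₂ x a

end

/-! ### The Bellman equation -/

section

variable {lam α C₁ C₂ Abar z : ℝ}

lemma uStar_zero : uStar α C₁ C₂ z 0 = 1 - z := if_pos rfl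

lemma uStar_of_ne {x : unitInterval} (hx : x ≠ 0) : uStar α C₁ C₂ z x = u α C₁ C₂ x z := if_neg hx

lemma measurable_uStar : Measurable (uStar α C₁ C₂ z) := by
  classical
  have h : Continuous fun x : unitInterval => u α C₁ C₂ x z :=
    continuous_u.comp (by fun_prop : Continuous fun x : unitInterval => ((x : ℝ), z))
  exact Measurable.ite (measurableSet_singleton 0) measurable_const h.measurable

lemma uStar_ae_eq : uStar α C₁ C₂ z =ᵐ[jobLaw] fun x => u α C₁ C₂ x z := by
  filter_upwards [compl_mem_ae_iff.2 jobLaw_singleton_zero] with x hx using uStar_of_ne hx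

lemma integrable_uStar : Integrable (uStar α C₁ C₂ z) jobLaw := by
  refine Integrable.congr ?_ uStar_ae_eq.symm
  refine (integrable_jobLaw_iff (F := fun t => u α C₁ C₂ t z)).2 ?_
  have h := continuous_u_mul_pow (α := α) (C₁ := C₁) (C₂ := C₂) z
  exact ((h.const_mul 5).congr fun y => by ring).integrableOn_Icc

lemma integral_uStar :
    ∫ x, uStar α C₁ C₂ z x ∂jobLaw = 5 * ∫ y in (0 : ℝ)..1, u α C₁ C₂ y z * y ^ 4 := by
  rw [integral_congr_ae uStar_ae_eq, integral_jobLaw fun t => u α C₁ C₂ t z,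
    ← intervalIntegral.integral_const_mul]
  exact intervalIntegral.integral_congr fun y _ => by ring

/-- The fixed-point equation of `zStep`, multiplied by α + lam, is the Bellman equation at the idle
state. -/
lemma discount_mul_uStar_zero (hpos : 0 < α + lam) (hz : zStep lam α C₁ C₂ z = z) :
    α * (1 - z) = lam * (∫ x, uStar α C₁ C₂ z x ∂jobLaw - (1 - z)) := by
  rw [integral_uStar]
  unfold zStep at hz
  set I := ∫ y in (0 : ℝ)..1, u α C₁ C₂ y z * y ^ 4
  have h : (α + lam) * (5 * lam / (α + lam) * I) = 5 * lam * I := by field_simp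
  linear_combination (α + lam) * hz + h

lemma u_add_nonneg (hα : 0 ≤ α) (hC₁ : 0 ≤ C₁) (hC₂ : 0 ≤ C₂) (hz : 0 ≤ z) {x : ℝ} (hx : 0 ≤ x) :
    0 ≤ u α C₁ C₂ x z + z := by
  linarith [neg_le_u hα hC₁ hC₂ hx hz]

/-- The explicit formula solves a quadratic equation. Divided by 4C₂x² this reads αu = C₁x - (u +
z)²/(4C₂x²), the Bellman equation after unconstrained minimization over the action. -/
lemma sq_u_add (hα : 0 ≤ α) (hC₁ : 0 ≤ C₁) (hC₂ : 0 ≤ C₂) (hz : 0 ≤ z) {x : ℝ} (hx : 0 ≤ x) :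
    (u α C₁ C₂ x z + z) ^ 2 = 4 * C₁ * C₂ * x ^ 3 - 4 * α * C₂ * x ^ 2 * u α C₁ C₂ x z := by
  have h := Real.sq_sqrt (show 0 ≤ α ^ 2 * C₂ ^ 2 * x ^ 4 + C₁ * C₂ * x ^ 3 + α * C₂ * x ^ 2 * z by
    positivity)
  unfold u
  linear_combination 4 * h

/-- Completes the square in the action; the constant left over is αu by `sq_u_add`. The Bellman
inequality and its equality case at the minimizer can both be read off. -/
lemma cost_sub_eq (hα : 0 ≤ α) (hC₁ : 0 ≤ C₁) (hC₂ : 0 < C₂) (hz : 0 ≤ z) {x : ℝ} (hx : 0 < x)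
    (a : ℝ) : C₁ * x + C₂ * a ^ 2 - a / x + a / x * (1 - z - u α C₁ C₂ x z) =
      α * u α C₁ C₂ x z + C₂ * (a - (u α C₁ C₂ x z + z) / (2 * x * C₂)) ^ 2 := by
  have h := sq_u_add hα hC₁ hC₂.le hz hx.le
  set U := u α C₁ C₂ x z
  have h1 : C₂ * (a - (U + z) / (2 * x * C₂)) ^ 2 =
      C₂ * a ^ 2 - a / x * (U + z) + (U + z) ^ 2 / (4 * x ^ 2 * C₂) := by
    field_simp
    ring
  rw [h1, h]
  field_simp
  ring

/-- The minimizer in the Bellman equation. -/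
noncomputable def optimalAction (α C₁ C₂ z : ℝ) (x : unitInterval) : ℝ≥0 :=
  ((uStar α C₁ C₂ z x + z) / (2 * (x : ℝ) * C₂)).toNNReal

lemma optimalAction_zero : optimalAction α C₁ C₂ z 0 = 0 := by simp [optimalAction]

lemma measurable_optimalAction : Measurable (optimalAction α C₁ C₂ z) := by
  have := measurable_uStar (α := α) (C₁ := C₁) (C₂ := C₂) (z := z)
  unfold optimalAction
  fun_prop

variable (hlam : 0 < lam) (hα : 0 < α) (hC₁ : 0 ≤ C₁) (hC₂ : 0 < C₂) (hz : 0 ≤ z)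
  (hstep : zStep lam α C₁ C₂ z = z)
  (hadm : ∀ x : ℝ, 0 < x → x ≤ 1 → (u α C₁ C₂ x z + z) / (2 * C₂) ≤ Abar)

include hα hC₁ hC₂ hz in
lemma coe_optimalAction {x : unitInterval} (hx : x ≠ 0) : (optimalAction α C₁ C₂ z x : ℝ) =
    (uStar α C₁ C₂ z x + z) / (2 * (x : ℝ) * C₂) := by
  have hpos := coe_pos_of_ne hx
  refine Real.coe_toNNReal _ (div_nonneg ?_ (by positivity))
  rw [uStar_of_ne hx]
  exact u_add_nonneg hα.le hC₁ hC₂.le hz hpos.le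

-- `hadm`, divided by x, says that the unconstrained minimizer does not exceed Abar/x.
include hα hC₁ hC₂ hz hadm in
lemma optimalAction_mem (x : unitInterval) :
    optimalAction α C₁ C₂ z x ∈ (model lam α C₁ C₂ Abar).admissible x := by
  by_cases hx : x = 0
  · rw [hx, admissible_zero, optimalAction_zero]
    rfl
  · have hpos := coe_pos_of_ne hx
    rw [admissible_of_ne hx, mem_ofPred_eq, coe_optimalAction hα hC₁ hC₂ hz hx, uStar_of_ne hx]
    calc (u α C₁ C₂ x z + z) / (2 * (x : ℝ) * C₂) =
        (u α C₁ C₂ x z + z) / (2 * C₂) / (x : ℝ) := by rw [div_div]; ring_nf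
      _ ≤ _ := div_le_div_of_nonneg_right (hadm x hpos x.2.2) hpos.le

include hlam hα hC₁ hC₂ hz hstep in
lemma discount_mul_uStar_le (x : unitInterval) (a : ℝ≥0) : α * uStar α C₁ C₂ z x ≤
    (model lam α C₁ C₂ Abar).cost x a +
      ∫ᵛ y, uStar α C₁ C₂ z y ∂<•((model lam α C₁ C₂ Abar).rate x a) := by
  by_cases hx : x = 0
  · rw [hx, cost_zero, zero_add, integral_rate_zero integrable_uStar, uStar_zero]
    exact (discount_mul_uStar_zero (by positivity) hstep).le
  · rw [cost_of_ne hx, integral_rate_of_ne _ hx, uStar_zero, uStar_of_ne hx,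
      cost_sub_eq hα.le hC₁ hC₂ hz (coe_pos_of_ne hx)]
    exact le_add_of_nonneg_right (by positivity)

include hlam hα hC₁ hC₂ hz hstep in
lemma discount_mul_uStar_eq (x : unitInterval) : (model lam α C₁ C₂ Abar).cost x
      (optimalAction α C₁ C₂ z x) + ∫ᵛ y, uStar α C₁ C₂ z y
        ∂<•((model lam α C₁ C₂ Abar).rate x (optimalAction α C₁ C₂ z x)) =
      α * uStar α C₁ C₂ z x := by
  by_cases hx : x = 0
  · rw [hx, cost_zero, zero_add, integral_rate_zero integrable_uStar, uStar_zero]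
    exact (discount_mul_uStar_zero (by positivity) hstep).symm
  · rw [cost_of_ne hx, integral_rate_of_ne _ hx, uStar_zero, coe_optimalAction hα hC₁ hC₂ hz hx,
      uStar_of_ne hx, cost_sub_eq hα.le hC₁ hC₂ hz (coe_pos_of_ne hx), sub_self]
    ring

include hlam hα hC₁ hC₂ hz hstep hadm in
lemma solvesBellman : (model lam α C₁ C₂ Abar).SolvesBellman (uStar α C₁ C₂ z) where
  measurable := measurable_uStar
  integrable x a _ := integrable_rate integrable_uStar x a
  equation x := by
    refine IsLeast.isGLB ⟨⟨optimalAction α C₁ C₂ z x, optimalAction_mem hα hC₁ hC₂ hz hadm x,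
      discount_mul_uStar_eq hlam hα hC₁ hC₂ hz hstep x⟩, ?_⟩
    rintro _ ⟨a, _, rfl⟩
    exact discount_mul_uStar_le hlam hα hC₁ hC₂ hz hstep x a

/-! ### Optimality -/

/-- Translates between a real inequality with a signed cost and its form in [0, ∞], where the
negative part of the cost is moved to the other side. -/
lemma ofReal_neg_add_le_iff {c s t : ℝ} (hs : 0 ≤ s) (ht : 0 ≤ t) :
    ENNReal.ofReal (-c) + ENNReal.ofReal s ≤ ENNReal.ofReal c + ENNReal.ofReal t ↔ s ≤ c + t := by
  rcases le_total 0 c with hc | hc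
  · rw [ENNReal.ofReal_of_nonpos (neg_nonpos.2 hc), zero_add, ← ENNReal.ofReal_add hc ht,
      ENNReal.ofReal_le_ofReal_iff (add_nonneg hc ht)]
  · rw [ENNReal.ofReal_of_nonpos hc, zero_add, ← ENNReal.ofReal_add (neg_nonneg.2 hc) hs,
      ENNReal.ofReal_le_ofReal_iff ht]
    constructor <;> intro h <;> linarith

include hα hC₁ hC₂ hz in
lemma uStar_add_nonneg (x : unitInterval) : 0 ≤ uStar α C₁ C₂ z x + z := by
  by_cases hx : x = 0
  · rw [hx, uStar_zero]
    simp
  · rw [uStar_of_ne hx]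
    exact u_add_nonneg hα.le hC₁ hC₂.le hz x.2.1

lemma integrable_uStar_jumpLaw (x : unitInterval) : Integrable (uStar α C₁ C₂ z) (jumpLaw x) := by
  by_cases hx : x = 0
  · rw [hx, jumpLaw_zero]
    exact integrable_uStar
  · rw [jumpLaw_of_ne hx]
    exact integrable_dirac (by simp)

lemma integral_rate_eq (x : unitInterval) (a : ℝ≥0) :
    ∫ᵛ y, uStar α C₁ C₂ z y ∂<•((model lam α C₁ C₂ Abar).rate x a) =
      jumpRate lam x a * (∫ y, uStar α C₁ C₂ z y ∂(jumpLaw x) - uStar α C₁ C₂ z x) := by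
  by_cases hx : x = 0
  · subst hx
    rw [integral_rate_zero integrable_uStar, jumpRate_zero, jumpLaw_zero]
  · rw [integral_rate_of_ne _ hx, jumpRate_of_ne hx, jumpLaw_of_ne hx, integral_dirac]

include hα hC₁ hC₂ hz in
lemma lintegral_uStar_add (x : unitInterval) :
    ∫⁻ y, ENNReal.ofReal (uStar α C₁ C₂ z y + z) ∂(jumpLaw x) =
      ENNReal.ofReal (∫ y, uStar α C₁ C₂ z y ∂(jumpLaw x) + z) := by
  have hint := integrable_uStar_jumpLaw (α := α) (C₁ := C₁) (C₂ := C₂) (z := z) x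
  have hadd : Integrable (fun y => uStar α C₁ C₂ z y + z) (jumpLaw x) :=
    hint.add (integrable_const z)
  rw [← ofReal_integral_eq_lintegral_ofReal hadd
    (ae_of_all _ (uStar_add_nonneg hα hC₁ hC₂ hz)), integral_add hint (integrable_const z)]
  simp

-- The verification theorem is applied with v = u* + z and B = z. In (α + g)v ≤ c + αz + gνv every z
-- cancels, leaving the Bellman inequality αu* ≤ c + g(νu* - u*), with equality at the minimizer.
include hlam hα hC₁ hC₂ hz hstep hadm in
lemma isOptimalPolicy_optimalAction (hlamα : 2 * lam ≤ α) (γ : Measure unitInterval)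
    [IsProbabilityMeasure γ] : (model lam α C₁ C₂ Abar).IsOptimalPolicy γ
      (CTMDP.stationaryPolicy (optimalAction α C₁ C₂ z)) := by
  have hv0 := uStar_add_nonneg (α := α) (C₁ := C₁) (C₂ := C₂) (z := z) hα hC₁ hC₂ hz
  have hI0 : ∀ x, 0 ≤ ∫ y, uStar α C₁ C₂ z y ∂(jumpLaw x) + z := fun x => by
    have hint := integrable_uStar_jumpLaw (α := α) (C₁ := C₁) (C₂ := C₂) (z := z) x
    have h : ∫ y, (uStar α C₁ C₂ z y + z) ∂(jumpLaw x) = ∫ y, uStar α C₁ C₂ z y ∂(jumpLaw x) + z := by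
      rw [integral_add hint (integrable_const z)]
      simp
    rw [← h]
    exact integral_nonneg hv0
  have hg0 := jumpRate_nonneg hlam.le
  have hleft : ∀ x a, ((α.toNNReal : ℝ≥0∞) + ENNReal.ofReal (jumpRate lam x a)) *
      ENNReal.ofReal (uStar α C₁ C₂ z x + z) =
      ENNReal.ofReal ((α + jumpRate lam x a) * (uStar α C₁ C₂ z x + z)) := fun x a => by
    rw [ENNReal.ofReal_mul (add_nonneg hα.le (hg0 x a)), ENNReal.ofReal_add hα.le (hg0 x a)]
    rfl
  have hright : ∀ x a, ENNReal.ofReal ((model lam α C₁ C₂ Abar).cost x a) +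
        (α.toNNReal : ℝ≥0∞) * (z.toNNReal : ℝ≥0∞) +
      ENNReal.ofReal (jumpRate lam x a) *
        ∫⁻ y, ENNReal.ofReal (uStar α C₁ C₂ z y + z) ∂(jumpLaw x) =
      ENNReal.ofReal ((model lam α C₁ C₂ Abar).cost x a) + ENNReal.ofReal
        (α * z + jumpRate lam x a * (∫ y, uStar α C₁ C₂ z y ∂(jumpLaw x) + z)) := fun x a => by
    rw [lintegral_uStar_add hα hC₁ hC₂ hz, ENNReal.ofReal_add (mul_nonneg hα.le hz)
      (mul_nonneg (hg0 x a) (hI0 x)), ENNReal.ofReal_mul hα.le, ENNReal.ofReal_mul (hg0 x a),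
      add_assoc]
    rfl
  have hs0 : ∀ x a, 0 ≤ (α + jumpRate lam x a) * (uStar α C₁ C₂ z x + z) := fun x a =>
    mul_nonneg (add_nonneg hα.le (hg0 x a)) (hv0 x)
  have ht0 : ∀ x a, 0 ≤ α * z + jumpRate lam x a * (∫ y, uStar α C₁ C₂ z y ∂(jumpLaw x) + z) :=
    fun x a => add_nonneg (mul_nonneg hα.le hz) (mul_nonneg (hg0 x a) (hI0 x))
  -- The shifted function is 1 at the idle state and at most 2C₂·Abar elsewhere by `hadm`, so the
  -- sum of the two bounds serves everywhere.
  have hC : ∀ x, ENNReal.ofReal (uStar α C₁ C₂ z x + z) ≤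
      ((1 + 2 * C₂ * Abar).toNNReal : ℝ≥0∞) := fun x => by
    have hA : 0 ≤ Abar :=
      (div_nonneg (u_add_nonneg hα.le hC₁ hC₂.le hz zero_le_one) (by positivity)).trans
        (hadm 1 zero_lt_one le_rfl)
    refine ENNReal.ofReal_le_ofReal ?_
    by_cases hx : x = 0
    · rw [hx, uStar_zero]
      have : 0 ≤ 2 * C₂ * Abar := by positivity
      linarith
    · rw [uStar_of_ne hx]
      have := hadm x (coe_pos_of_ne hx) x.2.2
      rw [div_le_iff₀ (by positivity)] at this
      linarith
  refine CTMDP.isOptimalPolicy_stationaryPolicy (hasJumpKernel hlam.le) (Real.toNNReal_pos.2 hα)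
    (Real.coe_toNNReal α hα.le).symm measurableSet_admissible measurable_cost
    measurable_optimalAction (optimalAction_mem hα hC₁ hC₂ hz hadm)
    (fun x => measurableSet_singleton _)
    (fun π hπ => negativeCost_lt_top hlam hlamα hC₁ hC₂.le hπ) measurable_lyapunov
    ((lintegral_lyapunov_le γ).trans_lt (by simp)).ne
    (fun x a _ => lyapunov_drift hlam.le hlamα x a)
    (v := fun x => ENNReal.ofReal (uStar α C₁ C₂ z x + z))
    (measurable_uStar.add_const z).ennreal_ofReal hC z.toNNReal (fun x a _ => ?_) fun x => ?_
  · rw [hleft, hright, ofReal_neg_add_le_iff (hs0 x a) (ht0 x a)]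
    have := discount_mul_uStar_le (Abar := Abar) hlam hα hC₁ hC₂ hz hstep x a
    rw [integral_rate_eq] at this
    linarith
  · rw [hleft, hright]
    set a := optimalAction α C₁ C₂ z x with ha
    have := discount_mul_uStar_eq (Abar := Abar) hlam hα hC₁ hC₂ hz hstep x
    rw [integral_rate_eq, ← ha] at this
    have h2 := (ofReal_neg_add_le_iff (c := -((model lam α C₁ C₂ Abar).cost x a)) (ht0 x a)
      (hs0 x a)).2 (by linarith)
    rwa [neg_neg] at h2

end

end LossQueue

end

/-! ### Assembly of the theorem -/

theorem theorem5 (lam α C₁ C₂ Abar : ℝ) (hlam : 0 < lam) (hα : 4 * lam < α)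
    (hC₁ : 0 ≤ C₁) (hC₂ : 0 ≤ C₂) (hAbar : 0 ≤ Abar)
    (γ : Measure unitInterval) (hγ : IsProbabilityMeasure γ)
    (hγ_int : ∫⁻ y in {y : unitInterval | y ≠ 0}, ENNReal.ofReal (1 / (y : ℝ) ^ 4) ∂γ < ⊤) :
    -- (a) the model is a CTMDP and satisfies all the conditions
    ((LossQueue.model lam α C₁ C₂ Abar).IsModel ∧
      ∃ (w w' : unitInterval → ℝ) (ρ b L' ρ' b' : ℝ),
        (LossQueue.model lam α C₁ C₂ Abar).RegularityCondition w ρ b ∧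
        (LossQueue.model lam α C₁ C₂ Abar).FinitenessCondition γ w ρ ∧
        (LossQueue.model lam α C₁ C₂ Abar).ExitRateCondition ∧
        (LossQueue.model lam α C₁ C₂ Abar).StrongRegularityCondition w ∧
        (LossQueue.model lam α C₁ C₂ Abar).DynamicProgrammingCondition w w' L' ρ' b' ∧
        (LossQueue.model lam α C₁ C₂ Abar).CompactnessContinuityCondition w) ∧
    -- under every policy, the law of the process and the performance functional are well defined
    (∀ π, (LossQueue.model lam α C₁ C₂ Abar).IsPolicy π →
      (∃! P, (LossQueue.model lam α C₁ C₂ Abar).IsControlledLaw γ π P) ∧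
      (LossQueue.model lam α C₁ C₂ Abar).negativeCost γ π < ⊤) ∧
    (C₁ / (2 * α) ≤ 1 →
      -- (b) convergence of the recursion
      StrictMono (LossQueue.zSeq lam α C₁ C₂) ∧
      ∃ z : ℝ, Tendsto (LossQueue.zSeq lam α C₁ C₂) atTop (𝓝 z) ∧
        (∀ x : ℝ, 0 < x → x ≤ 1 →
          Tendsto (fun n => LossQueue.u α C₁ C₂ x (LossQueue.zSeq lam α C₁ C₂ n)) atTop
            (𝓝 (LossQueue.u α C₁ C₂ x z))) ∧
        -- (c) the Bellman equation and the optimal policy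
        (0 < C₂ →
          (∀ x : ℝ, 0 < x → x ≤ 1 → (LossQueue.u α C₁ C₂ x z + z) / (2 * C₂) ≤ Abar) →
          (LossQueue.model lam α C₁ C₂ Abar).SolvesBellman (LossQueue.uStar α C₁ C₂ z) ∧
          ∃ φ : unitInterval → ℝ≥0, φ 0 = 0 ∧
            (∀ x : unitInterval, x ≠ 0 →
              (φ x : ℝ) = (LossQueue.uStar α C₁ C₂ z x + z) / (2 * (x : ℝ) * C₂)) ∧
            Measurable φ ∧
            (∀ x, φ x ∈ (LossQueue.model lam α C₁ C₂ Abar).admissible x) ∧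
            (LossQueue.model lam α C₁ C₂ Abar).IsOptimalPolicy γ
              (CTMDP.stationaryPolicy φ))) := by
  have hα0 : 0 < α := by linarith
  have hM := LossQueue.hasJumpKernel (α := α) (C₁ := C₁) (C₂ := C₂) (Abar := Abar) hlam.le
  refine ⟨⟨LossQueue.isModel hAbar hlam.le hα0, LossQueue.weight 4, LossQueue.weight 2, 0, 4 * lam,
    Abar + lam + 1, 0, 4 * lam, LossQueue.regularityCondition hAbar hlam.le,
    ⟨LossQueue.integrable_weight_four_of_lintegral hγ_int, hα0,
      LossQueue.costBound hAbar hC₁ hC₂ (by norm_num)⟩,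
    LossQueue.exitRateCondition, LossQueue.strongRegularityCondition hAbar hlam.le,
    LossQueue.dynamicProgrammingCondition hAbar hlam.le hα0 hC₁ hC₂,
    LossQueue.compactnessContinuityCondition⟩,
    fun π hπ => ⟨CTMDP.existsUnique_isControlledLaw hM hπ γ,
      LossQueue.negativeCost_lt_top hlam (by linarith) hC₁ hC₂ hπ⟩, fun hC => ?_⟩
  obtain ⟨z, hlim, hz, hstep⟩ := LossQueue.exists_tendsto_zSeq hlam hα hC₁ hC₂ hC
  refine ⟨LossQueue.strictMono_zSeq hlam hα hC₁ hC₂ hC, z, hlim, fun x _ _ => ?_,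
    fun hC₂' hadm => ⟨LossQueue.solvesBellman hlam hα0 hC₁ hC₂' hz hstep hadm,
      LossQueue.optimalAction α C₁ C₂ z, LossQueue.optimalAction_zero,
      fun x hx => LossQueue.coe_optimalAction hα0 hC₁ hC₂' hz hx,
      LossQueue.measurable_optimalAction,
      LossQueue.optimalAction_mem hα0 hC₁ hC₂' hz hadm,
      LossQueue.isOptimalPolicy_optimalAction hlam hα0 hC₁ hC₂' hz hstep hadm (by linarith) γ⟩⟩
  have hcont : Continuous fun t => LossQueue.u α C₁ C₂ x t :=
    LossQueue.continuous_u.comp (by fun_prop : Continuous fun t : ℝ => (x, t))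
  exact (hcont.tendsto z).comp hlim
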